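/- **Setting.** Let $d\ge 2$ and let $\Omega\subset\mathbb R^d$ be a nonempty, open, bounded and convex set with smooth boundary, $n(x)$ its outer unit normal at $x\in\partial\Omega$, $d\lambda$ the surface measure of $\partial\Omega$, and $d\omega$ the rotation invariant measure on $\mathbb S^{d-1}$ with total mass $1$. Put $S\Omega=\Omega\times\mathbb S^{d-1}$, $S\Omega_T=(0,T)\times S\Omega$ and $\partial_\pm S\Omega_T=(0,T)\times\{(x,v)\in\partial\Omega\times\mathbb S^{d-1}:\pm n(x)\cdot v>0\}$. The norm of $L^2(S\Omega)$ is taken with respect to $dx\,d\omega(v)$ and that of $L^2(\partial_+S\Omega_T)$ with respect to $(n(x)\cdot v)\,dt\,d\lambda(x)\,d\omega(v)$. Fix a unit vector $\gamma\in\mathbb R^d$ and numbers $0<\beta<\gamma_0$, and put $$V=\{v\in\mathbb S^{d-1}:\gamma\cdot v\ge\gamma_0\},\qquad B(v)=\gamma\cdot v-\beta .$$ Let $T>\operatorname{diam}\Omega$ and $T>\beta^{-1}\bigl(\max_{x\in\overline\Omega}\gamma\cdot x-\min_{x\in\overline\Omega}\gamma\cdot x\bigr)$. All functions are real-valued and measurable,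 derivatives are weak derivatives, (in)equalities hold almost everywhere, and values at $t=0$ and on $\partial_\pm S\Omega_T$ are traces. **Theorem.** For all constants $c_1,c_2,c_3>0$ and $M,m$ there is a constant $C>0$, depending only on these constants and on $\Omega,T,\gamma,\gamma_0,\beta$, such that the following holds. Let $\sigma\in L^\infty(S\Omega)$ and $\mu\in L^\infty(\Omega\times\mathbb S^{d-1}\times\mathbb S^{d-1})$ satisfy $0\le\sigma\le M$, $0\le\mu\le m$ and $$\int_{\mathbb S^{d-1}}\mu(x,v,v')\,d\omega(v')\le\sigma(x,v),\qquad \int_{\mathbb S^{d-1}}\mu(x,v',v)\,d\omega(v')\le\sigma(x,v)\qquad\text{for a.e. }(x,v)\in S\Omega .$$ Assume that, for some $\gamma_1,C_\sigma,C_\mu>0$, $$B(v)^{-1}|\sigma(x,v)|\le C_\sigma\ \text{ for a.e. }(x,v)\in S\Omega\text{ with }|\gamma\cdot v-\beta|\le\gamma_1,\qquad \int_{\mathbb S^{d-1}}|B(v')|^{-2}|\mu(x,v',v)|^2\,d\omega(v')\le C_\mu\ \text{ for a.e. }(x,v)\in S\Omega ,$$ and that $\mu(x,v',v)=0$ for $v\notin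 V$. Let $f_0,\ v\cdot\nabla_xf_0,\ (v\cdot\nabla_x)^2f_0\in L^\infty(S\Omega)$ with $f_0(x,v)=0$ for $v\notin V$. Let $\widetilde S\in L^\infty(S\Omega)$ satisfy $\widetilde S(x,v)=\widetilde S(x,-v)$, and $\widetilde S(x,v)=0$ whenever $|\gamma\cdot v|\le\gamma_0$. Let $S_0$ satisfy $\|S_0\|_{L^\infty(S\Omega_T)}\le c_3$ and $\|\partial_tS_0\|_{L^\infty(S\Omega_T)}\le c_3$, with $c_1\le S_0(0,x,v)\le c_2$ for $(x,v)\in\Omega\times V$ and $S_0(0,x,v)=0$ for $v\notin V$. Let $f\in H^2(0,T;L^2(S\Omega))$ with $v\cdot\nabla_xf\in H^1(0,T;L^2(S\Omega))$ solve $$\partial_tf+v\cdot\nabla_xf+\sigma f=\int_{\mathbb S^{d-1}}\mu(x,v',v)f(t,x,v')\,d\omega(v')+\widetilde S(x,v)S_0(t,x,v)\quad\text{in }S\Omega_T,$$ $$f=f_0\ \text{ on }\{0\}\times S\Omega,\qquad f=0\ \text{ on }\partial_-S\Omega_T .$$ Then $$\|\widetilde S\|_{L^2(S\Omega)}\le C\left(\|\partial_tf\|_{L^2(\partial_+S\Omega_T)}+\|f_0\|_{L^2(S\Omega)}+\|v\cdot\nabla_xf_0\|_{L^2(S\Omega)}\right).$$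 -/

import Mathlib

open MeasureTheory Set Filter Topology
open scoped ContDiff ENNReal

noncomputable section

namespace InverseTransport

/-- Euclidean space of dimension `d`. -/
abbrev Euc (d : ℕ) : Type := EuclideanSpace ℝ (Fin d)

/-- The unit sphere of `Euc d`, the set of velocities. -/
abbrev Sph (d : ℕ) : Type := Metric.sphere (0 : Euc d) 1

variable {d : ℕ}

/-! ### Measures -/

/-- The rotation invariant measure on the unit sphere, normalized to total mass one. -/
def sphereMeasure (d : ℕ) : Measure (Sph d) :=
  ((volume : Measure (Euc d)).toSphere univ)⁻¹ • (volume : Measure (Euc d)).toSphere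

/-- The measure `dx dω(v)` on `Ω × S`. -/
def phaseMeasure (Ω : Set (Euc d)) : Measure (Euc d × Sph d) :=
  (volume.restrict Ω).prod (sphereMeasure d)

/-- The measure `dx dω(v') dω(v)` on `Ω × S × S`. -/
def scatteringMeasure (Ω : Set (Euc d)) : Measure (Euc d × Sph d × Sph d) :=
  (volume.restrict Ω).prod ((sphereMeasure d).prod (sphereMeasure d))

/-- The measure `dt dx dω(v)` on `(0,T) × Ω × S`. -/
def phaseTimeMeasure (Ω : Set (Euc d)) (T : ℝ) : Measure (ℝ × Euc d × Sph d) :=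
  (volume.restrict (Ioo 0 T)).prod (phaseMeasure Ω)

/-! ### Smooth boundary and outer normal -/

/-- `ρ` is a smooth defining function of `Ω` near its boundary point `x`. -/
structure IsLocalDefiningFunction (Ω : Set (Euc d)) (x : Euc d) (ρ : Euc d → ℝ) : Prop where
  smooth : ContDiff ℝ ∞ ρ
  zero : ρ x = 0
  gradient_ne : gradient ρ x ≠ 0
  mem_iff : ∀ᶠ y in 𝓝 x, (y ∈ Ω ↔ ρ y < 0)

/-- `Ω` has a smooth boundary. -/
def HasSmoothBoundary (Ω : Set (Euc d)) : Prop :=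
  ∀ x ∈ frontier Ω, ∃ ρ, IsLocalDefiningFunction Ω x ρ

/-- `n` is the outer unit normal of `Ω` at `x`. -/
def IsOuterUnitNormal (Ω : Set (Euc d)) (x n : Euc d) : Prop :=
  ∃ ρ, IsLocalDefiningFunction Ω x ρ ∧ n = ‖gradient ρ x‖⁻¹ • gradient ρ x

/-- The outer unit normal `n(x)`, meaningful at the points `x` of a smooth boundary. -/
def outerNormal (Ω : Set (Euc d)) (x : Euc d) : Euc d :=
  Classical.epsilon (IsOuterUnitNormal Ω x)

/-- The measure `dt dλ(x) dω(v)` on `(0,T) × ∂Ω × S`, where `λ` is the surface measure, i.e. the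
`(d-1)`-dimensional Hausdorff measure, normalized as Lebesgue measure in dimension `d-1`. -/
def boundaryMeasure (Ω : Set (Euc d)) (T : ℝ) : Measure (ℝ × Euc d × Sph d) :=
  (volume.restrict (Ioo 0 T)).prod
    ((((Measure.euclideanHausdorffMeasure (d - 1) : Measure (Euc d)).restrict (frontier Ω))).prod
      (sphereMeasure d))

/-- The measure `(n(x) · v) dt dλ(x) dω(v)` on the outgoing boundary
`(0,T) × {(x,v) : x ∈ ∂Ω, n(x) · v > 0}`. -/
def outgoingMeasure (Ω : Set (Euc d)) (T : ℝ) : Measure (ℝ × Euc d × Sph d) :=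
  ((boundaryMeasure Ω T).restrict
      {p | 0 < inner ℝ (outerNormal Ω p.2.1) (p.2.2 : Euc d)}).withDensity
    fun p => ENNReal.ofReal (inner ℝ (outerNormal Ω p.2.1) (p.2.2 : Euc d))

/-! ### Weak derivatives

The test functions on `(0,T) × Ω × S` (resp. `Ω × S`) are the restrictions of the smooth functions
on `ℝ × ℝᵈ × ℝᵈ` (resp. `ℝᵈ × ℝᵈ`) with compact support in `(0,T) × Ω × ℝᵈ` (resp. `Ω × ℝᵈ`). -/

def IsTestFunction (Ω : Set (Euc d)) (ψ : Euc d × Euc d → ℝ) : Prop :=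
  ContDiff ℝ ∞ ψ ∧ HasCompactSupport ψ ∧ tsupport ψ ⊆ Ω ×ˢ univ

def IsTimeTestFunction (Ω : Set (Euc d)) (T : ℝ) (ψ : ℝ × Euc d × Euc d → ℝ) : Prop :=
  ContDiff ℝ ∞ ψ ∧ HasCompactSupport ψ ∧ tsupport ψ ⊆ Ioo 0 T ×ˢ Ω ×ˢ univ

/-- `g = v · ∇ₓ f` weakly on `Ω × S`. -/
def HasWeakTransportDeriv (Ω : Set (Euc d)) (f g : Euc d × Sph d → ℝ) : Prop :=
  ∀ ψ, IsTestFunction Ω ψ →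
    ∫ p, f p * fderiv ℝ ψ (p.1, (p.2 : Euc d)) ((p.2 : Euc d), 0) ∂phaseMeasure Ω
      = -∫ p, g p * ψ (p.1, (p.2 : Euc d)) ∂phaseMeasure Ω

/-- `g = v · ∇ₓ f` weakly on `(0,T) × Ω × S`. -/
def HasWeakTransportDerivT (Ω : Set (Euc d)) (T : ℝ) (f g : ℝ × Euc d × Sph d → ℝ) : Prop :=
  ∀ ψ, IsTimeTestFunction Ω T ψ →
    ∫ p, f p * fderiv ℝ ψ (p.1, p.2.1, (p.2.2 : Euc d)) (0, (p.2.2 : Euc d), 0)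
        ∂phaseTimeMeasure Ω T
      = -∫ p, g p * ψ (p.1, p.2.1, (p.2.2 : Euc d)) ∂phaseTimeMeasure Ω T

/-- `g = ∂ₜ f` weakly on `(0,T) × Ω × S`. -/
def HasWeakTimeDeriv (Ω : Set (Euc d)) (T : ℝ) (f g : ℝ × Euc d × Sph d → ℝ) : Prop :=
  ∀ ψ, IsTimeTestFunction Ω T ψ →
    ∫ p, f p * fderiv ℝ ψ (p.1, p.2.1, (p.2.2 : Euc d)) (1, 0, 0) ∂phaseTimeMeasure Ω T
      = -∫ p, g p * ψ (p.1, p.2.1, (p.2.2 : Euc d)) ∂phaseTimeMeasure Ω T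

/-! ### Traces

A function with an integrable weak derivative in a direction is absolutely continuous along almost
every line of that direction, up to a null set of the line. Its traces are the one-sided essential
limits along these lines; they do not depend on the representative, up to null sets. -/

/-- One-sided limits at `0` that ignore Lebesgue null sets. -/
def essRight : Filter ℝ := 𝓝[>] (0 : ℝ) ⊓ ae volume

/-- `f(0,·,·) = g` in the sense of traces. -/
def HasInitialValue (Ω : Set (Euc d)) (f : ℝ × Euc d × Sph d → ℝ) (g : Euc d × Sph d → ℝ) :
    Prop :=
  ∀ᵐ q ∂phaseMeasure Ω, Tendsto (fun t => f (t, q)) essRight (𝓝 (g q))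

/-- `f = 0` on the incoming boundary `(0,T) × {(x,v) : x ∈ ∂Ω, n(x) · v < 0}`
in the sense of traces. -/
def VanishesOnIncoming (Ω : Set (Euc d)) (T : ℝ) (f : ℝ × Euc d × Sph d → ℝ) : Prop :=
  ∀ᵐ p ∂boundaryMeasure Ω T, inner ℝ (outerNormal Ω p.2.1) (p.2.2 : Euc d) < 0 →
    Tendsto (fun s : ℝ => f (p.1, p.2.1 + s • (p.2.2 : Euc d), p.2.2)) essRight (𝓝 0)

/-- The trace of `f` on the outgoing boundary. The limit exists almost everywhere there
if `f` and `v · ∇ₓ f` are square integrable. -/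
def outgoingTrace (f : ℝ × Euc d × Sph d → ℝ) (p : ℝ × Euc d × Sph d) : ℝ :=
  limUnder essRight fun s : ℝ => f (p.1, p.2.1 - s • (p.2.2 : Euc d), p.2.2)

/-! ### The transport problem -/

/-- The scattering operator, with `μ = μ(x, v', v)`. -/
def scattering (μ : Euc d × Sph d × Sph d → ℝ) (f : ℝ × Euc d × Sph d → ℝ)
    (p : ℝ × Euc d × Sph d) : ℝ :=
  ∫ v', μ (p.2.1, v', p.2.2) * f (p.1, p.2.1, v') ∂sphereMeasure d

/-- `σ ∈ L^∞(Ω × S)` and `μ ∈ L^∞(Ω × S × S)` are nonnegative, bounded by `M` and `m`, and the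
absorption dominates the scattering. -/
structure IsAdmissiblePair (Ω : Set (Euc d)) (M m : ℝ) (σ : Euc d × Sph d → ℝ)
    (μ : Euc d × Sph d × Sph d → ℝ) : Prop where
  sigma_meas : AEStronglyMeasurable σ (phaseMeasure Ω)
  sigma_bound : ∀ᵐ q ∂phaseMeasure Ω, 0 ≤ σ q ∧ σ q ≤ M
  mu_meas : AEStronglyMeasurable μ (scatteringMeasure Ω)
  mu_bound : ∀ᵐ r ∂scatteringMeasure Ω, 0 ≤ μ r ∧ μ r ≤ m
  integral_right_le : ∀ᵐ q ∂phaseMeasure Ω, ∫ v', μ (q.1, q.2, v') ∂sphereMeasure d ≤ σ q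
  integral_left_le : ∀ᵐ q ∂phaseMeasure Ω, ∫ v', μ (q.1, v', q.2) ∂sphereMeasure d ≤ σ q

/-- `f` solves `∂ₜf + v · ∇ₓf + σ f = K f + S` in `(0,T) × Ω × S`, `f = f₀` at `t = 0`, `f = 0` on
the incoming boundary, with `f ∈ H²(0,T;L²(Ω × S))` and `v · ∇ₓf ∈ H¹(0,T;L²(Ω × S))`. The
functions `ft, ftt, Xf, Xft` are `∂ₜf`, `∂ₜ²f`, `v · ∇ₓf`, `∂ₜ(v · ∇ₓf)`. -/
structure IsSolution (Ω : Set (Euc d)) (T : ℝ) (σ : Euc d × Sph d → ℝ)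
    (μ : Euc d × Sph d × Sph d → ℝ) (S : ℝ × Euc d × Sph d → ℝ) (f₀ : Euc d × Sph d → ℝ)
    (f ft ftt Xf Xft : ℝ × Euc d × Sph d → ℝ) : Prop where
  memLp_f : MemLp f 2 (phaseTimeMeasure Ω T)
  memLp_ft : MemLp ft 2 (phaseTimeMeasure Ω T)
  memLp_ftt : MemLp ftt 2 (phaseTimeMeasure Ω T)
  memLp_Xf : MemLp Xf 2 (phaseTimeMeasure Ω T)
  memLp_Xft : MemLp Xft 2 (phaseTimeMeasure Ω T)
  deriv_ft : HasWeakTimeDeriv Ω T f ft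
  deriv_ftt : HasWeakTimeDeriv Ω T ft ftt
  deriv_Xf : HasWeakTransportDerivT Ω T f Xf
  deriv_Xft : HasWeakTimeDeriv Ω T Xf Xft
  equation : ∀ᵐ p ∂phaseTimeMeasure Ω T, ft p + Xf p + σ p.2 * f p = scattering μ f p + S p
  initial : HasInitialValue Ω f f₀
  incoming : VanishesOnIncoming Ω T f

/-! ### The velocity set and the weight -/

/-- `V = {v ∈ S : γ · v ≥ γ₀}`. -/
def velocitySet (γ : Euc d) (γ₀ : ℝ) : Set (Sph d) := {v | γ₀ ≤ inner ℝ γ (v : Euc d)}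

/-- `B(v) = γ · v - β`. -/
def weightB (γ : Euc d) (β : ℝ) (v : Sph d) : ℝ := inner ℝ γ (v : Euc d) - β

/-- The width `max γ · x - min γ · x` of the closure of `Ω` in the direction `γ`. -/
def width (γ : Euc d) (Ω : Set (Euc d)) : ℝ :=
  sSup ((fun x => inner ℝ γ x) '' closure Ω) - sInf ((fun x => inner ℝ γ x) '' closure Ω)

end InverseTransport

end

open scoped NNReal
set_option linter.unusedSectionVars false

noncomputable section

namespace InverseTransport

/-! ### Volume swept by translating a nearly flat set -/

section

variable {d : ℕ}

/-! The argument is of Bukhgeim–Klibanov type. The function U = ∂ₜf solves the same transport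
problem with source `Stil` ∂ₜS₀, vanishes on the incoming boundary, and has the initial value u₀ =
`Stil` S₀(0) + R, where R = ∫ μ f₀ − v·∇f₀ − σ f₀ is controlled by the data. Since S₀(0) ≥ c₁ on V,
a bound for u₀ on V bounds `Stil` there. Evenness of `Stil` and its vanishing for |γ·v| ≤ γ₀ carry
the bound to all velocities (`phaseEnergy_source_le`).

The weight is w = exp(2s(γ·x − βt)), whose derivative along ∂ₜ + v·∇ is 2sB(v)w. On V one has B ≥ γ₀
− β > 0, and integrating the derivative of U²w gives the Carleman estimate `carleman_le`: the energy
of u₀ on V is bounded by the final energy on V, the outflow, the scattered energy of all velocities,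
and a source term with a factor of order 1/s. These terms are treated as follows. The final weight
is smaller than every initial weight by a factor exponentially small in s, because βT exceeds the
width of Ω, whereas the unweighted energy grows by a factor independent of s
(`integral_sq_final_le`). The scattered energy coming from V is absorbed on the left for large s.
Nothing is scattered into the velocities outside V. For γ·v ≤ −γ₀ the weight decays at a rate of
order s, which leaves R and a source term of order s⁻² (`timeEnergy_opposite_le`). For |γ·v| < γ₀
there is no source, and an ordinary energy estimate leaves R alone (`timeEnergy_transversal_le`).
All multiples of the energy of `Stil` on the right are then absorbed by taking s large
(`stability_of_estimates`).

The rest gives this a meaning for weak solutions whose traces are essential limits. A weak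
derivative along a measure preserving straight flow determines increments on almost every line
(`ae_sub_eq_intervalIntegral_of_weakDeriv`). The differentiated problem is obtained in
`exists_isDerivedSolution` by writing everything as a primitive in time: an identity c + ∫₀ᵗ H = 0
forces c = 0 and H = 0. The energy identities come from time segments and from chords of Ω
separately. Chord integrals are averaged over the phase space (`integral_chord_average`), so that
the outflow becomes an integral over (0,T) × Ω × S. It is compared with the surface integral in
`lintegral_chord_sq_le`. The geometric input is `HasSmoothBoundary.volume_translates_le`: the
cylinder swept by a boundary piece A moving along v has volume at most ∫_A |n·v| dλ. -/

theorem euclideanHausdorffMeasure_image_le {X Y : Type*} [EMetricSpace X] [MeasurableSpace X]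
    [BorelSpace X] [EMetricSpace Y] [MeasurableSpace Y] [BorelSpace Y] {K : ℝ≥0} {f : X → Y}
    {s : Set X} (hf : LipschitzOnWith K f s) (j : ℕ) :
    (Measure.euclideanHausdorffMeasure j : Measure Y) (f '' s) ≤
      (K : ℝ≥0∞) ^ j * (Measure.euclideanHausdorffMeasure j : Measure X) s := by
  rw [Measure.euclideanHausdorffMeasure_def, Measure.euclideanHausdorffMeasure_def]
  simp only [Measure.smul_apply, ENNReal.smul_def, smul_eq_mul]
  rw [mul_left_comm]
  gcongr
  simpa using hf.hausdorffMeasure_image_le (d := (j : ℝ)) (by positivity)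

theorem finrank_orthogonal_span (n : Euc d) (hn : ‖n‖ = 1) :
    Module.finrank ℝ (ℝ ∙ n)ᗮ = d - 1 := by
  have h := (ℝ ∙ n).finrank_add_finrank_orthogonal
  rw [finrank_span_singleton (by rintro rfl; simp at hn), finrank_euclideanSpace_fin] at h
  omega

/-- The volume of a right cylinder of height one over a hyperplane. -/
theorem volume_orthogonal_cylinder (n : Euc d) (hn : ‖n‖ = 1) (B : Set (ℝ ∙ n)ᗮ) :
    volume {z : Euc d | (ℝ ∙ n)ᗮ.orthogonalProjectionOnto z ∈ B ∧ inner ℝ n z ∈ Ioo (0 : ℝ) 1} =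
      (Measure.euclideanHausdorffMeasure (d - 1) : Measure (ℝ ∙ n)ᗮ) B := by
  have hmp := (ℝ ∙ n).measurePreserving_measurableEquivProd (0 : Euc d)
  rw [InnerProductSpace.euclideanHausdorffMeasure_eq_volume] at hmp
  let e : ℝ ≃ₗᵢ[ℝ] (ℝ ∙ n) := LinearIsometryEquiv.toSpanUnitSingleton n hn
  have he : volume (e '' Ioo (0 : ℝ) 1) = 1 := by
    have := e.symm.measurePreserving.measure_preimage (s := Ioo (0 : ℝ) 1)
      measurableSet_Ioo.nullMeasurableSet
    have him : e '' Ioo (0 : ℝ) 1 = e.symm ⁻¹' Ioo (0 : ℝ) 1 := e.toEquiv.image_eq_preimage_symm _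
    rw [him, this]
    simp
  have hset : {z : Euc d | (ℝ ∙ n)ᗮ.orthogonalProjectionOnto z ∈ B ∧
      inner ℝ n z ∈ Ioo (0 : ℝ) 1} =
      ((ℝ ∙ n).measurableEquivProd (0 : Euc d)) ⁻¹' ((e '' Ioo (0 : ℝ) 1) ×ˢ B) := by
    ext z
    have hz : (ℝ ∙ n).orthogonalProjectionOnto z = e (inner ℝ n z) := by
      apply Subtype.ext
      simp [e, Submodule.coe_orthogonalProjectionOnto_apply, Submodule.starProjection_unit_singleton ℝ hn]
    simp only [mem_ofPred_eq, mem_preimage, Submodule.measurableEquivProd_apply, vsub_eq_sub,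
      sub_zero, mem_prod, hz, e.injective.mem_set_image]
    tauto
  rw [hset, hmp.measure_preimage_equiv, Measure.volume_eq_prod, Measure.prod_prod, he, one_mul,
    ← finrank_orthogonal_span n hn, InnerProductSpace.euclideanHausdorffMeasure_eq_volume]

/-- A set A satisfying the cone condition is a graph over n⊥ with small slope. The swept set is then
the image of the cylinder of height one over the projection of A, under a map that differs by an
ε-Lipschitz error from the linear map fixing n⊥ and sending n to v. That linear map has determinant
n·v, and the projection does not increase the Hausdorff measure. The same ε serves for all A. -/
theorem exists_volume_translates_le (n v : Euc d) (hn : ‖n‖ = 1) (m : ℝ≥0)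
    (hm : ENNReal.ofReal |inner ℝ n v| < m) :
    ∃ ε > (0 : ℝ), ∀ A : Set (Euc d),
      (∀ y ∈ A, ∀ y' ∈ A, |inner ℝ n (y - y')| ≤
        ε * ‖(ℝ ∙ n)ᗮ.orthogonalProjectionOnto (y - y')‖) →
      volume ((fun p : Euc d × ℝ => p.1 + p.2 • v) '' (A ×ˢ Ioo 0 1)) ≤
        m * (Measure.euclideanHausdorffMeasure (d - 1) : Measure (Euc d)) A := by
  let π := (ℝ ∙ n)ᗮ.orthogonalProjectionOnto
  let L : Euc d →L[ℝ] Euc d := ContinuousLinearMap.id ℝ _ +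
    (innerSL ℝ n).smulRight (v - n)
  have hL : ∀ z, L z = z + inner ℝ n z • (v - n) := fun z => by simp [L]
  have hdet : L.det = inner ℝ n v := by
    have : (L : Euc d →ₗ[ℝ] Euc d) =
        LinearMap.transvection (innerSL ℝ n : Euc d →ₗ[ℝ] ℝ) (v - n) := by
      ext z : 1
      simp [L, LinearMap.transvection]
    rw [ContinuousLinearMap.det, this, LinearMap.transvection.det]
    simp [inner_sub_right, hn]
  have hπ : ∀ z : Euc d, (π z : Euc d) = z - inner ℝ n z • n := by
    intro z
    have := (ℝ ∙ n).starProjection_add_starProjection_orthogonal z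
    rw [Submodule.starProjection_unit_singleton ℝ hn] at this
    exact eq_sub_of_add_eq' this
  have := addHaar_image_le_mul_of_det_lt (volume : Measure (Euc d)) L (m := m)
    (by rw [hdet]; exact hm)
  obtain ⟨δ, hδ, hδpos⟩ := (this.and self_mem_nhdsWithin).exists
  refine ⟨δ, hδpos, fun A hA => ?_⟩
  let S : Set (Euc d) := {z | π z ∈ π '' A ∧ inner ℝ n z ∈ Ioo (0 : ℝ) 1}
  -- `g` is a section of the projection over the image of `A`. The cone condition makes the
  -- projection injective on `A`, whence g (π y) = y below.
  choose! g hgA hgπ using (fun (w : (ℝ ∙ n)ᗮ) (h : w ∈ π '' A) => h)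
  have happ : ApproximatesLinearOn (fun z => g (π z) + (inner ℝ n z : ℝ) • v) L S δ := by
    intro z hz z' hz'
    have h1 := hgπ _ hz.1
    have h2 := hgπ _ hz'.1
    have h3 : ((π (g (π z)) : (ℝ ∙ n)ᗮ) : Euc d) = π z := by rw [h1]
    have h4 : ((π (g (π z')) : (ℝ ∙ n)ᗮ) : Euc d) = π z' := by rw [h2]
    rw [hπ, hπ] at h3 h4
    -- Since L z = π z + (n·z) v, the error is exactly the variation of the height of `g` along n.
    have key : g (π z) + (inner ℝ n z : ℝ) • v - (g (π z') + (inner ℝ n z' : ℝ) • v) - L (z - z') =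
        (inner ℝ n (g (π z) - g (π z')) : ℝ) • n := by
      rw [hL, inner_sub_right, inner_sub_right]
      have e1 : g (π z) = (z - (inner ℝ n z : ℝ) • n) + (inner ℝ n (g (π z)) : ℝ) • n := by
        rw [← h3]; abel
      have e2 : g (π z') = (z' - (inner ℝ n z' : ℝ) • n) + (inner ℝ n (g (π z')) : ℝ) • n := by
        rw [← h4]; abel
      generalize (inner ℝ n (g (π z)) : ℝ) = a at *
      generalize (inner ℝ n (g (π z')) : ℝ) = b at *
      rw [e1, e2]
      module
    rw [key, norm_smul, hn, mul_one, Real.norm_eq_abs]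
    refine (hA _ (hgA _ hz.1) _ (hgA _ hz'.1)).trans ?_
    gcongr
    have : (π (g (π z) - g (π z'))) = π (z - z') := by rw [map_sub, h1, h2, map_sub]
    change ‖π (g (π z) - g (π z'))‖ ≤ _
    rw [this]
    exact Submodule.norm_orthogonalProjectionOnto_apply_le _ _
  have himg : (fun p : Euc d × ℝ => p.1 + p.2 • v) '' (A ×ˢ Ioo 0 1) ⊆
      (fun z => g (π z) + (inner ℝ n z : ℝ) • v) '' S := by
    rintro _ ⟨⟨y, s⟩, ⟨hy, hs⟩, rfl⟩
    have hpn : π n = 0 := by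
      apply Subtype.ext
      rw [hπ]; simp [hn]
    have hz : π ((π y : Euc d) + s • n) = π y := by
      rw [map_add, map_smul, hpn, smul_zero, add_zero]
      exact Submodule.orthogonalProjectionOnto_mem_subspace_eq_self _
    have hz2 : (inner ℝ n ((π y : Euc d) + s • n) : ℝ) = s := by
      rw [hπ]; simp [inner_add_right, inner_sub_right, inner_smul_right, hn]
    refine ⟨(π y : Euc d) + s • n, ⟨?_, ?_⟩, ?_⟩
    · rw [hz]; exact mem_image_of_mem _ hy
    · rw [hz2]; exact hs
    · simp only [hz, hz2]
      congr 1
      have hyA : π y ∈ π '' A := mem_image_of_mem _ hy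
      have h0 := hA _ (hgA _ hyA) _ hy
      have hp0 : π (g (π y) - y) = 0 := by rw [map_sub, hgπ _ hyA, sub_self]
      change _ ≤ _ * ‖π (g (π y) - y)‖ at h0
      rw [hp0, norm_zero, mul_zero] at h0
      have h5 : ((π (g (π y) - y) : (ℝ ∙ n)ᗮ) : Euc d) = 0 := by rw [hp0]; rfl
      rw [hπ, abs_nonpos_iff.mp h0, zero_smul, sub_zero] at h5
      exact sub_eq_zero.mp h5
  calc _ ≤ volume ((fun z => g (π z) + (inner ℝ n z : ℝ) • v) '' S) := measure_mono himg
    _ ≤ m * volume S := hδ S _ happ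
    _ = m * (Measure.euclideanHausdorffMeasure (d - 1) : Measure (ℝ ∙ n)ᗮ) (π '' A) := by
        rw [← volume_orthogonal_cylinder n hn]
    _ ≤ _ := by
        gcongr
        simpa using euclideanHausdorffMeasure_image_le
          ((ℝ ∙ n)ᗮ.lipschitzWith_orthogonalProjectionOnto.lipschitzOnWith (s := A)) (d - 1)

/-- With slope at most one the section of the projection is 2-Lipschitz, so A lies in a Lipschitz
image of a bounded subset of a hyperplane. -/
theorem euclideanHausdorffMeasure_lt_top_of_cone (n : Euc d) (hn : ‖n‖ = 1) (A : Set (Euc d))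
    (hA : Bornology.IsBounded A)
    (hcone : ∀ y ∈ A, ∀ y' ∈ A, |inner ℝ n (y - y')| ≤
        ‖(ℝ ∙ n)ᗮ.orthogonalProjectionOnto (y - y')‖) :
    (Measure.euclideanHausdorffMeasure (d - 1) : Measure (Euc d)) A < ⊤ := by
  let π := (ℝ ∙ n)ᗮ.orthogonalProjectionOnto
  choose! g hgA hgπ using (fun (w : (ℝ ∙ n)ᗮ) (h : w ∈ π '' A) => h)
  have hnorm : ∀ z : Euc d, ‖z‖ ≤ ‖π z‖ + |inner ℝ n z| := by
    intro z
    have := (ℝ ∙ n).starProjection_add_starProjection_orthogonal z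
    rw [Submodule.starProjection_unit_singleton ℝ hn] at this
    calc ‖z‖ = ‖(inner ℝ n z : ℝ) • n + (ℝ ∙ n)ᗮ.starProjection z‖ := by rw [this]
      _ ≤ _ := by
        refine (norm_add_le _ _).trans ?_
        rw [norm_smul, hn, mul_one, add_comm]
        rfl
  have hlip : LipschitzOnWith 2 g (π '' A) := by
    refine LipschitzOnWith.of_dist_le_mul fun w hw w' hw' => ?_
    rw [dist_eq_norm, dist_eq_norm]
    have h1 := hcone _ (hgA _ hw) _ (hgA _ hw')
    have h2 := hnorm (g w - g w')
    change _ ≤ ‖π (g w - g w')‖ at h1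
    have h3 : π (g w - g w') = w - w' := by rw [map_sub, hgπ _ hw, hgπ _ hw']
    rw [h3] at h1 h2
    simp only [NNReal.coe_ofNat]
    linarith
  have himg : A ⊆ g '' (π '' A) := by
    intro y hy
    have hyA : π y ∈ π '' A := mem_image_of_mem _ hy
    refine ⟨π y, hyA, ?_⟩
    have h1 := hcone _ (hgA _ hyA) _ hy
    have h2 := hnorm (g (π y) - y)
    change _ ≤ ‖π (g (π y) - y)‖ at h1
    have h3 : π (g (π y) - y) = 0 := by rw [map_sub, hgπ _ hyA, sub_self]
    rw [h3, norm_zero] at h1 h2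
    exact sub_eq_zero.mp (norm_le_zero_iff.mp (by linarith))
  refine (measure_mono himg).trans_lt ((euclideanHausdorffMeasure_image_le hlip _).trans_lt ?_)
  refine ENNReal.mul_lt_top (ENNReal.pow_lt_top ENNReal.coe_lt_top) ?_
  rw [← finrank_orthogonal_span n hn, InnerProductSpace.euclideanHausdorffMeasure_eq_volume]
  refine Bornology.IsBounded.measure_lt_top ?_
  exact π.lipschitz.isBounded_image hA

end

/-! ### Outer normals and flatness of a smooth boundary -/

section

variable {d : ℕ}

theorem norm_le_norm_orthogonalProjectionOnto_add (n : Euc d) (hn : ‖n‖ = 1) (z : Euc d) :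
    ‖z‖ ≤ ‖(ℝ ∙ n)ᗮ.orthogonalProjectionOnto z‖ + |inner ℝ n z| := by
  have := (ℝ ∙ n).starProjection_add_starProjection_orthogonal z
  rw [Submodule.starProjection_unit_singleton ℝ hn] at this
  calc ‖z‖ = ‖(inner ℝ n z : ℝ) • n + (ℝ ∙ n)ᗮ.starProjection z‖ := by rw [this]
    _ ≤ _ := by
      refine (norm_add_le _ _).trans ?_
      rw [norm_smul, hn, mul_one, add_comm]
      rfl

namespace IsLocalDefiningFunction

variable {Ω : Set (Euc d)} {x : Euc d} {ρ : Euc d → ℝ}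

theorem hasStrictFDerivAt (h : IsLocalDefiningFunction Ω x ρ) :
    HasStrictFDerivAt ρ (innerSL ℝ (gradient ρ x)) x := by
  have h1 := h.smooth.contDiffAt.hasStrictFDerivAt (x := x) (by simp)
  have h2 := ((h.smooth.differentiable (by simp)) x).hasGradientAt.hasFDerivAt
  rw [h2.fderiv] at h1
  exact h1

/-- A frontier point of an open set is outside it, where ρ ≥ 0, and is a limit of points inside,
where ρ < 0. -/
theorem eventually_eq_zero (h : IsLocalDefiningFunction Ω x ρ) (hΩ : IsOpen Ω) :
    ∀ᶠ y in 𝓝 x, y ∈ frontier Ω → ρ y = 0 := by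
  filter_upwards [eventually_eventually_nhds.mpr h.mem_iff] with y hy hyf
  have hyn : y ∉ Ω := by rw [hΩ.frontier_eq] at hyf; exact hyf.2
  refine le_antisymm ?_ (not_lt.mp (mt hy.self_of_nhds.mpr hyn))
  have hcl : y ∈ closure Ω := frontier_subset_closure hyf
  have := mem_closure_iff_nhdsWithin_neBot.mp hcl
  refine le_of_tendsto (h.smooth.continuous.continuousWithinAt (s := Ω) (x := y)) ?_
  filter_upwards [hy.filter_mono nhdsWithin_le_nhds, self_mem_nhdsWithin] with z hz hzΩ
  exact (hz.mp hzΩ).le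

theorem of_frontier (h : IsLocalDefiningFunction Ω x ρ) (hΩ : IsOpen Ω) :
    ∀ᶠ y in 𝓝 x, y ∈ frontier Ω → IsLocalDefiningFunction Ω y ρ := by
  have hg : Continuous (gradient ρ) := by
    have := h.smooth.continuous_fderiv (by simp)
    exact (InnerProductSpace.toDual ℝ (Euc d)).symm.continuous.comp this
  filter_upwards [h.eventually_eq_zero hΩ, eventually_eventually_nhds.mpr h.mem_iff,
    hg.continuousAt.eventually_ne h.gradient_ne] with y h1 h2 h3 hy
  exact ⟨h.smooth, h1 hy, h3, h2⟩

theorem tendsto_slope (h : IsLocalDefiningFunction Ω x ρ) (w : Euc d) :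
    Tendsto (fun t : ℝ => t⁻¹ * ρ (x + t • w)) (𝓝[>] 0) (𝓝 (inner ℝ (gradient ρ x) w)) := by
  have hd : HasDerivAt (fun t : ℝ => ρ (x + t • w)) (inner ℝ (gradient ρ x) w) 0 := by
    have h1 : HasDerivAt (fun t : ℝ => x + t • w) w 0 := by
      simpa using ((hasDerivAt_id (0 : ℝ)).smul_const w).const_add x
    have h2 := h.hasStrictFDerivAt.hasFDerivAt
    exact h2.comp_hasDerivAt_of_eq (0 : ℝ) h1 (by simp)
  have := (hasDerivAt_iff_tendsto_slope.mp hd).mono_left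
    (nhdsWithin_mono (0 : ℝ) (fun t (ht : 0 < t) => ht.ne'))
  refine this.congr fun t => ?_
  simp [slope_def_field, h.zero, div_eq_inv_mul]

theorem eventually_mem (h : IsLocalDefiningFunction Ω x ρ) {w : Euc d}
    (hw : inner ℝ (gradient ρ x) w < 0) : ∀ᶠ t : ℝ in 𝓝[>] 0, x + t • w ∈ Ω := by
  have hc : Tendsto (fun t : ℝ => x + t • w) (𝓝[>] 0) (𝓝 x) := by
    have : Continuous (fun t : ℝ => x + t • w) := by fun_prop
    simpa using (this.tendsto 0).mono_left nhdsWithin_le_nhds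
  filter_upwards [(h.tendsto_slope w).eventually_lt_const hw, hc.eventually h.mem_iff,
    self_mem_nhdsWithin] with t ht1 ht2 ht3
  exact ht2.mpr (neg_of_mul_neg_right ht1 (inv_pos.mpr ht3).le)

theorem eventually_notMem (h : IsLocalDefiningFunction Ω x ρ) {w : Euc d}
    (hw : 0 < inner ℝ (gradient ρ x) w) : ∀ᶠ t : ℝ in 𝓝[>] 0, x + t • w ∉ Ω := by
  have hc : Tendsto (fun t : ℝ => x + t • w) (𝓝[>] 0) (𝓝 x) := by
    have : Continuous (fun t : ℝ => x + t • w) := by fun_prop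
    simpa using (this.tendsto 0).mono_left nhdsWithin_le_nhds
  filter_upwards [(h.tendsto_slope w).eventually_const_lt hw, hc.eventually h.mem_iff,
    self_mem_nhdsWithin] with t ht1 ht2 ht3
  rw [ht2, not_lt]
  exact ((mul_pos_iff_of_pos_left (inv_pos.mpr ht3)).mp ht1).le

theorem mem_frontier (h : IsLocalDefiningFunction Ω x ρ) : x ∈ frontier Ω := by
  have hx : x ∉ Ω := fun hx => by
    have := h.mem_iff.self_of_nhds.mp hx
    rw [h.zero] at this
    exact lt_irrefl _ this
  refine ⟨?_, fun hi => hx (interior_subset hi)⟩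
  have h1 := h.eventually_mem (w := -gradient ρ x) (by
    rw [inner_neg_right, real_inner_self_eq_norm_sq, neg_neg_iff_pos]
    exact pow_pos (norm_pos_iff.mpr h.gradient_ne) 2)
  have hc : Tendsto (fun t : ℝ => x + t • (-gradient ρ x)) (𝓝[>] 0) (𝓝 x) := by
    have : Continuous (fun t : ℝ => x + t • (-gradient ρ x)) := by fun_prop
    simpa using (this.tendsto 0).mono_left nhdsWithin_le_nhds
  exact mem_closure_of_tendsto hc h1

end IsLocalDefiningFunction

namespace IsOuterUnitNormal

variable {Ω : Set (Euc d)} {x n : Euc d}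

theorem norm_eq (h : IsOuterUnitNormal Ω x n) : ‖n‖ = 1 := by
  obtain ⟨ρ, hρ, rfl⟩ := h
  rw [norm_smul, norm_inv, norm_norm, inv_mul_cancel₀ (norm_ne_zero_iff.mpr hρ.gradient_ne)]

theorem eventually_mem (h : IsOuterUnitNormal Ω x n) {w : Euc d} (hw : inner ℝ n w < 0) :
    ∀ᶠ t : ℝ in 𝓝[>] 0, x + t • w ∈ Ω := by
  obtain ⟨ρ, hρ, rfl⟩ := h
  rw [real_inner_smul_left] at hw
  exact hρ.eventually_mem
    (neg_of_mul_neg_right hw (inv_pos.mpr (norm_pos_iff.mpr hρ.gradient_ne)).le)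

theorem eventually_notMem (h : IsOuterUnitNormal Ω x n) {w : Euc d} (hw : 0 < inner ℝ n w) :
    ∀ᶠ t : ℝ in 𝓝[>] 0, x + t • w ∉ Ω := by
  obtain ⟨ρ, hρ, rfl⟩ := h
  rw [real_inner_smul_left] at hw
  exact hρ.eventually_notMem
    ((mul_pos_iff_of_pos_left (inv_pos.mpr (norm_pos_iff.mpr hρ.gradient_ne))).mp hw)

/-- If n ≠ n' then n·n' < 1, so the direction n' − n points strictly inward according to n and
strictly outward according to n'. The normal is therefore independent of the defining function and
of the choice in `outerNormal`. -/
theorem unique {n' : Euc d} (h : IsOuterUnitNormal Ω x n) (h' : IsOuterUnitNormal Ω x n') :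
    n = n' := by
  by_contra hne
  have hlt : inner ℝ n n' < 1 := lt_of_le_of_ne
    ((real_inner_le_norm n n').trans (by rw [h.norm_eq, h'.norm_eq, one_mul]))
    (mt (inner_eq_one_iff_of_norm_eq_one h.norm_eq h'.norm_eq).mp hne)
  have h1 := h.eventually_mem (w := n' - n) (by
    rw [inner_sub_right, real_inner_self_eq_norm_sq, h.norm_eq]; linarith)
  have h2 := h'.eventually_notMem (w := n' - n) (by
    rw [inner_sub_right, real_inner_self_eq_norm_sq, h'.norm_eq, real_inner_comm]; linarith)
  obtain ⟨t, ht1, ht2⟩ := (h1.and h2).exists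
  exact ht2 ht1

/-- If z ∈ Ω lay strictly beyond the tangent hyperplane, the segment from x to z would be inside Ω
by convexity, yet would start outside by the meaning of the normal. The inequality is strict because
a point on the hyperplane could be pushed along n inside the open set. -/
theorem inner_sub_neg (h : IsOuterUnitNormal Ω x n) (hopen : IsOpen Ω) (hconv : Convex ℝ Ω)
    {y : Euc d} (hy : y ∈ Ω) : inner ℝ n (y - x) < 0 := by
  have hxc : x ∈ closure Ω := by
    obtain ⟨ρ, hρ, -⟩ := h
    exact frontier_subset_closure hρ.mem_frontier
  have hle : ∀ z ∈ Ω, inner ℝ n (z - x) ≤ 0 := by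
    intro z hz
    by_contra hpos
    have h1 := h.eventually_notMem (not_le.mp hpos)
    obtain ⟨t, ht1, ht2⟩ := (h1.and (Ioo_mem_nhdsGT (zero_lt_one' ℝ))).exists
    refine ht1 ?_
    have := hconv.openSegment_closure_interior_subset_interior hxc (hopen.interior_eq.symm ▸ hz)
    rw [hopen.interior_eq] at this
    exact this ⟨1 - t, t, by linarith [ht2.2], ht2.1, by ring, by module⟩
  have hc : Tendsto (fun t : ℝ => y + t • n) (𝓝[>] 0) (𝓝 y) := by
    have : Continuous (fun t : ℝ => y + t • n) := by fun_prop
    simpa using (this.tendsto 0).mono_left nhdsWithin_le_nhds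
  obtain ⟨t, ht1, ht2⟩ := ((hc.eventually (hopen.mem_nhds hy)).and self_mem_nhdsWithin).exists
  have := hle _ ht1
  rw [add_sub_right_comm, inner_add_right, inner_smul_right, real_inner_self_eq_norm_sq,
    h.norm_eq] at this
  have : 0 < t := ht2
  linarith

end IsOuterUnitNormal

section Normal

variable {Ω : Set (Euc d)}

theorem HasSmoothBoundary.isOuterUnitNormal (h : HasSmoothBoundary Ω) {x : Euc d}
    (hx : x ∈ frontier Ω) : IsOuterUnitNormal Ω x (outerNormal Ω x) := by
  obtain ⟨ρ, hρ⟩ := h x hx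
  exact Classical.epsilon_spec (p := IsOuterUnitNormal Ω x) ⟨_, ρ, hρ, rfl⟩

theorem HasSmoothBoundary.continuousOn_outerNormal (h : HasSmoothBoundary Ω) (hΩ : IsOpen Ω) :
    ContinuousOn (outerNormal Ω) (frontier Ω) := by
  intro x hx
  obtain ⟨ρ, hρ⟩ := h x hx
  have hg : Continuous (gradient ρ) := by
    have := hρ.smooth.continuous_fderiv (by simp)
    exact (InnerProductSpace.toDual ℝ (Euc d)).symm.continuous.comp this
  have hc : ContinuousAt (fun y => ‖gradient ρ y‖⁻¹ • gradient ρ y) x :=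
    (hg.norm.continuousAt.inv₀ (norm_ne_zero_iff.mpr hρ.gradient_ne)).smul hg.continuousAt
  refine hc.continuousWithinAt.congr_of_eventuallyEq ?_
    ((h.isOuterUnitNormal hx).unique ⟨ρ, hρ, rfl⟩)
  filter_upwards [(hρ.of_frontier hΩ).filter_mono nhdsWithin_le_nhds, self_mem_nhdsWithin]
    with y hy hyf
  exact (h.isOuterUnitNormal hyf).unique ⟨ρ, hy hyf, rfl⟩

theorem HasSmoothBoundary.measurable_outerNormal (h : HasSmoothBoundary Ω) (hΩ : IsOpen Ω) :
    Measurable (outerNormal Ω) := by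
  refine measurable_of_restrict_of_restrict_compl (isClosed_frontier (s := Ω)).measurableSet
    (h.continuousOn_outerNormal hΩ).domRestrict.measurable ?_
  -- Off the frontier there is no normal, and the choice is made from one and the same empty
  -- predicate, so it is constant.
  have : (frontier Ω)ᶜ.domRestrict (outerNormal Ω) =
      fun _ => Classical.epsilon (fun _ : Euc d => False) := by
    ext1 x
    have : IsOuterUnitNormal Ω x = fun _ => False := by
      ext n
      simp only [iff_false]
      rintro ⟨ρ, hρ, -⟩
      exact x.2 hρ.mem_frontier
    simp only [domRestrict_apply, outerNormal, this]
  rw [this]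
  exact measurable_const

/-- Strict differentiability compares two moving points. At both of them ρ = 0, so their difference
is almost orthogonal to the gradient. This pairwise form is what exhibits a boundary piece as a
graph of small slope. -/
theorem HasSmoothBoundary.exists_cone (h : HasSmoothBoundary Ω) (hΩ : IsOpen Ω) {x : Euc d}
    (hx : x ∈ frontier Ω) {ε : ℝ} (hε : 0 < ε) :
    ∀ᶠ p : Euc d × Euc d in 𝓝 (x, x), p.1 ∈ frontier Ω → p.2 ∈ frontier Ω →
      |inner ℝ (outerNormal Ω x) (p.1 - p.2)| ≤
        ε * ‖(ℝ ∙ outerNormal Ω x)ᗮ.orthogonalProjectionOnto (p.1 - p.2)‖ := by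
  have hn := (h.isOuterUnitNormal hx).norm_eq
  obtain ⟨ρ, hρ, hnρ⟩ := h.isOuterUnitNormal hx
  set n := outerNormal Ω x
  have hpos : 0 < ‖gradient ρ x‖ := norm_pos_iff.mpr hρ.gradient_ne
  -- The constant is chosen because a ≤ ε/(1+ε) · (b + a) solves to a ≤ ε b.
  have hlo := hρ.hasStrictFDerivAt.isLittleO.def
    (c := ‖gradient ρ x‖ * (ε / (1 + ε))) (by positivity)
  have hz := hρ.eventually_eq_zero hΩ
  have hz2 : ∀ᶠ p : Euc d × Euc d in 𝓝 (x, x),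
      (p.1 ∈ frontier Ω → ρ p.1 = 0) ∧ (p.2 ∈ frontier Ω → ρ p.2 = 0) := by
    rw [nhds_prod_eq]
    exact (hz.prod_inl _).and (hz.prod_inr _)
  filter_upwards [hlo, hz2] with p hp1 hp2 h1 h2
  rw [hp2.1 h1, hp2.2 h2, sub_self, zero_sub, norm_neg, innerSL_apply_apply] at hp1
  have e1 : (inner ℝ (gradient ρ x) (p.1 - p.2) : ℝ) = ‖gradient ρ x‖ * inner ℝ n (p.1 - p.2) := by
    rw [hnρ, real_inner_smul_left, ← mul_assoc, mul_inv_cancel₀ hpos.ne', one_mul]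
  rw [e1, norm_mul, norm_norm, mul_assoc, mul_le_mul_iff_right₀ hpos, Real.norm_eq_abs] at hp1
  have h3 := norm_le_norm_orthogonalProjectionOnto_add n hn (p.1 - p.2)
  have h4 : |(inner ℝ n (p.1 - p.2) : ℝ)| ≤
      ε / (1 + ε) * (‖(ℝ ∙ n)ᗮ.orthogonalProjectionOnto (p.1 - p.2)‖ +
        |(inner ℝ n (p.1 - p.2) : ℝ)|) := hp1.trans (by gcongr)
  rw [div_mul_eq_mul_div, le_div_iff₀ (by positivity)] at h4
  linarith

theorem HasSmoothBoundary.measure_frontier_lt_top (h : HasSmoothBoundary Ω) (hΩ : IsOpen Ω)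
    (hb : Bornology.IsBounded Ω) :
    (Measure.euclideanHausdorffMeasure (d - 1) : Measure (Euc d)) (frontier Ω) < ⊤ := by
  have hbf : Bornology.IsBounded (frontier Ω) := hb.closure.subset frontier_subset_closure
  have hcpt : IsCompact (frontier Ω) := Metric.isCompact_of_isClosed_isBounded isClosed_frontier hbf
  refine hcpt.measure_lt_top_of_nhdsWithin fun x hx => ?_
  have h1 := h.exists_cone hΩ hx one_pos
  rw [nhds_prod_eq, Filter.Eventually, mem_prod_self_iff] at h1
  obtain ⟨U, hU, hUc⟩ := h1
  refine ⟨U ∩ frontier Ω, inter_mem (mem_nhdsWithin_of_mem_nhds hU) self_mem_nhdsWithin, ?_⟩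
  refine euclideanHausdorffMeasure_lt_top_of_cone _ (h.isOuterUnitNormal hx).norm_eq _
    (hbf.subset inter_subset_right) fun y hy y' hy' => ?_
  simpa using hUc (mk_mem_prod hy.1 hy'.1) hy.2 hy'.2

end Normal

end

/-! ### Swept boundary pieces, and chords -/

section

variable {d : ℕ}

section Cylinder

variable {Ω : Set (Euc d)}

/-- Near x the boundary is flat and the normal nearly constant. One half of ε pays for the flatness,
the other for the variation of the normal. -/
theorem HasSmoothBoundary.exists_nhds_volume_translates_le (h : HasSmoothBoundary Ω)
    (hΩ : IsOpen Ω) (v : Euc d) {x : Euc d} (hx : x ∈ frontier Ω) {ε : ℝ} (hε : 0 < ε) :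
    ∃ U : Set (Euc d), IsOpen U ∧ x ∈ U ∧ ∀ A ⊆ frontier Ω ∩ U, MeasurableSet A →
      volume ((fun p : Euc d × ℝ => p.1 + p.2 • v) '' (A ×ˢ Ioo 0 1)) ≤
        ∫⁻ y in A, ENNReal.ofReal (|inner ℝ (outerNormal Ω y) v| + ε)
          ∂(Measure.euclideanHausdorffMeasure (d - 1) : Measure (Euc d)) := by
  have hn := (h.isOuterUnitNormal hx).norm_eq
  set n := outerNormal Ω x with hndef
  have hpos : 0 ≤ |inner ℝ n v| + ε / 2 := by positivity
  obtain ⟨η, hη, hηA⟩ := exists_volume_translates_le n v hn (Real.toNNReal (|inner ℝ n v| + ε / 2))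
    (by
      change _ < ENNReal.ofReal _
      exact (ENNReal.ofReal_lt_ofReal_iff (by positivity)).mpr (by linarith))
  have h1 := h.exists_cone hΩ hx hη
  rw [nhds_prod_eq, Filter.Eventually, mem_prod_self_iff] at h1
  obtain ⟨U, hU, hUc⟩ := h1
  have hcont : ∀ᶠ y in 𝓝 x, y ∈ frontier Ω →
      |inner ℝ n v| < |inner ℝ (outerNormal Ω y) v| + ε / 2 := by
    have hc : ContinuousWithinAt (fun y => |(inner ℝ (outerNormal Ω y) v : ℝ)| + ε / 2)
        (frontier Ω) x :=
      ((((h.continuousOn_outerNormal hΩ) x hx).inner continuousWithinAt_const).abs).add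
        continuousWithinAt_const
    have := hc.eventually_const_lt (u := |inner ℝ n v|) (by change _ < |(inner ℝ n v : ℝ)| + _; linarith)
    exact eventually_nhdsWithin_iff.mp this
  obtain ⟨W, hW, hWo, hxW⟩ := eventually_nhds_iff.mp (hcont.and hU)
  refine ⟨W, hWo, hxW, fun A hA hAm => ?_⟩
  have hcone : ∀ y ∈ A, ∀ y' ∈ A, |inner ℝ n (y - y')| ≤
      η * ‖(ℝ ∙ n)ᗮ.orthogonalProjectionOnto (y - y')‖ := fun y hy y' hy' => by
    have hyU : (y, y') ∈ U ×ˢ U := ⟨(hW y (hA hy).2).2, (hW y' (hA hy').2).2⟩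
    exact (hUc hyU) (hA hy).1 (hA hy').1
  have hle := hηA A hcone
  refine hle.trans ?_
  · rw [← setLIntegral_const]
    refine setLIntegral_mono' hAm fun y hy => ?_
    change ENNReal.ofReal _ ≤ _
    exact ENNReal.ofReal_le_ofReal (by linarith [(hW y (hA hy).2).1 (hA hy).1])

/-- A is cut into countably many disjoint pieces, each in a good neighbourhood. The left side is
subadditive and the right side additive; the error sits inside the integral and so does not
accumulate over the pieces. -/
theorem HasSmoothBoundary.volume_translates_le_add (h : HasSmoothBoundary Ω)
    (hΩ : IsOpen Ω) (v : Euc d) {ε : ℝ} (hε : 0 < ε) {A : Set (Euc d)} (hA : A ⊆ frontier Ω)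
    (hAm : MeasurableSet A) :
    volume ((fun p : Euc d × ℝ => p.1 + p.2 • v) '' (A ×ˢ Ioo 0 1)) ≤
        ∫⁻ y in A, ENNReal.ofReal (|inner ℝ (outerNormal Ω y) v| + ε)
          ∂(Measure.euclideanHausdorffMeasure (d - 1) : Measure (Euc d)) := by
  rcases (frontier Ω).eq_empty_or_nonempty with he | hne
  · rw [he, subset_empty_iff] at hA
    simp [hA]
  choose! U hUo hxU hUA using fun x (hx : x ∈ frontier Ω) =>
    h.exists_nhds_volume_translates_le hΩ v hx hε
  obtain ⟨t, htf, htc, htU⟩ := TopologicalSpace.countable_cover_nhdsWithin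
    (f := U) (s := frontier Ω)
    (fun x hx => mem_nhdsWithin_of_mem_nhds ((hUo x hx).mem_nhds (hxU x hx)))
  have htne : t.Nonempty := by
    by_contra hte
    rw [not_nonempty_iff_eq_empty] at hte
    obtain ⟨x, hx⟩ := hne
    simpa [hte] using htU hx
  obtain ⟨u, rfl⟩ := htc.exists_eq_range htne
  let W : ℕ → Set (Euc d) := fun i => U (u i)
  have hWm : ∀ i, MeasurableSet (W i) := fun i => (hUo _ (htf ⟨i, rfl⟩)).measurableSet
  have hAU : A = ⋃ i, A ∩ disjointed W i := by
    rw [← inter_iUnion, iUnion_disjointed]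
    refine (inter_eq_left.mpr (hA.trans (htU.trans ?_))).symm
    simp [W]
  have hm : ∀ i, MeasurableSet (A ∩ disjointed W i) := fun i =>
    hAm.inter (MeasurableSet.disjointed hWm i)
  have hd : Pairwise (Function.onFun Disjoint fun i => A ∩ disjointed W i) := fun i j hij =>
    ((disjoint_disjointed W) hij).mono inter_subset_right inter_subset_right
  calc volume ((fun p : Euc d × ℝ => p.1 + p.2 • v) '' (A ×ˢ Ioo 0 1))
      = volume (⋃ i, (fun p : Euc d × ℝ => p.1 + p.2 • v) ''
          ((A ∩ disjointed W i) ×ˢ Ioo 0 1)) := by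
        rw [← image_iUnion, ← iUnion_prod_const, ← hAU]
    _ ≤ ∑' i, volume ((fun p : Euc d × ℝ => p.1 + p.2 • v) ''
          ((A ∩ disjointed W i) ×ˢ Ioo 0 1)) := measure_iUnion_le _
    _ ≤ ∑' i, ∫⁻ y in A ∩ disjointed W i, ENNReal.ofReal (|inner ℝ (outerNormal Ω y) v| + ε)
          ∂(Measure.euclideanHausdorffMeasure (d - 1) : Measure (Euc d)) := by
        refine ENNReal.tsum_le_tsum fun i => hUA _ (htf ⟨i, rfl⟩) _ ?_ (hm i)
        exact inter_subset_inter hA (disjointed_subset W i)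
    _ = _ := by
        rw [← lintegral_iUnion hm hd, ← hAU]

theorem HasSmoothBoundary.volume_translates_le (h : HasSmoothBoundary Ω)
    (hΩ : IsOpen Ω) (hb : Bornology.IsBounded Ω) (v : Euc d) {A : Set (Euc d)}
    (hA : A ⊆ frontier Ω) (hAm : MeasurableSet A) :
    volume ((fun p : Euc d × ℝ => p.1 + p.2 • v) '' (A ×ˢ Ioo 0 1)) ≤
        ∫⁻ y in A, ENNReal.ofReal |inner ℝ (outerNormal Ω y) v|
          ∂(Measure.euclideanHausdorffMeasure (d - 1) : Measure (Euc d)) := by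
  set lam := (Measure.euclideanHausdorffMeasure (d - 1) : Measure (Euc d))
  have hfin : lam A ≠ ⊤ := ((measure_mono hA).trans_lt (h.measure_frontier_lt_top hΩ hb)).ne
  refine ENNReal.le_of_forall_pos_le_add fun δ hδ _ => ?_
  -- With this ε the total error ε λ(A) is at most δ. It is here that finiteness of the surface
  -- measure is needed.
  set ε : ℝ := δ / ((lam A).toReal + 1) with hεdef
  have hpos : 0 < (lam A).toReal + 1 := by positivity
  have hε : 0 < ε := div_pos hδ hpos
  refine (h.volume_translates_le_add hΩ v hε hA hAm).trans ?_
  simp_rw [ENNReal.ofReal_add (abs_nonneg _) hε.le]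
  rw [lintegral_add_right _ measurable_const, setLIntegral_const]
  gcongr
  rw [← ENNReal.ofReal_toReal hfin, ← ENNReal.ofReal_mul hε.le, ← ENNReal.ofReal_coe_nnreal]
  refine ENNReal.ofReal_le_ofReal ?_
  rw [hεdef, div_mul_eq_mul_div, div_le_iff₀ hpos]
  nlinarith [δ.2]

end Cylinder

/-! ### Chords of a convex set -/

/-- The parameters of the points of `Ω` on the line through `x` in the direction `v`. -/
def chord (Ω : Set (Euc d)) (x v : Euc d) : Set ℝ := {r | x + r • v ∈ Ω}

/-- Lengths and exit times are Lebesgue measures of sections of open sets, so that their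
measurability in (x, v) is part of Tonelli's theorem and needs no geometry. -/
def chordLength (Ω : Set (Euc d)) (x v : Euc d) : ℝ≥0∞ := volume (chord Ω x v)

/-- The time at which the line through `x` with velocity `v` leaves the convex set `Ω`. -/
def exitTime (Ω : Set (Euc d)) (x v : Euc d) : ℝ := (volume (chord Ω x v ∩ Ioi 0)).toReal

def exitPoint (Ω : Set (Euc d)) (x v : Euc d) : Euc d := x + exitTime Ω x v • v

section Chord

variable {Ω : Set (Euc d)}

theorem mem_chord {x v : Euc d} {r : ℝ} : r ∈ chord Ω x v ↔ x + r • v ∈ Ω := Iff.rfl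

theorem isOpen_chord (hΩ : IsOpen Ω) (x v : Euc d) : IsOpen (chord Ω x v) :=
  hΩ.preimage (f := fun r : ℝ => x + r • v) (by fun_prop)

theorem chordLength_add_smul (x v : Euc d) (s : ℝ) :
    chordLength Ω (x + s • v) v = chordLength Ω x v := by
  have : chord Ω (x + s • v) v = (fun r => s + r) ⁻¹' chord Ω x v := by
    ext r
    simp only [mem_chord, mem_preimage]
    rw [add_smul, add_assoc]
  rw [chordLength, this, measure_preimage_add, chordLength]

theorem measurable_chordLength (hΩ : IsOpen Ω) :
    Measurable fun p : Euc d × Euc d => chordLength Ω p.1 p.2 := by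
  have : MeasurableSet {q : (Euc d × Euc d) × ℝ | q.1.1 + q.2 • q.1.2 ∈ Ω} :=
    (hΩ.preimage (f := fun q : (Euc d × Euc d) × ℝ => q.1.1 + q.2 • q.1.2)
      (by fun_prop)).measurableSet
  exact measurable_measure_prodMk_left this

theorem measurable_exitTime (hΩ : IsOpen Ω) :
    Measurable fun p : Euc d × Euc d => exitTime Ω p.1 p.2 := by
  have : MeasurableSet {q : (Euc d × Euc d) × ℝ | q.1.1 + q.2 • q.1.2 ∈ Ω ∧ q.2 ∈ Ioi 0} :=
    (hΩ.preimage (f := fun q : (Euc d × Euc d) × ℝ => q.1.1 + q.2 • q.1.2)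
      (by fun_prop)).measurableSet.inter (measurableSet_Ioi.preimage measurable_snd)
  exact (measurable_measure_prodMk_left this).ennreal_toReal

theorem measurable_exitPoint (hΩ : IsOpen Ω) :
    Measurable fun p : Euc d × Euc d => exitPoint Ω p.1 p.2 :=
  measurable_fst.add ((measurable_exitTime hΩ).smul measurable_snd)

theorem exists_chord_eq (hΩ : IsOpen Ω) (hb : Bornology.IsBounded Ω) (hc : Convex ℝ Ω)
    {x v : Euc d} (hx : x ∈ Ω) (hv : ‖v‖ = 1) :
    ∃ a b : ℝ, a < 0 ∧ 0 < b ∧ chord Ω x v = Ioo a b := by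
  set s := chord Ω x v
  have h0 : (0 : ℝ) ∈ s := by simpa [s, mem_chord] using hx
  have hso : IsOpen s := isOpen_chord hΩ x v
  have hconv : Convex ℝ s := by
    intro r hr r' hr' a b ha hb' hab
    have h2 := hc hr hr' ha hb' hab
    rw [mem_chord]
    convert h2 using 1
    simp only [smul_eq_mul]
    have : x = (a + b) • x := by rw [hab, one_smul]
    nth_rw 1 [this]
    module
  have hbd : Bornology.IsBounded s := by
    obtain ⟨R, hR⟩ := hb.exists_norm_le
    refine isBounded_iff_forall_norm_le.mpr ⟨R + ‖x‖, fun r hr => ?_⟩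
    have := hR _ hr
    calc ‖r‖ = ‖(x + r • v) - x‖ := by rw [add_sub_cancel_left, norm_smul, hv, mul_one]
      _ ≤ _ := (norm_sub_le _ _).trans (by linarith)
  have hsub : s ⊆ Ioo (sInf s) (sSup s) := by
    have := interior_mono (subset_Icc_csInf_csSup hbd.bddBelow hbd.bddAbove)
    rwa [hso.interior_eq, interior_Icc] at this
  refine ⟨sInf s, sSup s, (hsub h0).1, (hsub h0).2, hsub.antisymm ?_⟩
  exact IsConnected.Ioo_csInf_csSup_subset ⟨⟨0, h0⟩, hconv.isPreconnected⟩ hbd.bddBelow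
    hbd.bddAbove

theorem chord_neg (x v : Euc d) : chord Ω x (-v) = -chord Ω x v := by
  ext r
  simp [mem_chord]

theorem exitTime_eq_of_chord_eq {x v : Euc d} {a b : ℝ} (ha : a < 0) (hb : 0 < b)
    (h : chord Ω x v = Ioo a b) : exitTime Ω x v = b := by
  have : Ioo a b ∩ Ioi 0 = Ioo 0 b := by
    ext r
    simp only [mem_inter_iff, mem_Ioo, mem_Ioi]
    constructor
    · rintro ⟨h1, h2⟩; exact ⟨h2, h1.2⟩
    · rintro ⟨h1, h2⟩; exact ⟨⟨by linarith, h2⟩, h1⟩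
  rw [exitTime, h, this, Real.volume_Ioo, sub_zero, ENNReal.toReal_ofReal hb.le]

theorem chord_eq (hΩ : IsOpen Ω) (hb : Bornology.IsBounded Ω) (hc : Convex ℝ Ω)
    {x v : Euc d} (hx : x ∈ Ω) (hv : ‖v‖ = 1) :
    chord Ω x v = Ioo (-exitTime Ω x (-v)) (exitTime Ω x v) := by
  obtain ⟨a, b, ha, hb0, h⟩ := exists_chord_eq hΩ hb hc hx hv
  have h' : chord Ω x (-v) = Ioo (-b) (-a) := by
    rw [chord_neg, h]
    ext r
    simp only [Set.mem_neg, mem_Ioo]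
    constructor <;> rintro ⟨h1, h2⟩ <;> constructor <;> linarith
  rw [exitTime_eq_of_chord_eq ha hb0 h, exitTime_eq_of_chord_eq (by linarith) (by linarith) h',
    neg_neg, h]

theorem exitTime_pos (hΩ : IsOpen Ω) (hb : Bornology.IsBounded Ω) (hc : Convex ℝ Ω)
    {x v : Euc d} (hx : x ∈ Ω) (hv : ‖v‖ = 1) : 0 < exitTime Ω x v := by
  have h0 : (0 : ℝ) ∈ chord Ω x v := by simpa [mem_chord] using hx
  rw [chord_eq hΩ hb hc hx hv] at h0
  exact h0.2

theorem exitTime_add_smul (hΩ : IsOpen Ω) (hb : Bornology.IsBounded Ω) (hc : Convex ℝ Ω)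
    {x v : Euc d} {s : ℝ} (hx : x ∈ Ω) (hs : x + s • v ∈ Ω) (hv : ‖v‖ = 1) :
    exitTime Ω (x + s • v) v = exitTime Ω x v - s := by
  obtain ⟨a, b, ha, hb0, h⟩ := exists_chord_eq hΩ hb hc hx hv
  have hs' : s ∈ Ioo a b := h ▸ hs
  have h' : chord Ω (x + s • v) v = Ioo (a - s) (b - s) := by
    ext r
    have : r ∈ chord Ω (x + s • v) v ↔ s + r ∈ chord Ω x v := by
      simp only [mem_chord]
      rw [add_smul, add_assoc]
    rw [this, h]
    simp only [mem_Ioo]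
    constructor <;> rintro ⟨h1, h2⟩ <;> constructor <;> linarith
  rw [exitTime_eq_of_chord_eq ha hb0 h, exitTime_eq_of_chord_eq (by linarith [hs'.1])
    (by linarith [hs'.2]) h']

theorem chordLength_eq (hΩ : IsOpen Ω) (hb : Bornology.IsBounded Ω) (hc : Convex ℝ Ω)
    {x v : Euc d} (hx : x ∈ Ω) (hv : ‖v‖ = 1) :
    chordLength Ω x v = ENNReal.ofReal (exitTime Ω x v + exitTime Ω x (-v)) := by
  rw [chordLength, chord_eq hΩ hb hc hx hv, Real.volume_Ioo, sub_neg_eq_add]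

theorem chordLength_ne_top (hΩ : IsOpen Ω) (hb : Bornology.IsBounded Ω) (hc : Convex ℝ Ω)
    {x v : Euc d} (hx : x ∈ Ω) (hv : ‖v‖ = 1) : chordLength Ω x v ≠ ⊤ := by
  rw [chordLength_eq hΩ hb hc hx hv]; exact ENNReal.ofReal_ne_top

theorem chordLength_pos (hΩ : IsOpen Ω) (hb : Bornology.IsBounded Ω) (hc : Convex ℝ Ω)
    {x v : Euc d} (hx : x ∈ Ω) (hv : ‖v‖ = 1) : 0 < chordLength Ω x v := by
  rw [chordLength_eq hΩ hb hc hx hv, ENNReal.ofReal_pos]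
  have := exitTime_pos hΩ hb hc hx hv
  have := exitTime_pos hΩ hb hc hx (v := -v) (by rwa [norm_neg])
  linarith

theorem exitPoint_mem_frontier (hΩ : IsOpen Ω) (hb : Bornology.IsBounded Ω) (hc : Convex ℝ Ω)
    {x v : Euc d} (hx : x ∈ Ω) (hv : ‖v‖ = 1) : exitPoint Ω x v ∈ frontier Ω := by
  have hch := chord_eq hΩ hb hc hx hv
  have hpos := exitTime_pos hΩ hb hc hx hv
  have hpos' := exitTime_pos hΩ hb hc hx (v := -v) (by rwa [norm_neg])
  rw [hΩ.frontier_eq]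
  refine ⟨?_, fun h => ?_⟩
  · have hmem : exitTime Ω x v ∈ closure (chord Ω x v) := by
      rw [hch, closure_Ioo (by linarith)]
      exact ⟨by linarith, le_rfl⟩
    exact map_mem_closure (f := fun r : ℝ => x + r • v) (by fun_prop) hmem fun r hr => hr
  · have : exitTime Ω x v ∈ chord Ω x v := h
    rw [hch] at this
    exact lt_irrefl _ this.2

theorem inner_outerNormal_exitPoint_pos (hΩ : IsOpen Ω) (hb : Bornology.IsBounded Ω)
    (hc : Convex ℝ Ω) (hs : HasSmoothBoundary Ω) {x v : Euc d} (hx : x ∈ Ω) (hv : ‖v‖ = 1) :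
    0 < inner ℝ (outerNormal Ω (exitPoint Ω x v)) v := by
  have h1 := (hs.isOuterUnitNormal (exitPoint_mem_frontier hΩ hb hc hx hv)).inner_sub_neg hΩ hc hx
  have h2 : x - exitPoint Ω x v = (-exitTime Ω x v) • v := by rw [exitPoint]; module
  rw [h2, inner_smul_right] at h1
  have := exitTime_pos hΩ hb hc hx hv
  nlinarith

/-- Integrating the inverse chord length over the points of each chord gives one. -/
theorem lintegral_inv_chordLength_le (x v : Euc d) :
    ∫⁻ s : ℝ, Ω.indicator (fun z => (chordLength Ω z v)⁻¹) (x - s • v) ≤ 1 := by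
  have h1 : ∀ s : ℝ, Ω.indicator (fun z => (chordLength Ω z v)⁻¹) (x - s • v) =
      (-chord Ω x v).indicator (fun _ => (chordLength Ω x v)⁻¹) s := by
    intro s
    have h2 : x - s • v = x + (-s) • v := by module
    have h3 : s ∈ -chord Ω x v ↔ x - s • v ∈ Ω := by rw [Set.mem_neg, mem_chord, h2]
    by_cases hs : x - s • v ∈ Ω
    · rw [indicator_of_mem hs, indicator_of_mem (h3.mpr hs), h2, chordLength_add_smul]
    · rw [indicator_of_notMem hs, indicator_of_notMem (mt h3.mp hs)]
  simp_rw [h1]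
  refine (lintegral_indicator_const_le _ _).trans ?_
  rw [Measure.measure_neg]
  exact ENNReal.inv_mul_le_one _

end Chord

end

/-! ### Change of variables from points to exit points -/

section

variable {d : ℕ}

section Chord
variable {Ω : Set (Euc d)}


theorem measurable_exitTime_left (hΩ : IsOpen Ω) (v : Euc d) : Measurable fun x => exitTime Ω x v := by
  have h2 : Measurable fun x : Euc d => (x, v) := by fun_prop
  have := (measurable_exitTime hΩ).comp h2
  exact this

theorem measurable_exitPoint_left (hΩ : IsOpen Ω) (v : Euc d) : Measurable fun x => exitPoint Ω x v := 
  (measurable_exitPoint hΩ).comp (measurable_prodMk_right (y := v))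

theorem measurable_chordLength_left (hΩ : IsOpen Ω) (v : Euc d) : Measurable fun x => chordLength Ω x v := 
  (measurable_chordLength hΩ).comp (measurable_prodMk_right (y := v))

/-- Insert 1 = ∫ J(s − τ(x)) ds, where J is the indicator of (0,1) and τ the exit time, and
substitute x = z − s v. Then z is the exit point moved along v by s − τ ∈ (0,1), so z lies in the
swept set. For each such z the integral over s is at most that of the inverse chord length along one
chord, which is at most one. -/
theorem setLIntegral_inv_chordLength_exitPoint_le (hΩ : IsOpen Ω) (v : Euc d) {A : Set (Euc d)}
    (hA : MeasurableSet A) :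
    ∫⁻ x in Ω, (chordLength Ω x v)⁻¹ * A.indicator 1 (exitPoint Ω x v) ≤
      volume ((fun p : Euc d × ℝ => p.1 + p.2 • v) '' (A ×ˢ Ioo 0 1)) := by
  obtain ⟨C, hC⟩ : ∃ C, C = (fun p : Euc d × ℝ => p.1 + p.2 • v) '' (A ×ˢ Ioo 0 1) := ⟨_, rfl⟩
  rw [← hC]
  have hmk : Measurable fun x => chordLength Ω x v :=
    measurable_chordLength_left hΩ v
  have hmt : Measurable fun x => exitTime Ω x v :=
    measurable_exitTime_left hΩ v
  have hme : Measurable fun x => exitPoint Ω x v :=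
    measurable_exitPoint_left hΩ v
  let h : Euc d → ℝ≥0∞ :=
    Ω.indicator fun x => (chordLength Ω x v)⁻¹ * A.indicator 1 (exitPoint Ω x v)
  have h1A : Measurable (A.indicator (1 : Euc d → ℝ≥0∞)) := measurable_one.indicator hA
  have hh : Measurable h := by
    refine Measurable.indicator ?_ hΩ.measurableSet
    exact hmk.inv.mul (h1A.comp hme)
  let J : ℝ → ℝ≥0∞ := (Ioo (0 : ℝ) 1).indicator 1
  have hJ : Measurable J := measurable_one.indicator measurableSet_Ioo
  have hJint : ∀ c : ℝ, ∫⁻ s, J (s - c) = 1 := by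
    intro c
    rw [lintegral_sub_right_eq_self J c]
    simp [J, lintegral_indicator measurableSet_Ioo]
  have hmeas : Measurable fun p : Euc d × ℝ => h p.1 * J (p.2 - exitTime Ω p.1 v) :=
    (hh.comp measurable_fst).mul (hJ.comp (measurable_snd.sub (hmt.comp measurable_fst)))
  have hmeas2 : Measurable fun p : ℝ × Euc d =>
      h (p.2 - p.1 • v) * J (p.1 - exitTime Ω (p.2 - p.1 • v) v) := by
    have : Measurable fun p : ℝ × Euc d => (p.2 - p.1 • v, p.1) := by fun_prop
    exact hmeas.comp this
  have hle : ∀ z (s : ℝ), h (z - s • v) * J (s - exitTime Ω (z - s • v) v) ≤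
      Ω.indicator (fun z => (chordLength Ω z v)⁻¹) (z - s • v) := by
    intro z s
    have hJ1 : ∀ r, J r ≤ 1 := fun r => indicator_le_self' (by simp) _
    have hA1 : ∀ y, A.indicator (1 : Euc d → ℝ≥0∞) y ≤ 1 := fun r => indicator_le_self' (by simp) _
    by_cases hs : z - s • v ∈ Ω
    · simp only [h]
      rw [indicator_of_mem hs, indicator_of_mem hs, mul_assoc]
      calc _ ≤ (chordLength Ω (z - s • v) v)⁻¹ * (1 * 1) := by
            gcongr
            · exact hA1 _
            · exact hJ1 _
        _ = _ := by rw [one_mul, mul_one]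
    · simp only [h]
      rw [indicator_of_notMem hs, zero_mul]
      exact zero_le
  have hmemC : ∀ z (s : ℝ), h (z - s • v) * J (s - exitTime Ω (z - s • v) v) ≠ 0 → z ∈ C := by
    intro z s hne
    have h1 := left_ne_zero_of_mul hne
    have h5 := mem_of_indicator_ne_zero (right_ne_zero_of_mul hne)
    have h3 : z - s • v ∈ Ω := mem_of_indicator_ne_zero h1
    simp only [h] at h1
    rw [indicator_of_mem h3] at h1
    have h4 := mem_of_indicator_ne_zero (right_ne_zero_of_mul h1)
    have h6 : z = exitPoint Ω (z - s • v) v + (s - exitTime Ω (z - s • v) v) • v := by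
      rw [exitPoint]; module
    rw [h6, hC]
    exact mem_image_of_mem (fun p : Euc d × ℝ => p.1 + p.2 • v) (mk_mem_prod h4 h5)
  calc ∫⁻ x in Ω, (chordLength Ω x v)⁻¹ * A.indicator 1 (exitPoint Ω x v)
      = ∫⁻ x, h x := (lintegral_indicator hΩ.measurableSet _).symm
    _ = ∫⁻ x, ∫⁻ s : ℝ, h x * J (s - exitTime Ω x v) := by
        refine lintegral_congr fun x => ?_
        have hJc : Measurable fun s => J (s - exitTime Ω x v) :=
          hJ.comp (measurable_id.sub_const _)
        rw [lintegral_const_mul _ hJc, hJint, mul_one]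
    _ = ∫⁻ s : ℝ, ∫⁻ x, h x * J (s - exitTime Ω x v) := lintegral_lintegral_swap hmeas.aemeasurable
    _ = ∫⁻ s : ℝ, ∫⁻ z, h (z - s • v) * J (s - exitTime Ω (z - s • v) v) := by
        refine lintegral_congr fun s => ?_
        exact (lintegral_sub_right_eq_self
          (fun x => h x * J (s - exitTime Ω x v)) (s • v)).symm
    _ = ∫⁻ z, ∫⁻ s : ℝ, h (z - s • v) * J (s - exitTime Ω (z - s • v) v) :=
        lintegral_lintegral_swap hmeas2.aemeasurable
    _ ≤ ∫⁻ z, C.indicator 1 z := by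
        refine lintegral_mono fun z => ?_
        by_cases hz : z ∈ C
        · rw [indicator_of_mem hz]
          exact (lintegral_mono fun s => hle z s).trans (lintegral_inv_chordLength_le z v)
        · rw [indicator_of_notMem hz]
          have : ∀ s : ℝ, h (z - s • v) * J (s - exitTime Ω (z - s • v) v) = 0 := fun s => by
            by_contra hne
            exact hz (hmemC z s hne)
          simp [this]
    _ ≤ _ := by
        exact (lintegral_indicator_const_le C 1).trans (one_mul _).le

/-- Tested on sets, the claim is that the exit map pushes ℓ⁻¹ dx to a measure dominated by (n·v)₊
dλ. Exit points of points of Ω satisfy n·v > 0, so a test set may be cut down to such points, and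
there |n·v| = n·v. -/
theorem setLIntegral_exitPoint_le (hΩ : IsOpen Ω) (hb : Bornology.IsBounded Ω)
    (hc : Convex ℝ Ω) (hs : HasSmoothBoundary Ω) {v : Euc d} (hv : ‖v‖ = 1)
    {g : Euc d → ℝ≥0∞} (hg : Measurable g) :
    ∫⁻ x in Ω, (chordLength Ω x v)⁻¹ * g (exitPoint Ω x v) ≤
      ∫⁻ y in frontier Ω, ENNReal.ofReal (inner ℝ (outerNormal Ω y) v) * g y
        ∂(Measure.euclideanHausdorffMeasure (d - 1) : Measure (Euc d)) := by
  set lam := (Measure.euclideanHausdorffMeasure (d - 1) : Measure (Euc d))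
  have hmk : Measurable fun x => chordLength Ω x v :=
    measurable_chordLength_left hΩ v
  have hme : Measurable fun x => exitPoint Ω x v :=
    measurable_exitPoint_left hΩ v
  have hmn : Measurable fun y => (inner ℝ (outerNormal Ω y) v : ℝ) :=
    (hs.measurable_outerNormal hΩ).inner measurable_const
  have hle : ((volume.restrict Ω).withDensity fun x => (chordLength Ω x v)⁻¹).map
      (fun x => exitPoint Ω x v) ≤
      (lam.restrict (frontier Ω)).withDensity
        fun y => ENNReal.ofReal (inner ℝ (outerNormal Ω y) v) := by
    refine Measure.le_iff.mpr fun A hA => ?_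
    let A' := A ∩ (frontier Ω ∩ {y | 0 < (inner ℝ (outerNormal Ω y) v : ℝ)})
    have hA' : MeasurableSet A' := hA.inter
      (isClosed_frontier.measurableSet.inter (measurableSet_lt measurable_const hmn))
    rw [Measure.map_apply hme hA, withDensity_apply _ (hme hA), withDensity_apply _ hA,
      ← lintegral_indicator (hme hA)]
    calc ∫⁻ x in Ω, ((fun x => exitPoint Ω x v) ⁻¹' A).indicator
          (fun x => (chordLength Ω x v)⁻¹) x
        = ∫⁻ x in Ω, (chordLength Ω x v)⁻¹ * A'.indicator 1 (exitPoint Ω x v) := by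
          refine setLIntegral_congr_fun hΩ.measurableSet fun x hx => ?_
          have hmem : exitPoint Ω x v ∈ A' ↔ x ∈ (fun x => exitPoint Ω x v) ⁻¹' A :=
            ⟨fun h => h.1, fun h => ⟨h, exitPoint_mem_frontier hΩ hb hc hx hv,
              inner_outerNormal_exitPoint_pos hΩ hb hc hs hx hv⟩⟩
          by_cases h : exitPoint Ω x v ∈ A'
          · rw [indicator_of_mem h, indicator_of_mem (hmem.mp h), Pi.one_apply, mul_one]
          · rw [indicator_of_notMem h, indicator_of_notMem (mt hmem.mpr h), mul_zero]
      _ ≤ _ := setLIntegral_inv_chordLength_exitPoint_le hΩ v hA'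
      _ ≤ _ := hs.volume_translates_le hΩ hb v (fun y hy => hy.2.1) hA'
      _ = ∫⁻ y in A', ENNReal.ofReal (inner ℝ (outerNormal Ω y) v) ∂lam :=
          setLIntegral_congr_fun hA' fun y hy => by
            rw [abs_of_pos hy.2.2]
      _ ≤ ∫⁻ y in A ∩ frontier Ω, ENNReal.ofReal (inner ℝ (outerNormal Ω y) v) ∂lam :=
          lintegral_mono_set fun y hy => ⟨hy.1, hy.2.1⟩
      _ = _ := by rw [Measure.restrict_restrict hA]
  calc ∫⁻ x in Ω, (chordLength Ω x v)⁻¹ * g (exitPoint Ω x v)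
      = ∫⁻ y, g y ∂(((volume.restrict Ω).withDensity fun x => (chordLength Ω x v)⁻¹).map
          (fun x => exitPoint Ω x v)) := by
        rw [lintegral_map hg hme]
        exact (lintegral_withDensity_eq_lintegral_mul _ hmk.inv (hg.comp hme)).symm
    _ ≤ _ := lintegral_mono' hle le_rfl
    _ = _ := by
        rw [lintegral_withDensity_eq_lintegral_mul _ hmn.ennreal_ofReal hg]
        rfl

end Chord

end

/-! ### Weak derivatives along straight flows -/

section

section Flow
variable {Z : Type*} [NormedAddCommGroup Z] [NormedSpace ℝ Z]

/-- The flow of a vector field that is constant along its integral curves. -/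
def shearHomeomorph (X : Z → Z) (hX : Continuous X) (hXX : ∀ z (r : ℝ), X (z + r • X z) = X z)
    (r : ℝ) : Z ≃ₜ Z where
  toFun z := z + r • X z
  invFun z := z + (-r) • X z
  left_inv z := by simp only [hXX]; module
  right_inv z := by simp only [hXX]; module
  continuous_toFun := by fun_prop
  continuous_invFun := by fun_prop

variable [FiniteDimensional ℝ Z] [MeasurableSpace Z] [BorelSpace Z]

/-- Against a test function ψ the flow is moved from g' onto ψ, by invariance of the measure. The
weak identity for ψ ∘ e(−r) then turns the r-integral into that of the r-derivative of ψ(e(−r) z),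
up to sign, and the fundamental theorem of calculus evaluates it. The null set depends on h. -/
theorem ae_sub_eq_intervalIntegral_of_weakDeriv (m : Measure Z) [SFinite m] (X : Z → Z)
    (hX : ContDiff ℝ ∞ X) (hXX : ∀ z (r : ℝ), X (z + r • X z) = X z)
    (hmp : ∀ r : ℝ, MeasurePreserving (fun z => z + r • X z) m m)
    {Q : Set Z} (hQ : IsOpen Q)
    (hQc : ∀ z ∈ Q, ∀ h : ℝ, z + h • X z ∈ Q → ∀ r ∈ uIcc 0 h, z + r • X z ∈ Q)
    {g g' : Z → ℝ} (hg : IntegrableOn g Q m) (hg' : IntegrableOn g' Q m)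
    (hweak : ∀ ψ : Z → ℝ, ContDiff ℝ ∞ ψ → HasCompactSupport ψ → tsupport ψ ⊆ Q →
      ∫ z in Q, g z * fderiv ℝ ψ z (X z) ∂m = -∫ z in Q, g' z * ψ z ∂m) (h : ℝ) :
    ∀ᵐ z ∂m, z ∈ Q → z + h • X z ∈ Q →
      g (z + h • X z) - g z = ∫ r in (0 : ℝ)..h, g' (z + r • X z) := by
  let e : ℝ → Z ≃ₜ Z := shearHomeomorph X hX.continuous hXX
  have he : ∀ r z, e r z = z + r • X z := fun r z => rfl
  have hee : ∀ r z, e (-r) (e r z) = z := fun r z => (e r).left_inv z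
  have hee' : ∀ r z, e r (e (-r) z) = z := fun r z => (e r).right_inv z
  have hXe : ∀ r z, X (e r z) = X z := fun r z => hXX z r
  have hmpe : ∀ r, MeasurePreserving (e r) m m := hmp
  have hsubst : ∀ r (F : Z → ℝ), ∫ z, F (e r z) ∂m = ∫ z, F z ∂m := fun r F =>
    (hmpe r).integral_comp (e r).measurableEmbedding F
  let G := Q.indicator g
  let G' := Q.indicator g'
  have hG : Integrable G m := (integrable_indicator_iff hQ.measurableSet).mpr hg
  have hG' : Integrable G' m := (integrable_indicator_iff hQ.measurableSet).mpr hg'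
  let ν : Measure ℝ := volume.restrict (uIoc 0 h)
  have : IsFiniteMeasure ν := ⟨by simp [ν, uIoc]⟩
  -- `c` is the sign of the oriented interval, so that both signs of `h` are treated at once.
  obtain ⟨c, hc⟩ : ∃ c : ℝ, ∀ F : ℝ → ℝ, ∫ r in (0 : ℝ)..h, F r = c * ∫ r, F r ∂ν :=
    ⟨_, fun F => intervalIntegral.intervalIntegral_eq_integral_uIoc F 0 h volume⟩
  have hecont : Continuous fun p : ℝ × Z => e p.1 p.2 := by
    have := hX.continuous
    simp only [he]
    fun_prop
  have hskew : MeasurePreserving (fun p : ℝ × Z => (p.1, e p.1 p.2)) (ν.prod m) (ν.prod m) :=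
    (MeasurePreserving.id ν).skew_product (g := fun r z => e r z) hecont.measurable
      (Eventually.of_forall fun r => (hmpe r).map_eq)
  have hG'2 : Integrable (fun p : ℝ × Z => G' (e p.1 p.2)) (ν.prod m) :=
    hskew.integrable_comp_of_integrable (hG'.comp_snd ν)
  -- From a point of `W` the whole segment of the flow up to time `h` stays in `Q`, so the cut-offs
  -- in `G` and `G'` are invisible there.
  let W : Set Z := Q ∩ (e h) ⁻¹' Q
  have hW : IsOpen W := hQ.inter (hQ.preimage (e h).continuous)
  have hWr : ∀ z ∈ W, ∀ r ∈ uIcc 0 h, e r z ∈ Q := fun z hz r hr => hQc z hz.1 h hz.2 r hr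
  let D : Z → ℝ := fun z => G (e h z) - G z - ∫ r in (0 : ℝ)..h, G' (e r z)
  have hD1 : Integrable (fun z => G (e h z)) m := (hmpe h).integrable_comp_of_integrable hG
  have hD3 : Integrable (fun z => ∫ r in (0 : ℝ)..h, G' (e r z)) m := by
    simp_rw [hc]
    exact hG'2.integral_prod_right.const_mul c
  have hD : Integrable D m := (hD1.sub hG).sub hD3
  have hzero : ∀ᵐ z ∂m, z ∈ W → D z = 0 := by
    refine hW.ae_eq_zero_of_integral_contDiff_smul_eq_zero (hD.locallyIntegrable.locallyIntegrableOn W)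
      fun ψ hψ hψc hψs => ?_
    obtain ⟨K, hK⟩ := hψ.continuous.bounded_above_of_compact_support hψc
    have hmul : ∀ {F : Z → ℝ}, Integrable F m → Integrable (fun z => ψ z * F z) m := fun hF =>
      hF.bdd_mul hψ.continuous.aestronglyMeasurable (Eventually.of_forall hK)
    let ψX : Z → ℝ := fun z => fderiv ℝ ψ z (X z)
    have hψXcont : Continuous ψX :=
      (hψ.continuous_fderiv (by simp)).clm_apply hX.continuous
    have hψXc : HasCompactSupport ψX := by
      refine (hψc.fderiv (𝕜 := ℝ)).mono' ?_
      refine subset_trans (fun z hz => ?_) subset_closure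
      intro h0
      apply hz
      simp only [ψX]
      rw [h0]; rfl
    obtain ⟨K', hK'⟩ := hψXcont.bounded_above_of_compact_support hψXc
    have hderiv : ∀ r z (t : ℝ), HasDerivAt (fun t : ℝ => ψ (e (t + r) z)) (ψX (e (t + r) z)) t := by
      intro r z t
      have h1 : HasDerivAt (fun t : ℝ => e (t + r) z) (X z) t := by
        simp only [he]
        simpa using (((hasDerivAt_id t).add_const r).smul_const (X z)).const_add z
      have h2 := ((hψ.differentiable (by simp)) (e (t + r) z)).hasFDerivAt.comp_hasDerivAt t h1
      simp only [ψX, hXe]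
      exact h2
    have hshift : ∀ r, ∀ z, fderiv ℝ (fun z => ψ (e (-r) z)) z (X z) = ψX (e (-r) z) := by
      intro r z
      have hdiff : DifferentiableAt ℝ (fun z => ψ (e (-r) z)) z := by
        have h1 : Differentiable ℝ X := hX.differentiable (by simp)
        have h2 : Differentiable ℝ ψ := hψ.differentiable (by simp)
        simp only [he]
        fun_prop
      have h1 : HasDerivAt (fun t : ℝ => z + t • X z) (X z) 0 := by
        simpa using ((hasDerivAt_id (0 : ℝ)).smul_const (X z)).const_add z
      have h2 := hdiff.hasFDerivAt.comp_hasDerivAt_of_eq (0 : ℝ) h1 (by simp)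
      have h3 := hderiv (-r) z 0
      have h4 : (fun t : ℝ => ψ (e (t + -r) z)) =
          (fun z => ψ (e (-r) z)) ∘ fun t : ℝ => z + t • X z := by
        ext t
        simp only [Function.comp, he, hXX]
        congr 1
        module
      rw [h4] at h3
      rw [zero_add] at h3
      exact h2.unique h3
    -- For these `r` the shifted test function is again supported in `Q`, because `ψ` is supported
    -- in `W`.
    have hweakr : ∀ r ∈ uIoc 0 h, ∫ z, ψ z * G' (e r z) ∂m = -∫ z, G z * ψX (e (-r) z) ∂m := by
      intro r hr
      have hr' : r ∈ uIcc 0 h := uIoc_subset_uIcc hr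
      have hs : tsupport (fun z => ψ (e (-r) z)) ⊆ Q := by
        have : tsupport (ψ ∘ (e (-r))) = (e (-r)) ⁻¹' tsupport ψ :=
          tsupport_comp_eq_preimage ψ (e (-r))
        intro z hz
        have hz' : e (-r) z ∈ tsupport ψ := by
          change z ∈ tsupport (ψ ∘ (e (-r))) at hz
          rw [this] at hz
          exact hz
        have := hWr _ (hψs hz') r hr'
        rwa [hee'] at this
      have hcd : ContDiff ℝ ∞ (fun z => ψ (e (-r) z)) := by
        simp only [he]
        exact hψ.comp (contDiff_id.add (contDiff_const.smul hX))
      have hw := hweak (fun z => ψ (e (-r) z)) hcd (hψc.comp_homeomorph (e (-r))) hs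
      have e1 : ∫ z, ψ z * G' (e r z) ∂m = ∫ z, ψ (e (-r) z) * G' z ∂m := by
        rw [← hsubst (-r) (fun z => ψ z * G' (e r z))]
        simp only [hee']
      have e2 : ∫ z, ψ (e (-r) z) * G' z ∂m = ∫ z in Q, g' z * ψ (e (-r) z) ∂m := by
        rw [← integral_indicator hQ.measurableSet]
        congr 1 with z
        simp only [G', indicator]
        split_ifs <;> ring
      have e3 : ∫ z, G z * ψX (e (-r) z) ∂m =
          ∫ z in Q, g z * fderiv ℝ (fun z => ψ (e (-r) z)) z (X z) ∂m := by
        rw [← integral_indicator hQ.measurableSet]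
        congr 1 with z
        simp only [G, indicator, hshift]
        split_ifs <;> ring
      rw [e1, e2, e3, hw, neg_neg]
    have hGψ : Integrable (fun p : ℝ × Z => G p.2 * ψX (e (-p.1) p.2)) (ν.prod m) := by
      refine (hG.comp_snd ν).mul_bdd (c := K') ?_ (Eventually.of_forall fun p => hK' _)
      refine Continuous.aestronglyMeasurable ?_
      exact hψXcont.comp (hecont.comp (by fun_prop : Continuous fun p : ℝ × Z => (-p.1, p.2)))
    have hψG' : Integrable (fun p : ℝ × Z => ψ p.2 * G' (e p.1 p.2)) (ν.prod m) :=
      hG'2.bdd_mul (hψ.continuous.comp continuous_snd).aestronglyMeasurable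
        (Eventually.of_forall fun p => hK p.2)
    have hftc : ∀ z, ∫ r in (0 : ℝ)..h, ψX (e (-r) z) = ψ z - ψ (e (-h) z) := by
      intro z
      have h1 : ∀ r ∈ uIcc (0 : ℝ) h, HasDerivAt (fun r : ℝ => -ψ (e (-r) z)) (ψX (e (-r) z)) r := by
        intro r _
        have := (hderiv 0 z (-r)).scomp r (hasDerivAt_neg r)
        simp only [add_zero] at this
        have h2 := this.neg
        simp only [neg_smul, one_smul, neg_neg] at h2
        exact h2
      have hcont : Continuous fun r : ℝ => ψX (e (-r) z) :=
        hψXcont.comp (hecont.comp (by fun_prop : Continuous fun r : ℝ => (-r, z)))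
      rw [intervalIntegral.integral_eq_sub_of_hasDerivAt h1 (hcont.intervalIntegrable _ _)]
      simp only [he]
      simp
      ring
    have t1 : ∫ z, ψ z * G (e h z) ∂m = ∫ z, ψ (e (-h) z) * G z ∂m := by
      rw [← hsubst (-h) (fun z => ψ z * G (e h z))]
      simp only [hee']
    have t3 : ∫ z, ψ z * (∫ r in (0 : ℝ)..h, G' (e r z)) ∂m =
        -∫ z, G z * (ψ z - ψ (e (-h) z)) ∂m := by
      calc ∫ z, ψ z * (∫ r in (0 : ℝ)..h, G' (e r z)) ∂m
          = c * ∫ z, ∫ r, ψ z * G' (e r z) ∂ν ∂m := by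
            rw [← integral_const_mul]
            congr 1 with z
            rw [hc, integral_const_mul]
            ring
        _ = c * ∫ r, ∫ z, ψ z * G' (e r z) ∂m ∂ν := by
            rw [integral_integral_swap (f := fun z r => ψ z * G' (e r z)) hψG'.swap]
        _ = c * ∫ r, -∫ z, G z * ψX (e (-r) z) ∂m ∂ν := by
            congr 1
            exact setIntegral_congr_fun measurableSet_uIoc hweakr
        _ = -(c * ∫ z, ∫ r, G z * ψX (e (-r) z) ∂ν ∂m) := by
            rw [integral_neg, mul_neg, integral_integral_swap hGψ]
        _ = _ := by
            rw [← integral_const_mul]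
            congr 2 with z
            rw [← hftc, hc, integral_const_mul]
            ring
    have hψe : Integrable (fun z => ψ (e (-h) z) * G z) m :=
      hG.bdd_mul (hψ.continuous.comp (e (-h)).continuous).aestronglyMeasurable
        (Eventually.of_forall fun z => hK _)
    calc ∫ z, ψ z • D z ∂m
        = ∫ z, (ψ z * G (e h z) - ψ z * G z) - ψ z * (∫ r in (0 : ℝ)..h, G' (e r z)) ∂m := by
          congr 1 with z
          simp only [D, smul_eq_mul]
          ring
      _ = (∫ z, ψ z * G (e h z) ∂m - ∫ z, ψ z * G z ∂m)
          - ∫ z, ψ z * (∫ r in (0 : ℝ)..h, G' (e r z)) ∂m := by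
          have hs : Integrable (fun z => ψ z * G (e h z) - ψ z * G z) m :=
            (hmul hD1).sub (hmul hG)
          rw [integral_sub hs (hmul hD3),
            integral_sub (hmul hD1) (hmul hG)]
      _ = 0 := by
          have : ∫ z, G z * (ψ z - ψ (e (-h) z)) ∂m =
              ∫ z, ψ z * G z ∂m - ∫ z, ψ (e (-h) z) * G z ∂m := by
            rw [← integral_sub (hmul hG) hψe]
            congr 1 with z
            ring
          rw [t1, t3, this]
          ring
  filter_upwards [hzero] with z hz hzQ hzh
  have hzW : z ∈ W := ⟨hzQ, hzh⟩
  have h1 := hz hzW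
  simp only [D, G] at h1
  rw [indicator_of_mem (show e h z ∈ Q from hzh), indicator_of_mem hzQ] at h1
  have h2 : ∫ r in (0 : ℝ)..h, G' (e r z) = ∫ r in (0 : ℝ)..h, g' (z + r • X z) := by
    refine intervalIntegral.integral_congr fun r hr => ?_
    exact indicator_of_mem (hWr z hzW r hr) _
  rw [h2] at h1
  simp only [he] at h1
  linarith

end Flow

end

/-! ### Increments along time lines and transport lines -/

section

variable {d : ℕ}

theorem isProbabilityMeasure_sphereMeasure (hd : 2 ≤ d) :
    IsProbabilityMeasure (sphereMeasure d) := by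
  have : Nontrivial (Euc d) := by
    have : Nonempty (Fin d) := ⟨⟨0, by omega⟩⟩
    infer_instance
  have hne : (volume : Measure (Euc d)).toSphere univ ≠ 0 := by
    rw [Ne, Measure.measure_univ_eq_zero]
    exact Measure.toSphere_ne_zero _
  refine ⟨?_⟩
  rw [sphereMeasure, Measure.smul_apply, smul_eq_mul,
    ENNReal.inv_mul_cancel hne (measure_ne_top _ _)]

/-! ### Transfer of weak derivatives to the phase space -/

def phaseTimeIncl (p : ℝ × Euc d × Sph d) : ℝ × Euc d × Euc d := (p.1, p.2.1, (p.2.2 : Euc d))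

def phaseIncl (p : Euc d × Sph d) : Euc d × Euc d := (p.1, (p.2 : Euc d))

theorem measurableEmbedding_phaseIncl : MeasurableEmbedding (phaseIncl (d := d)) :=
  MeasurableEmbedding.id.prodMap (MeasurableEmbedding.subtype_coe
    (Metric.isClosed_sphere (x := (0 : Euc d)) (ε := 1)).measurableSet)

theorem measurableEmbedding_phaseTimeIncl : MeasurableEmbedding (phaseTimeIncl (d := d)) :=
  MeasurableEmbedding.id.prodMap measurableEmbedding_phaseIncl

theorem ae_fst_mem {Ω : Set (Euc d)} (hΩ : IsOpen Ω) : ∀ᵐ q ∂phaseMeasure Ω, q.1 ∈ Ω :=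
  (Measure.quasiMeasurePreserving_fst (μ := volume.restrict Ω) (ν := sphereMeasure d)).ae
    (ae_restrict_mem hΩ.measurableSet)

variable [IsProbabilityMeasure (sphereMeasure d)]

/-- The measure `dt dx dω(v)` on the whole space. -/
def totalMeasure (d : ℕ) : Measure (ℝ × Euc d × Sph d) :=
  volume.prod (volume.prod (sphereMeasure d))

instance : SFinite (totalMeasure d) := by unfold totalMeasure; infer_instance

theorem phaseTimeMeasure_eq_restrict (Ω : Set (Euc d)) (T : ℝ) :
    phaseTimeMeasure Ω T = (totalMeasure d).restrict (Ioo 0 T ×ˢ Ω ×ˢ univ) := by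
  rw [phaseTimeMeasure, phaseMeasure, totalMeasure, ← Measure.prod_restrict,
    ← Measure.prod_restrict, Measure.restrict_univ]

/-- The sphere is not a vector space. The measure is pushed forward to ℝ × ℝᵈ × ℝᵈ, where the
velocity is a free variable and the functions are extended by zero off the sphere; the flow lemma is
applied there and pulled back. -/
theorem ae_sub_eq_of_weakDeriv {Ω : Set (Euc d)} (hΩ : IsOpen Ω) {T : ℝ}
    (X : ℝ × Euc d × Euc d → ℝ × Euc d × Euc d) (hX : ContDiff ℝ ∞ X)
    (hXX : ∀ z (r : ℝ), X (z + r • X z) = X z)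
    (Φ : ℝ → ℝ × Euc d × Sph d → ℝ × Euc d × Sph d)
    (hΦX : ∀ r p, phaseTimeIncl (Φ r p) = phaseTimeIncl p + r • X (phaseTimeIncl p))
    (hΦ : ∀ r, MeasurePreserving (Φ r) (totalMeasure d) (totalMeasure d))
    (hQc : ∀ z ∈ Ioo 0 T ×ˢ Ω ×ˢ (univ : Set (Euc d)), ∀ h : ℝ,
      z + h • X z ∈ Ioo 0 T ×ˢ Ω ×ˢ (univ : Set (Euc d)) →
        ∀ r ∈ uIcc 0 h, z + r • X z ∈ Ioo 0 T ×ˢ Ω ×ˢ (univ : Set (Euc d)))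
    {g g' : ℝ × Euc d × Sph d → ℝ} (hg : Integrable g (phaseTimeMeasure Ω T))
    (hg' : Integrable g' (phaseTimeMeasure Ω T))
    (hweak : ∀ ψ, IsTimeTestFunction Ω T ψ →
      ∫ p, g p * fderiv ℝ ψ (phaseTimeIncl p) (X (phaseTimeIncl p)) ∂phaseTimeMeasure Ω T
        = -∫ p, g' p * ψ (phaseTimeIncl p) ∂phaseTimeMeasure Ω T) (h : ℝ) :
    ∀ᵐ p ∂totalMeasure d, p ∈ Ioo 0 T ×ˢ Ω ×ˢ (univ : Set (Sph d)) →
      Φ h p ∈ Ioo 0 T ×ˢ Ω ×ˢ (univ : Set (Sph d)) →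
      g (Φ h p) - g p = ∫ r in (0 : ℝ)..h, g' (Φ r p) := by
  have hι := measurableEmbedding_phaseTimeIncl (d := d)
  set Q : Set (ℝ × Euc d × Euc d) := Ioo 0 T ×ˢ Ω ×ˢ univ with hQdef
  have hQ : IsOpen Q := isOpen_Ioo.prod (hΩ.prod isOpen_univ)
  have hpre : phaseTimeIncl ⁻¹' Q = Ioo 0 T ×ˢ Ω ×ˢ (univ : Set (Sph d)) := by
    ext p
    simp [Q, phaseTimeIncl]
  rw [phaseTimeMeasure_eq_restrict, ← hpre] at hg hg' hweak
  have hext : ∀ (f : ℝ × Euc d × Sph d → ℝ) p,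
      Function.extend phaseTimeIncl f 0 (phaseTimeIncl p) = f p := fun f p =>
    hι.injective.extend_apply f 0 p
  have hcomp : ∀ (f : ℝ × Euc d × Sph d → ℝ),
      Function.extend phaseTimeIncl f 0 ∘ phaseTimeIncl = f := fun f => funext (hext f)
  have hmp : ∀ r : ℝ, MeasurePreserving (fun z => z + r • X z)
      ((totalMeasure d).map phaseTimeIncl) ((totalMeasure d).map phaseTimeIncl) := by
    intro r
    have hc : Continuous X := hX.continuous
    refine ⟨by fun_prop, ?_⟩
    rw [Measure.map_map (by fun_prop) hι.measurable]
    have : (fun z => z + r • X z) ∘ phaseTimeIncl = phaseTimeIncl ∘ Φ r := by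
      ext1 p
      exact (hΦX r p).symm
    rw [this, ← Measure.map_map hι.measurable (hΦ r).measurable, (hΦ r).map_eq]
  have key := ae_sub_eq_intervalIntegral_of_weakDeriv ((totalMeasure d).map phaseTimeIncl) X hX hXX
    hmp hQ hQc (g := Function.extend phaseTimeIncl g 0) (g' := Function.extend phaseTimeIncl g' 0)
    (by rw [hι.integrableOn_map_iff, hcomp]; exact hg)
    (by rw [hι.integrableOn_map_iff, hcomp]; exact hg')
    (fun ψ h1 h2 h3 => by
      rw [hι.setIntegral_map, hι.setIntegral_map]
      simp only [hext]
      exact hweak ψ ⟨h1, h2, h3⟩) h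
  rw [hι.ae_map_iff] at key
  filter_upwards [key] with p hp hp1 hp2
  simp only [← hΦX, hext] at hp
  rw [← hpre] at hp1 hp2
  exact hp hp1 hp2

/-- The shear `(t, x, v) ↦ (t, x + r v, v)`. -/
theorem measurePreserving_transport (r : ℝ) :
    MeasurePreserving (fun q : Euc d × Sph d => (q.1 + r • (q.2 : Euc d), q.2))
      (volume.prod (sphereMeasure d)) (volume.prod (sphereMeasure d)) := by
  have h := (MeasurePreserving.id (sphereMeasure d)).skew_product (μc := (volume : Measure (Euc d)))
    (g := fun v x => x + r • (v : Euc d)) (by unfold Function.uncurry; fun_prop)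
    (Eventually.of_forall fun v => (measurePreserving_add_right volume (r • (v : Euc d))).map_eq)
  exact (Measure.measurePreserving_swap.comp h).comp Measure.measurePreserving_swap

theorem HasWeakTimeDeriv.ae_sub_eq {Ω : Set (Euc d)} (hΩ : IsOpen Ω) {T : ℝ}
    {g g' : ℝ × Euc d × Sph d → ℝ} (hg : Integrable g (phaseTimeMeasure Ω T))
    (hg' : Integrable g' (phaseTimeMeasure Ω T)) (hweak : HasWeakTimeDeriv Ω T g g') (h : ℝ) :
    ∀ᵐ p ∂totalMeasure d, p.1 ∈ Ioo 0 T → p.2.1 ∈ Ω → p.1 + h ∈ Ioo 0 T →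
      g (p.1 + h, p.2) - g p = ∫ r in (0 : ℝ)..h, g' (p.1 + r, p.2) := by
  have := ae_sub_eq_of_weakDeriv hΩ (T := T) (fun _ => ((1 : ℝ), (0 : Euc d), (0 : Euc d)))
    contDiff_const (fun _ _ => rfl) (fun r p => (p.1 + r, p.2))
    (fun r p => by simp [phaseTimeIncl])
    (fun r => (measurePreserving_add_right volume r).prod (MeasurePreserving.id _))
    (fun z hz h hh r hr => by
      simp only [mem_prod, Prod.fst_add, Prod.smul_mk, smul_eq_mul, mul_one, Prod.snd_add,
        smul_zero, add_zero, mem_univ, and_true] at hz hh ⊢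
      refine ⟨?_, hz.2⟩
      have h1 : z.1 + r ∈ uIcc z.1 (z.1 + h) := by
        rw [mem_uIcc] at hr ⊢
        rcases hr with hr | hr
        · left; constructor <;> linarith
        · right; constructor <;> linarith
      exact (ordConnected_Ioo.uIcc_subset hz.1 hh.1) h1)
    hg hg' (fun ψ hψ => hweak ψ hψ) h
  filter_upwards [this] with p hp h1 h2 h3
  exact hp ⟨h1, h2, mem_univ _⟩ ⟨h3, h2, mem_univ _⟩

theorem HasWeakTransportDerivT.ae_sub_eq {Ω : Set (Euc d)} (hΩ : IsOpen Ω) (hc : Convex ℝ Ω) {T : ℝ}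
    {g g' : ℝ × Euc d × Sph d → ℝ} (hg : Integrable g (phaseTimeMeasure Ω T))
    (hg' : Integrable g' (phaseTimeMeasure Ω T)) (hweak : HasWeakTransportDerivT Ω T g g')
    (h : ℝ) :
    ∀ᵐ p ∂totalMeasure d, p.1 ∈ Ioo 0 T → p.2.1 ∈ Ω → p.2.1 + h • (p.2.2 : Euc d) ∈ Ω →
      g (p.1, p.2.1 + h • (p.2.2 : Euc d), p.2.2) - g p =
        ∫ r in (0 : ℝ)..h, g' (p.1, p.2.1 + r • (p.2.2 : Euc d), p.2.2) := by
  have := ae_sub_eq_of_weakDeriv hΩ (T := T)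
    (fun z : ℝ × Euc d × Euc d => ((0 : ℝ), z.2.2, (0 : Euc d)))
    (by fun_prop) (fun z r => by simp)
    (fun r p => (p.1, p.2.1 + r • (p.2.2 : Euc d), p.2.2))
    (fun r p => by simp [phaseTimeIncl])
    (fun r => (MeasurePreserving.id volume).prod (measurePreserving_transport r))
    (fun z hz h hh r hr => by
      simp only [mem_prod, Prod.fst_add, Prod.smul_mk, smul_eq_mul, mul_zero, Prod.snd_add,
        smul_zero, add_zero, mem_univ, and_true] at hz hh ⊢
      refine ⟨hz.1, ?_⟩
      have h1 : Convex ℝ {r : ℝ | z.2.1 + r • z.2.2 ∈ Ω} := by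
        intro a ha b hb s t hs ht hst
        have h2 := hc ha hb hs ht hst
        rw [mem_ofPred_eq]
        convert h2 using 1
        have h3 : z.2.1 = (s + t) • z.2.1 := by rw [hst, one_smul]
        nth_rw 1 [h3]
        simp only [smul_eq_mul]
        module
      have h0 : (0 : ℝ) ∈ {r : ℝ | z.2.1 + r • z.2.2 ∈ Ω} := by simpa using hz.2
      exact h1.ordConnected.uIcc_subset h0 hh.2 hr)
    hg hg' (fun ψ hψ => hweak ψ hψ) h
  filter_upwards [this] with p hp h1 h2 h3
  exact hp ⟨h1, h2, mem_univ _⟩ ⟨h1, h3, mem_univ _⟩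

/-- Uniqueness of the weak transport derivative. -/
theorem ae_eq_of_integral_testFunction_eq {Ω : Set (Euc d)} (hΩ : IsOpen Ω)
    {g g' : Euc d × Sph d → ℝ} (hg : Integrable g (phaseMeasure Ω))
    (hg' : Integrable g' (phaseMeasure Ω))
    (h : ∀ ψ, IsTestFunction Ω ψ → ∫ p, g p * ψ (p.1, (p.2 : Euc d)) ∂phaseMeasure Ω =
      ∫ p, g' p * ψ (p.1, (p.2 : Euc d)) ∂phaseMeasure Ω) :
    ∀ᵐ q ∂phaseMeasure Ω, g q = g' q := by
  have hι := measurableEmbedding_phaseIncl (d := d)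
  let D := Function.extend phaseIncl (g - g') 0
  have hD : D ∘ phaseIncl = g - g' := funext fun p => hι.injective.extend_apply (g - g') 0 p
  have hDi : Integrable D ((phaseMeasure Ω).map phaseIncl) := by
    rw [hι.integrable_map_iff, hD]
    exact hg.sub hg'
  have hopen : IsOpen (Ω ×ˢ (univ : Set (Euc d))) := hΩ.prod isOpen_univ
  have key : ∀ᵐ z ∂(phaseMeasure Ω).map phaseIncl, z ∈ Ω ×ˢ (univ : Set (Euc d)) → D z = 0 := by
    refine hopen.ae_eq_zero_of_integral_contDiff_smul_eq_zero
      (hDi.locallyIntegrable.locallyIntegrableOn _) fun ψ hψ hψc hψs => ?_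
    obtain ⟨K, hK⟩ := hψ.continuous.bounded_above_of_compact_support hψc
    have hm : AEStronglyMeasurable (fun p : Euc d × Sph d => ψ (p.1, (p.2 : Euc d)))
        (phaseMeasure Ω) := by
      refine Continuous.aestronglyMeasurable ?_
      exact hψ.continuous.comp (by fun_prop)
    have hb : ∀ {F : Euc d × Sph d → ℝ}, Integrable F (phaseMeasure Ω) →
        Integrable (fun p => F p * ψ (p.1, (p.2 : Euc d))) (phaseMeasure Ω) := fun hF =>
      hF.mul_bdd hm (Eventually.of_forall fun p => hK _)
    rw [hι.integral_map]
    calc ∫ p, ψ (phaseIncl p) • D (phaseIncl p) ∂phaseMeasure Ω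
        = ∫ p, g p * ψ (p.1, (p.2 : Euc d)) - g' p * ψ (p.1, (p.2 : Euc d)) ∂phaseMeasure Ω := by
          congr 1 with p
          have : D (phaseIncl p) = g p - g' p := congr_fun hD p
          rw [this, smul_eq_mul, phaseIncl]
          ring
      _ = 0 := by rw [integral_sub (hb hg) (hb hg'), h ψ ⟨hψ, hψc, hψs⟩, sub_self]
  rw [hι.ae_map_iff] at key
  filter_upwards [key, ae_fst_mem hΩ] with q hq hqΩ
  have h1 := hq ⟨hqΩ, mem_univ _⟩
  have h2 : D (phaseIncl q) = g q - g' q := congr_fun hD q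
  linarith

end

/-! ### Primitives in time -/

section

section TimePrimitive

variable {α : Type*} [MeasurableSpace α]

theorem ae_ae_of_ae_prod_swap {β : Type*} [MeasurableSpace β] {μ : Measure α} {ν : Measure β}
    [SFinite μ] [SFinite ν] {p : α × β → Prop} (h : ∀ᵐ z ∂μ.prod ν, p z) :
    ∀ᵐ y ∂ν, ∀ᵐ x ∂μ, p (x, y) :=
  Measure.ae_ae_of_ae_prod
    ((Measure.measurePreserving_swap (μ := ν) (ν := μ)).quasiMeasurePreserving.ae h)

theorem ae_prod_of_ae_ae_swap {β : Type*} [MeasurableSpace β] {μ : Measure α} {ν : Measure β}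
    [SFinite μ] [SFinite ν] {p : α × β → Prop} (hp : MeasurableSet {z | p z})
    (h : ∀ᵐ y ∂ν, ∀ᵐ x ∂μ, p (x, y)) : ∀ᵐ z ∂μ.prod ν, p z := by
  have h1 : ∀ᵐ z ∂ν.prod μ, p z.swap :=
    (Measure.ae_prod_iff_ae_ae (p := fun z : β × α => p z.swap) (measurable_swap hp)).mpr h
  have := (Measure.measurePreserving_swap (μ := μ) (ν := ν)).quasiMeasurePreserving.ae h1
  simpa using this

theorem stronglyMeasurable_intervalIntegral {β : Type*} [MeasurableSpace β] {f : β → ℝ → ℝ}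
    (hf : StronglyMeasurable (Function.uncurry f)) {a b : β → ℝ} (ha : Measurable a)
    (hb : Measurable b) : StronglyMeasurable fun z => ∫ r in a z..b z, f z r := by
  have key : ∀ {a b : β → ℝ}, Measurable a → Measurable b →
      StronglyMeasurable fun z => ∫ r in Ioc (a z) (b z), f z r := by
    intro a b ha hb
    have hm : MeasurableSet {p : β × ℝ | p.2 ∈ Ioc (a p.1) (b p.1)} :=
      (measurableSet_lt (ha.comp measurable_fst) measurable_snd).inter
        (measurableSet_le measurable_snd (hb.comp measurable_fst))
    have h1 : StronglyMeasurable
        (Function.uncurry fun z r => (Ioc (a z) (b z)).indicator (f z) r) := by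
      have := hf.indicator hm
      convert this using 1
      ext p
      rfl
    have h2 := h1.integral_prod_right (ν := (volume : Measure ℝ))
    simpa only [integral_indicator measurableSet_Ioc] using h2
  exact (key ha hb).sub (key hb ha)

variable {P : Measure α} {T : ℝ}

theorem ae_fst_mem_Ioo : ∀ᵐ p ∂(volume.restrict (Ioo 0 T)).prod P, p.1 ∈ Ioo 0 T :=
  (Measure.quasiMeasurePreserving_fst (μ := volume.restrict (Ioo 0 T)) (ν := P)).ae
    (ae_restrict_mem measurableSet_Ioo)

variable [SFinite P]

theorem stronglyMeasurable_primitive {g : ℝ × α → ℝ} (hg : StronglyMeasurable g) :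
    StronglyMeasurable fun p : ℝ × α => ∫ r in (0 : ℝ)..p.1, g (r, p.2) :=
  stronglyMeasurable_intervalIntegral (f := fun (p : ℝ × α) r => g (r, p.2))
    (hg.comp_measurable (by fun_prop : Measurable fun z : (ℝ × α) × ℝ => (z.2, z.1.2)))
    measurable_const measurable_fst

theorem ae_integrableOn_time {g : ℝ × α → ℝ}
    (hg : Integrable g ((volume.restrict (Ioo 0 T)).prod P)) :
    ∀ᵐ q ∂P, IntegrableOn (fun t => g (t, q)) (Ioo 0 T) := hg.prod_left_ae

theorem norm_primitive_le {f : ℝ → ℝ} (hf : IntegrableOn f (Ioo 0 T)) {t : ℝ} (ht : t ∈ Ioo 0 T) :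
    ‖∫ r in (0 : ℝ)..t, f r‖ ≤ ∫ r in Ioo 0 T, ‖f r‖ := by
  refine (intervalIntegral.norm_integral_le_integral_norm ht.1.le).trans ?_
  rw [intervalIntegral.integral_of_le ht.1.le]
  refine setIntegral_mono_set hf.norm (Eventually.of_forall fun _ => norm_nonneg _) ?_
  exact LE.le.eventuallyLE fun r hr => ⟨hr.1, hr.2.trans_lt ht.2⟩

theorem integrable_primitive {g : ℝ × α → ℝ} (hgm : StronglyMeasurable g)
    (hg : Integrable g ((volume.restrict (Ioo 0 T)).prod P)) :
    Integrable (fun p : ℝ × α => ∫ r in (0 : ℝ)..p.1, g (r, p.2))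
      ((volume.restrict (Ioo 0 T)).prod P) := by
  have h1 : Integrable (fun q => ∫ t in Ioo 0 T, ‖g (t, q)‖) P := hg.norm.integral_prod_right
  have h2 := h1.comp_snd (volume.restrict (Ioo 0 T))
  refine h2.mono (stronglyMeasurable_primitive hgm).aestronglyMeasurable ?_
  refine ae_prod_of_ae_ae_swap ?_ ?_
  · refine measurableSet_le (stronglyMeasurable_primitive hgm).norm.measurable ?_
    have := (hgm.norm.comp_measurable measurable_swap).integral_prod_right'
      (ν := volume.restrict (Ioo 0 T))
    exact (this.norm.measurable).comp measurable_snd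
  · filter_upwards [ae_integrableOn_time hg] with q hq
    filter_upwards [ae_restrict_mem measurableSet_Ioo] with t ht
    refine (norm_primitive_le hq ht).trans (le_abs_self _)

/-- A function whose increments are the integrals of `g'` is a primitive of `g'`. -/
theorem exists_ae_eq_add_primitive (hT : 0 < T) {g g' : ℝ × α → ℝ} (hgm : StronglyMeasurable g)
    (hgm' : StronglyMeasurable g') (hg : Integrable g ((volume.restrict (Ioo 0 T)).prod P))
    (hg' : Integrable g' ((volume.restrict (Ioo 0 T)).prod P))
    (hinc : ∀ h : ℝ, ∀ᵐ p ∂(volume : Measure ℝ).prod P, p.1 ∈ Ioo 0 T → p.1 + h ∈ Ioo 0 T →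
      g (p.1 + h, p.2) - g p = ∫ r in (0 : ℝ)..h, g' (p.1 + r, p.2)) :
    ∃ g₀ : α → ℝ, StronglyMeasurable g₀ ∧ Integrable g₀ P ∧
      ∀ᵐ p ∂(volume.restrict (Ioo 0 T)).prod P,
        g p = g₀ p.2 + ∫ r in (0 : ℝ)..p.1, g' (r, p.2) := by
  -- `H` turns out to be constant in time for almost every q. Its time average `g₀` picks that
  -- constant in a measurable way.
  let H : ℝ × α → ℝ := fun p => g p - ∫ r in (0 : ℝ)..p.1, g' (r, p.2)
  have hHm : StronglyMeasurable H := hgm.sub (stronglyMeasurable_primitive hgm')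
  have hH : Integrable H ((volume.restrict (Ioo 0 T)).prod P) :=
    hg.sub (integrable_primitive hgm' hg')
  let g₀ : α → ℝ := fun q => T⁻¹ * ∫ t in Ioo 0 T, H (t, q)
  have hg₀m : StronglyMeasurable g₀ :=
    ((hHm.comp_measurable measurable_swap).integral_prod_right'
      (ν := volume.restrict (Ioo 0 T))).const_mul _
  refine ⟨g₀, hg₀m, hH.integral_prod_right.const_mul _, ?_⟩
  -- The increments hold for each h off a null set that depends on h. Fubini exchanges the
  -- quantifiers, which requires joint measurability in (h, t, q).
  have hpair : ∀ᵐ q ∂P, ∀ᵐ t : ℝ, t ∈ Ioo 0 T → ∀ᵐ h : ℝ, t + h ∈ Ioo 0 T →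
      g (t + h, q) - g (t, q) = ∫ r in (0 : ℝ)..h, g' (t + r, q) := by
    have hms : MeasurableSet {z : ℝ × (ℝ × α) | z.2.1 ∈ Ioo 0 T → z.2.1 + z.1 ∈ Ioo 0 T →
        g (z.2.1 + z.1, z.2.2) - g z.2 = ∫ r in (0 : ℝ)..z.1, g' (z.2.1 + r, z.2.2)} := by
      have m1 : Measurable fun z : ℝ × (ℝ × α) => g (z.2.1 + z.1, z.2.2) - g z.2 :=
        (hgm.measurable.comp (by fun_prop)).sub (hgm.measurable.comp measurable_snd)
      have m2 : Measurable fun z : ℝ × (ℝ × α) => ∫ r in (0 : ℝ)..z.1, g' (z.2.1 + r, z.2.2) :=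
        (stronglyMeasurable_intervalIntegral
          (f := fun (z : ℝ × (ℝ × α)) r => g' (z.2.1 + r, z.2.2))
          (hgm'.comp_measurable (by fun_prop :
            Measurable fun w : (ℝ × (ℝ × α)) × ℝ => (w.1.2.1 + w.2, w.1.2.2)))
          measurable_const measurable_fst).measurable
      have s1 : MeasurableSet {z : ℝ × (ℝ × α) | z.2.1 ∈ Ioo 0 T} :=
        measurableSet_Ioo.preimage (by fun_prop : Measurable fun z : ℝ × (ℝ × α) => z.2.1)
      have s2 : MeasurableSet {z : ℝ × (ℝ × α) | z.2.1 + z.1 ∈ Ioo 0 T} :=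
        measurableSet_Ioo.preimage (by fun_prop : Measurable fun z : ℝ × (ℝ × α) => z.2.1 + z.1)
      exact s1.imp (s2.imp (measurableSet_eq_fun m1 m2))
    have h0 := (Measure.ae_prod_iff_ae_ae (μ := volume) (ν := volume.prod P) hms).mpr
      (Eventually.of_forall hinc)
    have h1 := ae_ae_of_ae_prod_swap h0
    have h2 := ae_ae_of_ae_prod_swap h1
    filter_upwards [h2] with q hq
    filter_upwards [hq] with t ht htT
    filter_upwards [ht] with h hh
    exact hh htT
  refine ae_prod_of_ae_ae_swap (measurableSet_eq_fun hgm.measurable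
    ((hg₀m.measurable.comp measurable_snd).add (stronglyMeasurable_primitive hgm').measurable)) ?_
  filter_upwards [hpair, ae_integrableOn_time hg'] with q hq hgq
  rw [ae_restrict_iff' measurableSet_Ioo]
  filter_upwards [hq] with t ht htT
  have hi : ∀ s ∈ Ioo 0 T, IntervalIntegrable (fun r => g' (r, q)) volume 0 s := fun s hs => by
    rw [intervalIntegrable_iff_integrableOn_Ioc_of_le hs.1.le]
    exact hgq.mono_set fun r hr => ⟨hr.1, hr.2.trans_lt hs.2⟩
  have hconst : ∀ᵐ s : ℝ, s ∈ Ioo 0 T → H (s, q) = H (t, q) := by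
    have h3 := (measurePreserving_sub_right volume t).quasiMeasurePreserving.ae (ht htT)
    filter_upwards [h3] with s hs hsT
    have h4 := hs (by rwa [add_sub_cancel])
    rw [add_sub_cancel, intervalIntegral.integral_comp_add_left (fun r => g' (r, q)),
      add_zero, add_sub_cancel] at h4
    have h5 := intervalIntegral.integral_interval_sub_left (hi s hsT) (hi t htT)
    simp only [H]
    linarith
  have havg : ∫ s in Ioo 0 T, H (s, q) = T * H (t, q) := by
    rw [setIntegral_congr_ae measurableSet_Ioo hconst]
    simp [hT.le]
  simp only [g₀, havg, inv_mul_cancel_left₀ hT.ne', H]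
  ring

/-- If `c + ∫₀ᵗ H` vanishes for almost all `t` then `c` and `H` vanish. -/
theorem ae_eq_zero_of_add_primitive_eq_zero (hT : 0 < T) {c : α → ℝ} {H : ℝ × α → ℝ}
    (hHm : StronglyMeasurable H)
    (hH : Integrable H ((volume.restrict (Ioo 0 T)).prod P))
    (h : ∀ᵐ p ∂(volume.restrict (Ioo 0 T)).prod P, c p.2 + ∫ r in (0 : ℝ)..p.1, H (r, p.2) = 0) :
    (∀ᵐ q ∂P, c q = 0) ∧ ∀ᵐ p ∂(volume.restrict (Ioo 0 T)).prod P, H p = 0 := by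
  have key : ∀ᵐ q ∂P, c q = 0 ∧ ∀ᵐ t ∂volume.restrict (Ioo 0 T), H (t, q) = 0 := by
    filter_upwards [ae_ae_of_ae_prod_swap h, ae_integrableOn_time hH] with q hq hHq
    have hii : IntervalIntegrable (fun r => H (r, q)) volume 0 T := by
      rw [intervalIntegrable_iff_integrableOn_Ioo_of_le hT.le]
      exact hHq
    let F : ℝ → ℝ := fun t => c q + ∫ r in (0 : ℝ)..t, H (r, q)
    have hFc : ContinuousOn F (Icc 0 T) := by
      have := intervalIntegral.continuousOn_primitive_interval' hii left_mem_uIcc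
      rw [uIcc_of_le hT.le] at this
      exact continuousOn_const.add this
    -- By continuity, vanishing almost everywhere is vanishing on all of [0,T]. The point t = 0
    -- yields c = 0, and Lebesgue differentiation then yields H = 0.
    have hF0 : ∀ t ∈ Icc 0 T, F t = 0 := by
      have h1 : EqOn F (fun _ => 0) (Ioo 0 T) :=
        Measure.eqOn_open_of_ae_eq (μ := volume) hq isOpen_Ioo (hFc.mono Ioo_subset_Icc_self)
          continuousOn_const
      have h2 := h1.of_subset_closure hFc continuousOn_const Ioo_subset_Icc_self
        (by rw [closure_Ioo hT.ne])
      exact h2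
    have hc0 : c q = 0 := by
      have := hF0 0 ⟨le_rfl, hT.le⟩
      simpa [F] using this
    refine ⟨hc0, ?_⟩
    rw [ae_restrict_iff' measurableSet_Ioo]
    filter_upwards [hii.ae_hasDerivAt_integral] with t ht htT
    rw [uIcc_of_le hT.le] at ht
    have h1 := ht (Ioo_subset_Icc_self htT) 0 (left_mem_Icc.mpr hT.le)
    have h2 : HasDerivAt (fun _ : ℝ => (0 : ℝ)) (H (t, q)) t := by
      refine h1.congr_of_eventuallyEq ?_
      filter_upwards [Ioo_mem_nhds htT.1 htT.2] with s hs
      have := hF0 s (Ioo_subset_Icc_self hs)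
      simp only [F, hc0, zero_add] at this
      exact this.symm
    exact h2.unique (hasDerivAt_const t 0)
  exact ⟨key.mono fun q hq => hq.1, ae_prod_of_ae_ae_swap
    (measurableSet_eq_fun hHm.measurable measurable_const) (key.mono fun q hq => hq.2)⟩

end TimePrimitive

end

/-! ### Integral operators bounded on L¹ -/

section

section KernelOperator

variable {α Y : Type*} [MeasurableSpace α] [MeasurableSpace Y]

/-- The operator `f ↦ ∫ κ(q,y) f(θ(q,y)) dν(y)`. -/
def kernelOp (ν : Measure Y) (κ : α × Y → ℝ) (θ : α × Y → α) (f : α → ℝ) (q : α) : ℝ :=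
  ∫ y, κ (q, y) * f (θ (q, y)) ∂ν

/-- The operator `kernelOp ν κ θ` is bounded on `L¹(P)`. -/
structure IsBoundedKernel (P : Measure α) (ν : Measure Y) (κ : α × Y → ℝ) (θ : α × Y → α)
    (C : ℝ≥0∞) : Prop where
  measurable_kernel : Measurable κ
  measurable_map : Measurable θ
  ne_top : C ≠ ⊤
  lintegral_le : ∀ φ : α → ℝ≥0∞, Measurable φ →
    ∫⁻ q, ∫⁻ y, ‖κ (q, y)‖ₑ * φ (θ (q, y)) ∂ν ∂P ≤ C * ∫⁻ q, φ q ∂P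

namespace IsBoundedKernel

variable {P : Measure α} {ν : Measure Y} [SFinite P] [SFinite ν] {κ : α × Y → ℝ} {θ : α × Y → α}
  {C : ℝ≥0∞}

/-- The bound is applied to the indicator of a null set. Changes on null sets are thus invisible to
the operator, although the points θ(q, y) with q fixed may themselves fill only a null set. -/
theorem ae_ae (h : IsBoundedKernel P ν κ θ C) {p : α → Prop} (hp : ∀ᵐ q ∂P, p q) :
    ∀ᵐ q ∂P, ∀ᵐ y ∂ν, κ (q, y) ≠ 0 → p (θ (q, y)) := by
  obtain ⟨N, hN, hNm, hN0⟩ := exists_measurable_superset_of_null (ae_iff.mp hp)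
  have h1 := h.lintegral_le (N.indicator 1) (measurable_one.indicator hNm)
  rw [lintegral_indicator_one hNm, hN0, mul_zero, nonpos_iff_eq_zero] at h1
  have hm : Measurable fun z : α × Y => ‖κ z‖ₑ * N.indicator (1 : α → ℝ≥0∞) (θ z) :=
    h.measurable_kernel.enorm.mul ((measurable_one.indicator hNm).comp h.measurable_map)
  rw [lintegral_eq_zero_iff hm.lintegral_prod_right'] at h1
  filter_upwards [h1] with q hq
  have hmq : Measurable fun y => ‖κ (q, y)‖ₑ * N.indicator (1 : α → ℝ≥0∞) (θ (q, y)) :=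
    hm.comp measurable_prodMk_left
  have hq' := (lintegral_eq_zero_iff hmq).mp hq
  filter_upwards [hq'] with y hy hκ
  by_contra hnp
  have hmem : θ (q, y) ∈ N := hN hnp
  simp only [Pi.zero_apply, mul_eq_zero, enorm_eq_zero, indicator_of_mem hmem, Pi.one_apply,
    one_ne_zero, or_false] at hy
  exact hκ hy

theorem integrable (h : IsBoundedKernel P ν κ θ C) {f : α → ℝ} (hfm : StronglyMeasurable f)
    (hf : Integrable f P) : Integrable (fun z : α × Y => κ z * f (θ z)) (P.prod ν) := by
  have hm : StronglyMeasurable fun z : α × Y => κ z * f (θ z) :=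
    h.measurable_kernel.stronglyMeasurable.mul (hfm.comp_measurable h.measurable_map)
  refine ⟨hm.aestronglyMeasurable, ?_⟩
  rw [HasFiniteIntegral, lintegral_prod _ hm.enorm.aemeasurable]
  simp_rw [enorm_mul]
  refine (h.lintegral_le (fun q => ‖f q‖ₑ) hfm.enorm).trans_lt ?_
  exact ENNReal.mul_lt_top h.ne_top.lt_top hf.2

theorem integrable_kernelOp (h : IsBoundedKernel P ν κ θ C) {f : α → ℝ}
    (hfm : StronglyMeasurable f) (hf : Integrable f P) : Integrable (kernelOp ν κ θ f) P :=
  (h.integrable hfm hf).integral_prod_left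

theorem stronglyMeasurable_kernelOp (h : IsBoundedKernel P ν κ θ C) {f : α → ℝ}
    (hfm : StronglyMeasurable f) : StronglyMeasurable (kernelOp ν κ θ f) :=
  (h.measurable_kernel.stronglyMeasurable.mul
    (hfm.comp_measurable h.measurable_map)).integral_prod_right'

theorem ae_integrable (h : IsBoundedKernel P ν κ θ C) {f : α → ℝ}
    (hfm : StronglyMeasurable f) (hf : Integrable f P) :
    ∀ᵐ q ∂P, Integrable (fun y => κ (q, y) * f (θ (q, y))) ν :=
  (h.integrable hfm hf).prod_right_ae

theorem kernelOp_congr_ae (h : IsBoundedKernel P ν κ θ C) {f g : α → ℝ} (hfg : ∀ᵐ q ∂P, f q = g q) :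
    ∀ᵐ q ∂P, kernelOp ν κ θ f q = kernelOp ν κ θ g q := by
  filter_upwards [h.ae_ae hfg] with q hq
  refine integral_congr_ae ?_
  filter_upwards [hq] with y hy
  by_cases hκ : κ (q, y) = 0
  · rw [hκ, zero_mul, zero_mul]
  · rw [hy hκ]

/-- The kernel acting at each fixed time. -/
theorem time (h : IsBoundedKernel P ν κ θ C) (T : ℝ) :
    IsBoundedKernel ((volume.restrict (Ioo 0 T)).prod P) ν
      (fun z : (ℝ × α) × Y => κ (z.1.2, z.2)) (fun z => (z.1.1, θ (z.1.2, z.2))) C where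
  measurable_kernel := h.measurable_kernel.comp (by fun_prop)
  measurable_map := by
    have := h.measurable_map
    fun_prop
  ne_top := h.ne_top
  lintegral_le φ hφ := by
    have hκ := h.measurable_kernel
    have hθ := h.measurable_map
    have hm : Measurable fun z : (ℝ × α) × Y => ‖κ (z.1.2, z.2)‖ₑ * φ (z.1.1, θ (z.1.2, z.2)) := by
      fun_prop
    rw [lintegral_prod _ hm.lintegral_prod_right'.aemeasurable, lintegral_prod _ hφ.aemeasurable,
      ← lintegral_const_mul _ hφ.lintegral_prod_right']
    exact lintegral_mono fun t => h.lintegral_le (fun q => φ (t, q)) (hφ.comp measurable_prodMk_left)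

/-- This supplies, for fixed q, the joint integrability in (t, y) that allows time integrals to be
exchanged with the kernel. -/
theorem ae_integrable_time (h : IsBoundedKernel P ν κ θ C) {T : ℝ} {g : ℝ × α → ℝ}
    (hgm : StronglyMeasurable g) (hg : Integrable g ((volume.restrict (Ioo 0 T)).prod P)) :
    ∀ᵐ q ∂P, Integrable (fun z : ℝ × Y => κ (q, z.2) * g (z.1, θ (q, z.2)))
      ((volume.restrict (Ioo 0 T)).prod ν) := by
  have h1 := ((h.time T).integrable hgm hg)
  have hm : StronglyMeasurable fun z : (ℝ × α) × Y => κ (z.1.2, z.2) * g (z.1.1, θ (z.1.2, z.2)) :=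
    (h.time T).measurable_kernel.stronglyMeasurable.mul
      (hgm.comp_measurable (h.time T).measurable_map)
  have h2 := h1.2
  rw [HasFiniteIntegral, lintegral_prod _ hm.enorm.aemeasurable,
    lintegral_prod_symm _ hm.enorm.lintegral_prod_right'.aemeasurable] at h2
  have hm2 : Measurable fun z : (α × ℝ) × Y => ‖κ (z.1.1, z.2) * g (z.1.2, θ (z.1.1, z.2))‖ₑ :=
    hm.enorm.comp (by fun_prop : Measurable fun z : (α × ℝ) × Y => ((z.1.2, z.1.1), z.2))
  have hm3 : Measurable fun q => ∫⁻ t in Ioo 0 T, ∫⁻ y, ‖κ (q, y) * g (t, θ (q, y))‖ₑ ∂ν :=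
    (hm2.lintegral_prod_right').lintegral_prod_right' (ν := volume.restrict (Ioo 0 T))
  filter_upwards [ae_lt_top hm3 h2.ne] with q hq
  have hmq : StronglyMeasurable fun z : ℝ × Y => κ (q, z.2) * g (z.1, θ (q, z.2)) :=
    hm.comp_measurable (by fun_prop : Measurable fun z : ℝ × Y => ((z.1, q), z.2))
  refine ⟨hmq.aestronglyMeasurable, ?_⟩
  rw [HasFiniteIntegral, lintegral_prod _ hmq.enorm.aemeasurable]
  exact hq

/-- The kernel acts at each fixed time, so by Fubini the operator commutes with primitives in time.
It is used for scattering and for integration along rays alike. -/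
theorem kernelOp_primitive (h : IsBoundedKernel P ν κ θ C) {T : ℝ} {g g' : ℝ × α → ℝ}
    {g₀ : α → ℝ} (hgm : StronglyMeasurable g) (hg : Integrable g ((volume.restrict (Ioo 0 T)).prod P))
    (hgm' : StronglyMeasurable g') (hg' : Integrable g' ((volume.restrict (Ioo 0 T)).prod P))
    (hg₀m : StronglyMeasurable g₀) (hg₀ : Integrable g₀ P)
    (hrep : ∀ᵐ p ∂(volume.restrict (Ioo 0 T)).prod P,
        g p = g₀ p.2 + ∫ r in (0 : ℝ)..p.1, g' (r, p.2)) :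
    ∀ᵐ p ∂(volume.restrict (Ioo 0 T)).prod P,
      ∫ y, κ (p.2, y) * g (p.1, θ (p.2, y)) ∂ν = kernelOp ν κ θ g₀ p.2 +
        ∫ r in (0 : ℝ)..p.1, ∫ y, κ (p.2, y) * g' (r, θ (p.2, y)) ∂ν := by
  have h1 := (h.time T).ae_ae hrep
  have h2 := (h.time T).ae_integrable hgm hg
  have h3 : ∀ᵐ p ∂(volume.restrict (Ioo 0 T)).prod P,
      Integrable (fun y => κ (p.2, y) * g₀ (θ (p.2, y))) ν :=
    (Measure.quasiMeasurePreserving_snd (μ := volume.restrict (Ioo 0 T)) (ν := P)).ae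
      (h.ae_integrable hg₀m hg₀)
  have h4 := (Measure.quasiMeasurePreserving_snd (μ := volume.restrict (Ioo 0 T)) (ν := P)).ae
      (h.ae_integrable_time hgm' hg')
  filter_upwards [h1, h2, h3, h4, ae_fst_mem_Ioo] with p hp1 hp2 hp3 hp4 hpT
  have hsub : Ioc 0 p.1 ⊆ Ioo 0 T := fun r hr => ⟨hr.1, hr.2.trans_lt hpT.2⟩
  have e1 : (fun y => κ (p.2, y) * g (p.1, θ (p.2, y)) - κ (p.2, y) * g₀ (θ (p.2, y))) =ᵐ[ν]
      fun y => ∫ r in (0 : ℝ)..p.1, κ (p.2, y) * g' (r, θ (p.2, y)) := by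
    filter_upwards [hp1] with y hy
    rw [intervalIntegral.integral_const_mul]
    by_cases hκ : κ (p.2, y) = 0
    · simp [hκ]
    · rw [hy hκ]; ring
  have e2 : ∫ y, (∫ r in (0 : ℝ)..p.1, κ (p.2, y) * g' (r, θ (p.2, y))) ∂ν =
      ∫ r in (0 : ℝ)..p.1, ∫ y, κ (p.2, y) * g' (r, θ (p.2, y)) ∂ν := by
    simp_rw [intervalIntegral.integral_of_le hpT.1.le]
    rw [integral_integral_swap]
    refine Integrable.swap (f := fun z : ℝ × Y => κ (p.2, z.2) * g' (z.1, θ (p.2, z.2))) ?_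
    exact hp4.mono_measure (Measure.prod_mono (Measure.restrict_mono hsub le_rfl) le_rfl)
  rw [← e2, ← integral_congr_ae e1, integral_sub hp2 hp3, kernelOp]
  ring

end IsBoundedKernel
end KernelOperator

end

section

variable {d : ℕ} [IsProbabilityMeasure (sphereMeasure d)]

/-! ### The kernels of scattering and of integration along rays -/

theorem isBoundedKernel_scattering (Ω : Set (Euc d)) {μ : Euc d × Sph d × Sph d → ℝ}
    (hμ : Measurable μ) {m : ℝ} (hm : ∀ r, ‖μ r‖ ≤ m) :
    IsBoundedKernel (phaseMeasure Ω) (sphereMeasure d)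
      (fun z : (Euc d × Sph d) × Sph d => μ (z.1.1, z.2, z.1.2)) (fun z => (z.1.1, z.2))
      (ENNReal.ofReal m) where
  measurable_kernel := hμ.comp (by fun_prop)
  measurable_map := by fun_prop
  ne_top := ENNReal.ofReal_ne_top
  lintegral_le φ hφ := by
    have hφ' : Measurable fun x => ∫⁻ v', φ (x, v') ∂sphereMeasure d := hφ.lintegral_prod_right'
    have hφ'' : Measurable fun q : Euc d × Sph d => ∫⁻ v', φ (q.1, v') ∂sphereMeasure d :=
      hφ'.comp measurable_fst
    calc ∫⁻ q, (∫⁻ v', ‖μ (q.1, v', q.2)‖ₑ * φ (q.1, v') ∂sphereMeasure d) ∂phaseMeasure Ω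
        ≤ ∫⁻ q, ENNReal.ofReal m * ∫⁻ v', φ (q.1, v') ∂sphereMeasure d ∂phaseMeasure Ω := by
          refine lintegral_mono fun q => ?_
          have h : Measurable fun v' => φ (q.1, v') := hφ.comp measurable_prodMk_left
          rw [← lintegral_const_mul _ h]
          refine lintegral_mono fun v' => ?_
          gcongr
          rw [← ofReal_norm]
          exact ENNReal.ofReal_le_ofReal (hm _)
      _ = ENNReal.ofReal m * ∫⁻ q, ∫⁻ v', φ (q.1, v') ∂sphereMeasure d ∂phaseMeasure Ω :=
          lintegral_const_mul _ hφ''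
      _ = ENNReal.ofReal m * ∫⁻ q, φ q ∂phaseMeasure Ω := by
          rw [phaseMeasure, lintegral_prod _ hφ''.aemeasurable,
            lintegral_prod _ hφ.aemeasurable]
          simp

/-- The indicator of `Ω` at the points of the line through `x` with velocity `v`. -/
def rayKernel (Ω : Set (Euc d)) (z : (Euc d × Sph d) × ℝ) : ℝ :=
  Ω.indicator 1 (z.1.1 + z.2 • (z.1.2 : Euc d))

def rayMap (z : (Euc d × Sph d) × ℝ) : Euc d × Sph d := (z.1.1 + z.2 • (z.1.2 : Euc d), z.1.2)

theorem measurable_rayMap : Measurable (rayMap (d := d)) := by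
  unfold rayMap; fun_prop

theorem measurable_rayKernel {Ω : Set (Euc d)} (hΩ : MeasurableSet Ω) :
    Measurable (rayKernel Ω) := by
  have h : Measurable (Ω.indicator (1 : Euc d → ℝ)) := measurable_one.indicator hΩ
  have h2 : Measurable fun z : (Euc d × Sph d) × ℝ => z.1.1 + z.2 • (z.1.2 : Euc d) := by fun_prop
  exact h.comp h2
theorem phaseMeasure_eq_restrict (Ω : Set (Euc d)) :
    phaseMeasure Ω = (volume.prod (sphereMeasure d)).restrict (Ω ×ˢ univ) := by
  rw [phaseMeasure, ← Measure.prod_restrict, Measure.restrict_univ]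

theorem exists_chord_bound {Ω : Set (Euc d)} (hb : Bornology.IsBounded Ω) :
    ∃ D : ℝ, 0 < D ∧ ∀ x ∈ Ω, ∀ v : Euc d, ‖v‖ = 1 → ∀ r : ℝ, x + r • v ∈ Ω → |r| ≤ D := by
  obtain ⟨R, hR⟩ := hb.exists_norm_le
  refine ⟨|R| + |R| + 1, by positivity, fun x hx v hv r hr => ?_⟩
  have h1 := hR _ hr
  have h2 := hR _ hx
  calc |r| = ‖(x + r • v) - x‖ := by rw [add_sub_cancel_left, norm_smul, hv, mul_one, Real.norm_eq_abs]
    _ ≤ ‖x + r • v‖ + ‖x‖ := norm_sub_le _ _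
    _ ≤ _ := by linarith [le_abs_self R]

/-- Chord parameters seen from a point of Ω are bounded by some D, and for each r the shear x ↦ x +
r v preserves the measure. Integrating over [−D, D] gives the constant 2D. -/
theorem exists_isBoundedKernel_ray {Ω : Set (Euc d)} (hΩ : IsOpen Ω) (hb : Bornology.IsBounded Ω)
    (R : Set ℝ) :
    ∃ C, IsBoundedKernel (phaseMeasure Ω) (volume.restrict R) (rayKernel Ω) rayMap C := by
  obtain ⟨D, hD, hDb⟩ := exists_chord_bound hb
  refine ⟨ENNReal.ofReal (2 * D), measurable_rayKernel hΩ.measurableSet, measurable_rayMap,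
    ENNReal.ofReal_ne_top, fun φ hφ => ?_⟩
  have hκ := (measurable_rayKernel hΩ.measurableSet).enorm
  have hm : Measurable fun z : (Euc d × Sph d) × ℝ => ‖rayKernel Ω z‖ₑ * φ (rayMap z) :=
    hκ.mul (hφ.comp measurable_rayMap)
  let φ' : Euc d × Sph d → ℝ≥0∞ := (Ω ×ˢ univ).indicator φ
  have hΩm : MeasurableSet (Ω ×ˢ (univ : Set (Sph d))) := hΩ.measurableSet.prod MeasurableSet.univ
  have hφ' : Measurable φ' := hφ.indicator hΩm
  calc ∫⁻ q, (∫⁻ r in R, ‖rayKernel Ω (q, r)‖ₑ * φ (rayMap (q, r))) ∂phaseMeasure Ω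
      ≤ ∫⁻ q, (∫⁻ r in Icc (-D) D, φ' (rayMap (q, r))) ∂phaseMeasure Ω := by
        refine lintegral_mono_ae ?_
        filter_upwards [ae_fst_mem hΩ] with q hq
        refine (setLIntegral_le_lintegral R _).trans ?_
        rw [← lintegral_indicator measurableSet_Icc]
        refine lintegral_mono fun r => ?_
        by_cases hr : q.1 + r • (q.2 : Euc d) ∈ Ω
        · have hrD : r ∈ Icc (-D) D := abs_le.mp (hDb _ hq _ (norm_eq_of_mem_sphere q.2) r hr)
          have hmem : rayMap (q, r) ∈ Ω ×ˢ (univ : Set (Sph d)) := ⟨hr, mem_univ _⟩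
          simp only [rayKernel, φ', indicator_of_mem hrD, indicator_of_mem hr,
            indicator_of_mem hmem, Pi.one_apply, enorm_one, one_mul, le_refl]
        · simp only [rayKernel, indicator_of_notMem hr, enorm_zero, zero_mul, zero_le]
    _ ≤ ∫⁻ q, (∫⁻ r in Icc (-D) D, φ' (rayMap (q, r))) ∂(volume.prod (sphereMeasure d)) := by
        rw [phaseMeasure_eq_restrict]
        exact setLIntegral_le_lintegral _ _
    _ = ∫⁻ r in Icc (-D) D, ∫⁻ q, φ' (rayMap (q, r)) ∂(volume.prod (sphereMeasure d)) :=
        lintegral_lintegral_swap (hφ'.comp measurable_rayMap).aemeasurable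
    _ = ∫⁻ r in Icc (-D) D, ∫⁻ q, φ q ∂phaseMeasure Ω := by
        refine lintegral_congr fun r => ?_
        rw [phaseMeasure_eq_restrict, ← lintegral_indicator hΩm]
        exact (measurePreserving_transport r).lintegral_comp hφ'
    _ = ENNReal.ofReal (2 * D) * ∫⁻ q, φ q ∂phaseMeasure Ω := by
        rw [lintegral_const, Measure.restrict_apply_univ, Real.volume_Icc, mul_comm]
        congr 2
        ring

/-! ### Boundary points of the lines -/

/-- The direction is a function of the velocity so that w(v) = v treats exit points and w(v) = −v
treats entry points. -/
theorem lintegral_exitPoint_le {Ω : Set (Euc d)} (hΩ : IsOpen Ω) (hb : Bornology.IsBounded Ω)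
    (hc : Convex ℝ Ω) (hs : HasSmoothBoundary Ω) {T : ℝ} {w : Sph d → Euc d} (hwm : Measurable w)
    (hw : ∀ v, ‖w v‖ = 1) {G : ℝ × Euc d × Sph d → ℝ≥0∞} (hG : Measurable G) :
    ∫⁻ p, (chordLength Ω p.2.1 (w p.2.2))⁻¹ * G (p.1, exitPoint Ω p.2.1 (w p.2.2), p.2.2)
        ∂phaseTimeMeasure Ω T ≤
      ∫⁻ p, ENNReal.ofReal (inner ℝ (outerNormal Ω p.2.1) (w p.2.2)) * G p
        ∂boundaryMeasure Ω T := by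
  have : IsFiniteMeasure ((Measure.euclideanHausdorffMeasure (d - 1) :
      Measure (Euc d)).restrict (frontier Ω)) :=
    ⟨by rw [Measure.restrict_apply_univ]; exact hs.measure_frontier_lt_top hΩ hb⟩
  have hm1 : Measurable fun p : ℝ × Euc d × Sph d =>
      (chordLength Ω p.2.1 (w p.2.2))⁻¹ * G (p.1, exitPoint Ω p.2.1 (w p.2.2), p.2.2) := by
    have h1 : Measurable fun p : ℝ × Euc d × Sph d => (p.2.1, w p.2.2) := by fun_prop
    have h2 := (measurable_chordLength hΩ).comp h1
    have h3 := (measurable_exitPoint hΩ).comp h1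
    have h4 : Measurable fun p : ℝ × Euc d × Sph d =>
        (p.1, exitPoint Ω p.2.1 (w p.2.2), p.2.2) :=
      measurable_fst.prodMk (h3.prodMk (measurable_snd.comp measurable_snd))
    exact h2.inv.mul (hG.comp h4)
  have hm2 : Measurable fun p : ℝ × Euc d × Sph d =>
      ENNReal.ofReal (inner ℝ (outerNormal Ω p.2.1) (w p.2.2)) * G p := by
    have h1 : Measurable fun p : ℝ × Euc d × Sph d => outerNormal Ω p.2.1 :=
      (hs.measurable_outerNormal hΩ).comp (by fun_prop)
    have h2 : Measurable fun p : ℝ × Euc d × Sph d => w p.2.2 := by fun_prop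
    exact (h1.inner h2).ennreal_ofReal.mul hG
  rw [phaseTimeMeasure, phaseMeasure, boundaryMeasure, lintegral_prod _ hm1.aemeasurable,
    lintegral_prod _ hm2.aemeasurable]
  refine lintegral_mono fun t => ?_
  have hm1t := hm1.comp (measurable_prodMk_left (x := t))
  have hm2t := hm2.comp (measurable_prodMk_left (x := t))
  refine (lintegral_prod_symm _ hm1t.aemeasurable).trans_le
    (le_trans ?_ (lintegral_prod_symm _ hm2t.aemeasurable).ge)
  refine lintegral_mono fun v => ?_
  exact setLIntegral_exitPoint_le hΩ hb hc hs (hw v)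
    (g := fun y => G (t, y, v)) (hG.comp (by fun_prop))

/-- The weight ℓ⁻¹ is positive, so a null set of the boundary is reached from almost no point of the
phase space. This brings boundary conditions to almost every line. -/
theorem ae_exitPoint {Ω : Set (Euc d)} (hΩ : IsOpen Ω) (hb : Bornology.IsBounded Ω)
    (hc : Convex ℝ Ω) (hs : HasSmoothBoundary Ω) {T : ℝ} {w : Sph d → Euc d} (hwm : Measurable w)
    (hw : ∀ v, ‖w v‖ = 1) {S : ℝ × Euc d × Sph d → Prop}
    (hS : ∀ᵐ p ∂boundaryMeasure Ω T, S p) :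
    ∀ᵐ p ∂phaseTimeMeasure Ω T, S (p.1, exitPoint Ω p.2.1 (w p.2.2), p.2.2) := by
  obtain ⟨N, hN, hNm, hN0⟩ := exists_measurable_superset_of_null (ae_iff.mp hS)
  have h1 := lintegral_exitPoint_le (T := T) hΩ hb hc hs hwm hw
    (G := N.indicator 1) (measurable_one.indicator hNm)
  have h2 : ∫⁻ p, ENNReal.ofReal (inner ℝ (outerNormal Ω p.2.1) (w p.2.2)) *
      N.indicator (1 : ℝ × Euc d × Sph d → ℝ≥0∞) p ∂boundaryMeasure Ω T = 0 := by
    have : ∀ᵐ p ∂boundaryMeasure Ω T, ENNReal.ofReal (inner ℝ (outerNormal Ω p.2.1) (w p.2.2)) *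
        N.indicator (1 : ℝ × Euc d × Sph d → ℝ≥0∞) p = 0 := by
      filter_upwards [measure_eq_zero_iff_ae_notMem.mp hN0] with p hp
      rw [indicator_of_notMem hp, mul_zero]
    rw [lintegral_congr_ae this, lintegral_zero]
  rw [h2, nonpos_iff_eq_zero] at h1
  have hmw : Measurable fun p : ℝ × Euc d × Sph d => (p.2.1, w p.2.2) := by fun_prop
  have hm : Measurable fun p : ℝ × Euc d × Sph d => (chordLength Ω p.2.1 (w p.2.2))⁻¹ *
      N.indicator (1 : ℝ × Euc d × Sph d → ℝ≥0∞) (p.1, exitPoint Ω p.2.1 (w p.2.2), p.2.2) := by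
    have h2 := (measurable_chordLength hΩ).comp hmw
    have h3 := (measurable_exitPoint hΩ).comp hmw
    have h4 : Measurable fun p : ℝ × Euc d × Sph d =>
        (p.1, exitPoint Ω p.2.1 (w p.2.2), p.2.2) :=
      measurable_fst.prodMk (h3.prodMk (measurable_snd.comp measurable_snd))
    have h5 : Measurable (N.indicator (1 : ℝ × Euc d × Sph d → ℝ≥0∞)) :=
      measurable_one.indicator hNm
    exact h2.inv.mul (h5.comp h4)
  rw [lintegral_eq_zero_iff hm] at h1
  have hmem : ∀ᵐ p ∂phaseTimeMeasure Ω T, p.2.1 ∈ Ω :=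
    (Measure.quasiMeasurePreserving_snd (μ := volume.restrict (Ioo 0 T))
      (ν := phaseMeasure Ω)).ae (ae_fst_mem hΩ)
  filter_upwards [h1, hmem] with p hp hpΩ
  by_contra hnS
  have hpN : (p.1, exitPoint Ω p.2.1 (w p.2.2), p.2.2) ∈ N := hN hnS
  simp only [indicator_of_mem hpN, Pi.one_apply, mul_one, Pi.zero_apply, ENNReal.inv_eq_zero] at hp
  exact chordLength_ne_top hΩ hb hc hpΩ (hw _) hp

/-- A right neighbourhood of zero has positive measure and hence meets every conull set. Essential
limits are therefore unique. -/
instance essRight_neBot : essRight.NeBot := by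
  rw [essRight, inf_neBot_iff]
  intro U hU V hV
  obtain ⟨δ, hδ, hδU⟩ := mem_nhdsGT_iff_exists_Ioo_subset.mp hU
  by_contra hne
  rw [not_nonempty_iff_eq_empty] at hne
  have hsub : Ioo 0 δ ⊆ Vᶜ := fun s hs hsV => by
    have : s ∈ U ∩ V := ⟨hδU hs, hsV⟩
    rw [hne] at this
    exact this
  have h0 : volume (Ioo 0 δ) = 0 := measure_mono_null hsub hV
  rw [Real.volume_Ioo, sub_zero, ENNReal.ofReal_eq_zero] at h0
  exact absurd hδ (not_lt.mpr h0)

theorem ae_mem_phaseTimeMeasure {Ω : Set (Euc d)} (hΩ : IsOpen Ω) {T : ℝ} :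
    ∀ᵐ p ∂phaseTimeMeasure Ω T, p.1 ∈ Ioo 0 T ∧ p.2.1 ∈ Ω := by
  have hmem : ∀ᵐ p ∂phaseTimeMeasure Ω T, p.2.1 ∈ Ω :=
    (Measure.quasiMeasurePreserving_snd (μ := volume.restrict (Ioo 0 T))
      (ν := phaseMeasure Ω)).ae (ae_fst_mem hΩ)
  have hmem2 : ∀ᵐ p ∂phaseTimeMeasure Ω T, p.1 ∈ Ioo 0 T := ae_fst_mem_Ioo
  exact hmem2.and hmem

/-- The trace on the incoming boundary at the entry points of the lines. -/
theorem VanishesOnIncoming.ae_tendsto {Ω : Set (Euc d)} (hΩ : IsOpen Ω)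
    (hb : Bornology.IsBounded Ω) (hc : Convex ℝ Ω) (hs : HasSmoothBoundary Ω) {T : ℝ}
    {f : ℝ × Euc d × Sph d → ℝ} (hf : VanishesOnIncoming Ω T f) :
    ∀ᵐ p ∂phaseTimeMeasure Ω T, Tendsto (fun s : ℝ =>
      f (p.1, p.2.1 + (s - exitTime Ω p.2.1 (-(p.2.2 : Euc d))) • (p.2.2 : Euc d), p.2.2))
        essRight (𝓝 0) := by
  have h1 := ae_exitPoint (T := T) hΩ hb hc hs (w := fun v => -(v : Euc d)) (by fun_prop)
    (fun v => by rw [norm_neg]; exact norm_eq_of_mem_sphere v) hf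
  filter_upwards [h1, ae_mem_phaseTimeMeasure hΩ] with p hp hpm
  have hv : ‖-(p.2.2 : Euc d)‖ = 1 := by rw [norm_neg]; exact norm_eq_of_mem_sphere p.2.2
  have h2 := inner_outerNormal_exitPoint_pos hΩ hb hc hs hpm.2 hv
  rw [inner_neg_right] at h2
  refine (hp (by linarith)).congr fun s => ?_
  have h3 : exitPoint Ω p.2.1 (-(p.2.2 : Euc d)) + s • (p.2.2 : Euc d) =
      p.2.1 + (s - exitTime Ω p.2.1 (-(p.2.2 : Euc d))) • (p.2.2 : Euc d) := by
    rw [exitPoint]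
    module
  rw [h3]

end

section

variable {d : ℕ} [IsProbabilityMeasure (sphereMeasure d)]

/-! ### Representatives -/

instance (Ω : Set (Euc d)) : SFinite (phaseMeasure Ω) := by unfold phaseMeasure; infer_instance

instance (Ω : Set (Euc d)) (T : ℝ) : SFinite (phaseTimeMeasure Ω T) := by
  unfold phaseTimeMeasure; infer_instance

theorem HasWeakTimeDeriv.congr {Ω : Set (Euc d)} {T : ℝ} {f g f' g' : ℝ × Euc d × Sph d → ℝ}
    (h : HasWeakTimeDeriv Ω T f g) (hf : f =ᵐ[phaseTimeMeasure Ω T] f')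
    (hg : g =ᵐ[phaseTimeMeasure Ω T] g') : HasWeakTimeDeriv Ω T f' g' := fun ψ hψ => by
  refine (integral_congr_ae ?_).trans ((h ψ hψ).trans (congrArg Neg.neg (integral_congr_ae ?_)))
  · exact hf.mono fun p hp => by simp only [hp]
  · exact hg.mono fun p hp => by simp only [hp]

theorem HasWeakTransportDerivT.congr {Ω : Set (Euc d)} {T : ℝ} {f g f' g' : ℝ × Euc d × Sph d → ℝ}
    (h : HasWeakTransportDerivT Ω T f g) (hf : f =ᵐ[phaseTimeMeasure Ω T] f')
    (hg : g =ᵐ[phaseTimeMeasure Ω T] g') : HasWeakTransportDerivT Ω T f' g' := fun ψ hψ => by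
  refine (integral_congr_ae ?_).trans ((h ψ hψ).trans (congrArg Neg.neg (integral_congr_ae ?_)))
  · exact hf.mono fun p hp => by simp only [hp]
  · exact hg.mono fun p hp => by simp only [hp]

theorem HasWeakTimeDeriv.exists_ae_eq_add_primitive {Ω : Set (Euc d)} (hΩ : IsOpen Ω) {T : ℝ}
    (hT : 0 < T) {g g' : ℝ × Euc d × Sph d → ℝ} (h : HasWeakTimeDeriv Ω T g g')
    (hgm : StronglyMeasurable g) (hgm' : StronglyMeasurable g')
    (hg : Integrable g (phaseTimeMeasure Ω T)) (hg' : Integrable g' (phaseTimeMeasure Ω T)) :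
    ∃ g₀ : Euc d × Sph d → ℝ, StronglyMeasurable g₀ ∧ Integrable g₀ (phaseMeasure Ω) ∧
      ∀ᵐ p ∂phaseTimeMeasure Ω T, g p = g₀ p.2 + ∫ r in (0 : ℝ)..p.1, g' (r, p.2) := by
  refine InverseTransport.exists_ae_eq_add_primitive hT hgm hgm' hg hg' fun s => ?_
  have h1 := h.ae_sub_eq hΩ hg hg' s
  have h2 : (volume : Measure ℝ).prod (phaseMeasure Ω) ≤ totalMeasure d := by
    rw [phaseMeasure_eq_restrict, totalMeasure]
    exact Measure.prod_mono le_rfl Measure.restrict_le_self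
  have h3 : ∀ᵐ p ∂(volume : Measure ℝ).prod (phaseMeasure Ω), p.2.1 ∈ Ω :=
    (Measure.quasiMeasurePreserving_snd (μ := (volume : Measure ℝ))
      (ν := phaseMeasure Ω)).ae (ae_fst_mem hΩ)
  filter_upwards [h2.absolutelyContinuous.ae_le h1, h3] with p hp hpΩ ht hts
  exact hp ht hpΩ hts

theorem essRight_congr {f g : ℝ → ℝ} {a l : ℝ} (ha : 0 < a)
    (h : ∀ᵐ t : ℝ, t ∈ Ioo 0 a → f t = g t) (hf : Tendsto f essRight (𝓝 l)) :
    Tendsto g essRight (𝓝 l) := by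
  refine hf.congr' ?_
  have h1 : ∀ᶠ t in essRight, t ∈ Ioo 0 a := Filter.mem_inf_of_left (Ioo_mem_nhdsGT ha)
  have h2 : ∀ᶠ t in essRight, t ∈ Ioo 0 a → f t = g t := Filter.mem_inf_of_right h
  filter_upwards [h1, h2] with t ht1 ht2
  exact ht2 ht1

theorem tendsto_add_primitive_essRight {T : ℝ} (hT : 0 < T) {g : ℝ → ℝ}
    (hg : IntegrableOn g (Ioo 0 T)) (c : ℝ) :
    Tendsto (fun t => c + ∫ r in (0 : ℝ)..t, g r) essRight (𝓝 c) := by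
  have hii : IntervalIntegrable g volume 0 T := by
    rwa [intervalIntegrable_iff_integrableOn_Ioo_of_le hT.le]
  have hc := intervalIntegral.continuousOn_primitive_interval' hii left_mem_uIcc
  rw [uIcc_of_le hT.le] at hc
  have h7 := (hc 0 (left_mem_Icc.mpr hT.le)).tendsto
  rw [intervalIntegral.integral_same] at h7
  have h8 : essRight ≤ 𝓝[Icc 0 T] (0 : ℝ) := by
    refine inf_le_left.trans ?_
    rw [← nhdsWithin_Ioo_eq_nhdsGT hT]
    exact nhdsWithin_mono _ Ioo_subset_Icc_self
  have := (h7.mono_left h8).const_add c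
  rwa [add_zero] at this

theorem HasInitialValue.ae_eq {Ω : Set (Euc d)} {T : ℝ} (hT : 0 < T)
    {f g g' : ℝ × Euc d × Sph d → ℝ} {f₀ g₀ : Euc d × Sph d → ℝ} (h : HasInitialValue Ω f f₀)
    (hfg : f =ᵐ[phaseTimeMeasure Ω T] g) (hg' : Integrable g' (phaseTimeMeasure Ω T))
    (hrep : ∀ᵐ p ∂phaseTimeMeasure Ω T, g p = g₀ p.2 + ∫ r in (0 : ℝ)..p.1, g' (r, p.2)) :
    f₀ =ᵐ[phaseMeasure Ω] g₀ := by
  filter_upwards [h, ae_ae_of_ae_prod_swap hfg, ae_ae_of_ae_prod_swap hrep,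
    ae_integrableOn_time hg'] with q h1 h2 h3 h4
  rw [ae_restrict_iff' measurableSet_Ioo] at h2 h3
  have h5 : Tendsto (fun t => g₀ q + ∫ r in (0 : ℝ)..t, g' (r, q)) essRight (𝓝 (f₀ q)) := by
    refine essRight_congr hT ?_ h1
    filter_upwards [h2, h3] with t ht2 ht3 ht
    rw [ht2 ht, ht3 ht]
  exact tendsto_nhds_unique h5 (tendsto_add_primitive_essRight hT h4 (g₀ q))

/-! ### Integration along rays -/

theorem rayKernel_mul (Ω : Set (Euc d)) (q : Euc d × Sph d) (r : ℝ) (g : ℝ → ℝ) :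
    rayKernel Ω (q, r) * g r = (chord Ω q.1 q.2).indicator g r := by
  by_cases h : q.1 + r • (q.2 : Euc d) ∈ Ω
  · rw [indicator_of_mem (mem_chord.mpr h), rayKernel, indicator_of_mem h, Pi.one_apply, one_mul]
  · have h' : r ∉ chord Ω q.1 q.2 := h
    rw [indicator_of_notMem h', rayKernel, indicator_of_notMem h, zero_mul]

theorem integral_rayKernel {Ω : Set (Euc d)} (hΩ : IsOpen Ω) (q : Euc d × Sph d) (R : Set ℝ)
    (g : ℝ → ℝ) :
    ∫ r in R, rayKernel Ω (q, r) * g r = ∫ r in chord Ω q.1 q.2 ∩ R, g r := by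
  simp_rw [rayKernel_mul]
  rw [integral_indicator (isOpen_chord hΩ _ _).measurableSet,
    Measure.restrict_restrict (isOpen_chord hΩ _ _).measurableSet]

theorem integral_rayKernel_Iio {Ω : Set (Euc d)} (hΩ : IsOpen Ω) (hb : Bornology.IsBounded Ω)
    (hc : Convex ℝ Ω) {q : Euc d × Sph d} (hq : q.1 ∈ Ω) (g : ℝ → ℝ) :
    ∫ r in Iio 0, rayKernel Ω (q, r) * g r = ∫ r in (-exitTime Ω q.1 (-q.2))..0, g r := by
  have hv := norm_eq_of_mem_sphere q.2
  have h1 := exitTime_pos hΩ hb hc hq hv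
  have h2 := exitTime_pos hΩ hb hc hq (v := -q.2) (by rwa [norm_neg])
  have h3 : chord Ω q.1 q.2 ∩ Iio 0 = Ioo (-exitTime Ω q.1 (-q.2)) 0 := by
    rw [chord_eq hΩ hb hc hq hv]
    ext r
    simp only [mem_inter_iff, mem_Ioo, mem_Iio]
    constructor
    · rintro ⟨⟨h4, -⟩, h5⟩; exact ⟨h4, h5⟩
    · rintro ⟨h4, h5⟩; exact ⟨⟨h4, h5.trans h1⟩, h5⟩
  rw [integral_rayKernel hΩ, h3, intervalIntegral.integral_of_le (by linarith),
    integral_Ioc_eq_integral_Ioo]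

theorem ae_ray {Ω : Set (Euc d)} (hΩ : IsOpen Ω) (hb : Bornology.IsBounded Ω) {T : ℝ}
    {S : ℝ × Euc d × Sph d → Prop} (hS : ∀ᵐ p ∂phaseTimeMeasure Ω T, S p) :
    ∀ᵐ p ∂phaseTimeMeasure Ω T, ∀ᵐ r : ℝ, r ∈ chord Ω p.2.1 p.2.2 →
      S (p.1, p.2.1 + r • (p.2.2 : Euc d), p.2.2) := by
  obtain ⟨C, hC⟩ := exists_isBoundedKernel_ray hΩ hb univ
  filter_upwards [(hC.time T).ae_ae hS] with p hp
  rw [Measure.restrict_univ] at hp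
  filter_upwards [hp] with r hr hrc
  refine hr ?_
  rw [rayKernel, indicator_of_mem (mem_chord.mp hrc)]
  exact one_ne_zero

theorem ae_integrableOn_chord {Ω : Set (Euc d)} (hΩ : IsOpen Ω) (hb : Bornology.IsBounded Ω)
    {T : ℝ} {F : ℝ × Euc d × Sph d → ℝ} (hFm : StronglyMeasurable F)
    (hF : Integrable F (phaseTimeMeasure Ω T)) :
    ∀ᵐ p ∂phaseTimeMeasure Ω T, IntegrableOn
      (fun r : ℝ => F (p.1, p.2.1 + r • (p.2.2 : Euc d), p.2.2)) (chord Ω p.2.1 p.2.2) := by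
  obtain ⟨C, hC⟩ := exists_isBoundedKernel_ray hΩ hb univ
  filter_upwards [(hC.time T).ae_integrable hFm hF] with p hp
  rw [Measure.restrict_univ] at hp
  rw [← integrable_indicator_iff (isOpen_chord hΩ _ _).measurableSet]
  refine hp.congr (Eventually.of_forall fun r => ?_)
  exact rayKernel_mul Ω p.2 r fun r => F (p.1, p.2.1 + r • (p.2.2 : Euc d), p.2.2)

/-- A function which vanishes on the incoming boundary is the integral of its derivative along
the rays. -/
theorem ae_eq_integral_ray {Ω : Set (Euc d)} (hΩ : IsOpen Ω) (hb : Bornology.IsBounded Ω)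
    (hc : Convex ℝ Ω) (hs : HasSmoothBoundary Ω) {T : ℝ} {f g F : ℝ × Euc d × Sph d → ℝ}
    (hf : VanishesOnIncoming Ω T f) (hfg : f =ᵐ[phaseTimeMeasure Ω T] g)
    (hgm : StronglyMeasurable g) (hFm : StronglyMeasurable F)
    (hg : Integrable g (phaseTimeMeasure Ω T)) (hF : Integrable F (phaseTimeMeasure Ω T))
    (hweak : HasWeakTransportDerivT Ω T g F) :
    ∀ᵐ p ∂phaseTimeMeasure Ω T,
      g p = ∫ r in Iio 0, rayKernel Ω (p.2, r) * F (p.1, rayMap (p.2, r)) := by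
  have hinc : ∀ᵐ p ∂phaseTimeMeasure Ω T, ∀ᵐ h : ℝ, p.2.1 + h • (p.2.2 : Euc d) ∈ Ω →
      g (p.1, p.2.1 + h • (p.2.2 : Euc d), p.2.2) - g p =
        ∫ r in (0 : ℝ)..h, F (p.1, p.2.1 + r • (p.2.2 : Euc d), p.2.2) := by
    have hms : MeasurableSet {z : ℝ × (ℝ × Euc d × Sph d) |
        z.2.2.1 + z.1 • (z.2.2.2 : Euc d) ∈ Ω →
        g (z.2.1, z.2.2.1 + z.1 • (z.2.2.2 : Euc d), z.2.2.2) - g z.2 =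
        ∫ r in (0 : ℝ)..z.1, F (z.2.1, z.2.2.1 + r • (z.2.2.2 : Euc d), z.2.2.2)} := by
      have m0 : Measurable fun z : ℝ × (ℝ × Euc d × Sph d) =>
          (z.2.1, z.2.2.1 + z.1 • (z.2.2.2 : Euc d), z.2.2.2) := by fun_prop
      have m1 : Measurable fun z : ℝ × (ℝ × Euc d × Sph d) =>
          g (z.2.1, z.2.2.1 + z.1 • (z.2.2.2 : Euc d), z.2.2.2) - g z.2 :=
        (hgm.measurable.comp m0).sub (hgm.measurable.comp measurable_snd)
      have m3 : Measurable fun w : (ℝ × (ℝ × Euc d × Sph d)) × ℝ =>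
          (w.1.2.1, w.1.2.2.1 + w.2 • (w.1.2.2.2 : Euc d), w.1.2.2.2) := by fun_prop
      have m2 : Measurable fun z : ℝ × (ℝ × Euc d × Sph d) =>
          ∫ r in (0 : ℝ)..z.1, F (z.2.1, z.2.2.1 + r • (z.2.2.2 : Euc d), z.2.2.2) :=
        (stronglyMeasurable_intervalIntegral
          (f := fun (z : ℝ × (ℝ × Euc d × Sph d)) r =>
            F (z.2.1, z.2.2.1 + r • (z.2.2.2 : Euc d), z.2.2.2))
          (hFm.comp_measurable m3) measurable_const measurable_fst).measurable
      have m4 : Measurable fun z : ℝ × (ℝ × Euc d × Sph d) =>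
          z.2.2.1 + z.1 • (z.2.2.2 : Euc d) := by fun_prop
      exact (hΩ.measurableSet.preimage m4).imp (measurableSet_eq_fun m1 m2)
    have h0 := (Measure.ae_prod_iff_ae_ae (μ := volume) (ν := phaseTimeMeasure Ω T) hms).mpr
      (Eventually.of_forall fun h => by
        have h1 := hweak.ae_sub_eq hΩ hc hg hF h
        have h2 : phaseTimeMeasure Ω T ≤ totalMeasure d := by
          rw [phaseTimeMeasure_eq_restrict]
          exact Measure.restrict_le_self
        filter_upwards [h2.absolutelyContinuous.ae_le h1, ae_mem_phaseTimeMeasure hΩ]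
          with p hp hpm hh
        exact hp hpm.1 hpm.2 hh)
    exact ae_ae_of_ae_prod_swap h0
  filter_upwards [hinc, hf.ae_tendsto hΩ hb hc hs, ae_ray hΩ hb hfg,
    ae_integrableOn_chord hΩ hb hFm hF, ae_mem_phaseTimeMeasure hΩ] with p h1 h2 h3 h4 hpm
  have hv := norm_eq_of_mem_sphere p.2.2
  have t1 := exitTime_pos hΩ hb hc hpm.2 hv
  have t2 := exitTime_pos hΩ hb hc hpm.2 (v := -p.2.2) (by rwa [norm_neg])
  have hch := chord_eq hΩ hb hc hpm.2 hv
  set a := exitTime Ω p.2.1 (-p.2.2) with ha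
  set φ : ℝ → ℝ := fun r => F (p.1, p.2.1 + r • (p.2.2 : Euc d), p.2.2) with hφ
  have e1 := integral_rayKernel_Iio hΩ hb hc (q := p.2) hpm.2 φ
  have hii : IntervalIntegrable φ volume (-a) 0 := by
    rw [intervalIntegrable_iff_integrableOn_Ioo_of_le (by linarith)]
    refine h4.mono_set ?_
    rw [hch]
    exact Ioo_subset_Ioo_right t1.le
  -- The limit at the entry point, of parameter −a, is computed twice: here from the incoming
  -- condition, and in `l2` from continuity of the primitive.
  have l1 : Tendsto (fun s => g p + ∫ r in (0 : ℝ)..(s - a), φ r) essRight (𝓝 0) := by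
    refine essRight_congr t2 ?_ h2
    have q1 := (measurePreserving_sub_right volume a).quasiMeasurePreserving.ae h1
    have q3 := (measurePreserving_sub_right volume a).quasiMeasurePreserving.ae h3
    filter_upwards [q1, q3] with s hs1 hs3 hs
    have hsc : s - a ∈ chord Ω p.2.1 p.2.2 := by
      rw [hch]
      exact ⟨by linarith [hs.1], by linarith [hs.2]⟩
    rw [hs3 hsc]
    linarith [hs1 hsc]
  have l2 : Tendsto (fun s => g p + ∫ r in (0 : ℝ)..(s - a), φ r) essRight
      (𝓝 (g p + ∫ r in (0 : ℝ)..(-a), φ r)) := by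
    have hcont := intervalIntegral.continuousOn_primitive_interval' hii right_mem_uIcc
    rw [uIcc_of_le (by linarith)] at hcont
    have h7 := (hcont (-a) (left_mem_Icc.mpr (by linarith))).tendsto
    have h8 : Tendsto (fun s => s - a) essRight (𝓝[Icc (-a) 0] (-a)) := by
      refine tendsto_nhdsWithin_iff.mpr ⟨?_, ?_⟩
      · have : Tendsto (fun s : ℝ => s - a) (𝓝 0) (𝓝 (0 - a)) :=
          (continuous_id.sub continuous_const).tendsto 0
        rw [zero_sub] at this
        exact this.mono_left (inf_le_left.trans nhdsWithin_le_nhds)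
      · have h1 : ∀ᶠ t in essRight, t ∈ Ioo 0 a := Filter.mem_inf_of_left (Ioo_mem_nhdsGT t2)
        filter_upwards [h1] with s hs
        exact ⟨by linarith [hs.1], by linarith [hs.2]⟩
    exact (h7.comp h8).const_add _
  have h9 := tendsto_nhds_unique l1 l2
  rw [intervalIntegral.integral_symm] at h9
  refine Eq.trans ?_ e1.symm
  linarith

end

/-! ### The transport derivative at time zero -/

section

variable {d : ℕ} 

/-- Functions of t alone suffice as tests: the integral over α of c + ∫₀ᵗ H vanishes for almost
every t, and it tends to ∫ c as t → 0. -/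
theorem integral_eq_zero_of_integral_smul_add_primitive {α : Type*} [MeasurableSpace α]
    {P : Measure α} [SFinite P] {T : ℝ} (hT : 0 < T) {c : α → ℝ} {H : ℝ × α → ℝ}
    (hc : Integrable c P) (hHm : StronglyMeasurable H)
    (hH : Integrable H ((volume.restrict (Ioo 0 T)).prod P))
    (h : ∀ η : ℝ → ℝ, ContDiff ℝ ∞ η → HasCompactSupport η → tsupport η ⊆ Ioo 0 T →
      ∫ p, η p.1 * (c p.2 + ∫ r in (0 : ℝ)..p.1, H (r, p.2)) ∂(volume.restrict (Ioo 0 T)).prod P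
        = 0) :
    ∫ q, c q ∂P = 0 := by
  have hΦ : Integrable (fun p : ℝ × α => c p.2 + ∫ r in (0 : ℝ)..p.1, H (r, p.2))
      ((volume.restrict (Ioo 0 T)).prod P) :=
    (hc.comp_snd _).add (integrable_primitive hHm hH)
  set m : ℝ → ℝ := fun t => ∫ q, (c q + ∫ r in (0 : ℝ)..t, H (r, q)) ∂P with hm
  have hmi : IntegrableOn m (Ioo 0 T) := hΦ.integral_prod_left
  have hm0 : ∀ᵐ t : ℝ, t ∈ Ioo 0 T → m t = 0 := by
    refine isOpen_Ioo.ae_eq_zero_of_integral_contDiff_smul_eq_zero hmi.locallyIntegrableOn ?_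
    intro η hη hηc hηT
    have h1 := h η hη hηc hηT
    obtain ⟨K, hK⟩ := hη.continuous.bounded_above_of_compact_support hηc
    have h2 : Integrable (fun p : ℝ × α => η p.1 * (c p.2 + ∫ r in (0 : ℝ)..p.1, H (r, p.2)))
        ((volume.restrict (Ioo 0 T)).prod P) :=
      hΦ.bdd_mul (c := K) (hη.continuous.comp_aestronglyMeasurable
        measurable_fst.aestronglyMeasurable) (Eventually.of_forall fun p => hK _)
    rw [integral_prod _ h2] at h1
    simp_rw [integral_const_mul] at h1
    rw [← setIntegral_eq_integral_of_forall_compl_eq_zero (s := Ioo 0 T)]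
    · exact h1
    · intro t ht
      rw [image_eq_zero_of_notMem_tsupport fun h => ht (hηT h), zero_smul]
  have hHt : IntegrableOn (fun t => ∫ q, H (t, q) ∂P) (Ioo 0 T) := hH.integral_prod_left
  have hmeq : ∀ t ∈ Ioo 0 T, m t = ∫ q, c q ∂P + ∫ r in (0 : ℝ)..t, ∫ q, H (r, q) ∂P := by
    intro t ht
    have hsub : Ioc 0 t ⊆ Ioo 0 T := fun r hr => ⟨hr.1, hr.2.trans_lt ht.2⟩
    have h1 : Integrable H ((volume.restrict (Ioc 0 t)).prod P) :=
      hH.mono_measure (Measure.prod_mono (Measure.restrict_mono hsub le_rfl) le_rfl)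
    simp only [hm, intervalIntegral.integral_of_le ht.1.le]
    rw [integral_add hc h1.integral_prod_right, integral_integral_swap]
    exact h1.swap
  have h1 := tendsto_add_primitive_essRight hT hHt (∫ q, c q ∂P)
  have h2 : Tendsto (fun _ : ℝ => (0 : ℝ)) essRight (𝓝 (∫ q, c q ∂P)) := by
    refine essRight_congr hT ?_ h1
    filter_upwards [hm0] with t ht htT
    rw [← hmeq t htT, ht htT]
  exact tendsto_nhds_unique h2 tendsto_const_nhds

variable [IsProbabilityMeasure (sphereMeasure d)]

/-- The operator v·∇ commutes with the initial trace. With test functions η(t)ψ(x,v) the factor η is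
not differentiated, so the weak identity holds at almost every time, and by the preceding lemma it
persists at t = 0. Uniqueness of weak derivatives concludes. -/
theorem HasWeakTransportDerivT.ae_eq_initial {Ω : Set (Euc d)} (hΩ : IsOpen Ω) {T : ℝ} (hT : 0 < T)
    {f g f' g' : ℝ × Euc d × Sph d → ℝ} {f₀ g₀ f₁ g₁ : Euc d × Sph d → ℝ}
    (h : HasWeakTransportDerivT Ω T f g)
    (hfm' : StronglyMeasurable f') (hf' : Integrable f' (phaseTimeMeasure Ω T))
    (hgm' : StronglyMeasurable g') (hg' : Integrable g' (phaseTimeMeasure Ω T))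
    (hf₀ : Integrable f₀ (phaseMeasure Ω)) (hg₀ : Integrable g₀ (phaseMeasure Ω))
    (hrf : ∀ᵐ p ∂phaseTimeMeasure Ω T, f p = f₀ p.2 + ∫ r in (0 : ℝ)..p.1, f' (r, p.2))
    (hrg : ∀ᵐ p ∂phaseTimeMeasure Ω T, g p = g₀ p.2 + ∫ r in (0 : ℝ)..p.1, g' (r, p.2))
    (h₁ : HasWeakTransportDeriv Ω f₁ g₁) (hf₁ : f₁ =ᵐ[phaseMeasure Ω] f₀)
    (hg₁ : Integrable g₁ (phaseMeasure Ω)) : g₁ =ᵐ[phaseMeasure Ω] g₀ := by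
  refine ae_eq_of_integral_testFunction_eq hΩ hg₁ hg₀ fun ψ hψ => ?_
  set a : Euc d × Sph d → ℝ := fun q => fderiv ℝ ψ (q.1, (q.2 : Euc d)) ((q.2 : Euc d), 0) with ha
  set b : Euc d × Sph d → ℝ := fun q => ψ (q.1, (q.2 : Euc d)) with hb
  have hac : Continuous a := by
    have h1 : Continuous fun q : Euc d × Sph d => fderiv ℝ ψ (q.1, (q.2 : Euc d)) :=
      (hψ.1.continuous_fderiv (by simp)).comp (by fun_prop)
    exact h1.clm_apply (by fun_prop)
  have hbc : Continuous b := hψ.1.continuous.comp (by fun_prop)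
  obtain ⟨A, hA⟩ := (hψ.1.continuous_fderiv (by simp)).bounded_above_of_compact_support
    (hψ.2.1.fderiv ℝ)
  obtain ⟨B, hB⟩ := hψ.1.continuous.bounded_above_of_compact_support hψ.2.1
  have haA : ∀ q, ‖a q‖ ≤ A := fun q => by
    refine (ContinuousLinearMap.le_opNorm _ _).trans ?_
    have : ‖(((q.2 : Euc d), 0) : Euc d × Euc d)‖ = 1 := by
      simp [Prod.norm_def, norm_eq_of_mem_sphere q.2]
    rw [this, mul_one]
    exact hA _
  have i1 : Integrable (fun q => f₀ q * a q) (phaseMeasure Ω) :=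
    hf₀.mul_bdd (c := A) hac.aestronglyMeasurable (Eventually.of_forall haA)
  have i2 : Integrable (fun q => g₀ q * b q) (phaseMeasure Ω) :=
    hg₀.mul_bdd (c := B) hbc.aestronglyMeasurable (Eventually.of_forall fun q => hB _)
  have i3 : Integrable (fun p : ℝ × Euc d × Sph d => f' p * a p.2) (phaseTimeMeasure Ω T) :=
    hf'.mul_bdd (c := A) (hac.comp continuous_snd).aestronglyMeasurable
      (Eventually.of_forall fun p => haA _)
  have i4 : Integrable (fun p : ℝ × Euc d × Sph d => g' p * b p.2) (phaseTimeMeasure Ω T) :=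
    hg'.mul_bdd (c := B) (hbc.comp continuous_snd).aestronglyMeasurable
      (Eventually.of_forall fun q => hB _)
  have m3 : StronglyMeasurable (fun p : ℝ × Euc d × Sph d => f' p * a p.2) :=
    hfm'.mul (hac.measurable.comp measurable_snd).stronglyMeasurable
  have m4 : StronglyMeasurable (fun p : ℝ × Euc d × Sph d => g' p * b p.2) :=
    hgm'.mul (hbc.measurable.comp measurable_snd).stronglyMeasurable
  have key : ∫ q, (f₀ q * a q + g₀ q * b q) ∂phaseMeasure Ω = 0 := by
    refine integral_eq_zero_of_integral_smul_add_primitive hT (i1.add i2) (m3.add m4) (i3.add i4) ?_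
    intro η hη hηc hηT
    have hψT : IsTimeTestFunction Ω T (fun z => η z.1 * ψ z.2) := by
      have hsub : tsupport (fun z : ℝ × Euc d × Euc d => η z.1 * ψ z.2) ⊆
          tsupport η ×ˢ tsupport ψ := by
        refine closure_minimal ?_ ((isClosed_tsupport η).prod (isClosed_tsupport ψ))
        intro z hz
        have hz' : η z.1 * ψ z.2 ≠ 0 := hz
        exact ⟨subset_tsupport _ (left_ne_zero_of_mul hz'),
          subset_tsupport _ (right_ne_zero_of_mul hz')⟩
      refine ⟨(hη.comp contDiff_fst).mul (hψ.1.comp contDiff_snd), ?_, ?_⟩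
      · exact IsCompact.of_isClosed_subset (hηc.isCompact.prod hψ.2.1.isCompact)
          (isClosed_tsupport _) hsub
      · exact hsub.trans (prod_mono hηT hψ.2.2)
    have hw := h _ hψT
    have hder : ∀ p : ℝ × Euc d × Sph d,
        fderiv ℝ (fun z : ℝ × Euc d × Euc d => η z.1 * ψ z.2) (p.1, p.2.1, (p.2.2 : Euc d))
          (0, (p.2.2 : Euc d), 0) = η p.1 * a p.2 := by
      intro p
      have d1 : HasFDerivAt (fun z : ℝ × Euc d × Euc d => η z.1)
          ((fderiv ℝ η p.1).comp (ContinuousLinearMap.fst ℝ ℝ (Euc d × Euc d)))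
          (p.1, p.2.1, (p.2.2 : Euc d)) :=
        HasFDerivAt.comp (g := η) _ (hη.differentiable (by simp) p.1).hasFDerivAt hasFDerivAt_fst
      have d2 : HasFDerivAt (fun z : ℝ × Euc d × Euc d => ψ z.2)
          ((fderiv ℝ ψ (p.2.1, (p.2.2 : Euc d))).comp
            (ContinuousLinearMap.snd ℝ ℝ (Euc d × Euc d)))
          (p.1, p.2.1, (p.2.2 : Euc d)) :=
        HasFDerivAt.comp (g := ψ) _
          (hψ.1.differentiable (by simp) (p.2.1, (p.2.2 : Euc d))).hasFDerivAt hasFDerivAt_snd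
      refine (DFunLike.congr_fun (d1.mul d2).fderiv _).trans ?_
      simp [ha]
    simp_rw [hder] at hw
    obtain ⟨E, hE⟩ := hη.continuous.bounded_above_of_compact_support hηc
    have e1 : ∀ᵐ p ∂phaseTimeMeasure Ω T, η p.1 * ((f₀ p.2 * a p.2 + g₀ p.2 * b p.2) +
        ∫ r in (0 : ℝ)..p.1, (f' (r, p.2) * a p.2 + g' (r, p.2) * b p.2)) =
        f p * (η p.1 * a p.2) + g p * (η p.1 * b p.2) := by
      have hii : ∀ {k : ℝ × Euc d × Sph d → ℝ}, Integrable k (phaseTimeMeasure Ω T) →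
          ∀ᵐ p ∂phaseTimeMeasure Ω T, IntervalIntegrable (fun r => k (r, p.2)) volume 0 p.1 := by
        intro k hk
        have := (Measure.quasiMeasurePreserving_snd (μ := volume.restrict (Ioo 0 T))
          (ν := phaseMeasure Ω)).ae (ae_integrableOn_time hk)
        filter_upwards [this, ae_fst_mem_Ioo] with p hp hpT
        rw [intervalIntegrable_iff_integrableOn_Ioc_of_le hpT.1.le]
        exact hp.mono_set fun r hr => ⟨hr.1, hr.2.trans_lt hpT.2⟩
      filter_upwards [hrf, hrg, hii i3, hii i4] with p h1 h2 h3 h4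
      rw [intervalIntegral.integral_add h3 h4, intervalIntegral.integral_mul_const,
        intervalIntegral.integral_mul_const, h1, h2]
      ring
    have hηb : ∀ p : ℝ × Euc d × Sph d, ‖η p.1‖ ≤ E := fun p => hE _
    have hηm : AEStronglyMeasurable (fun p : ℝ × Euc d × Sph d => η p.1) (phaseTimeMeasure Ω T) :=
      (hη.continuous.comp continuous_fst).aestronglyMeasurable
    have hfi : Integrable f (phaseTimeMeasure Ω T) :=
      ((hf₀.comp_snd _).add (integrable_primitive hfm' hf')).congr
        (hrf.mono fun p hp => hp.symm)
    have hgi : Integrable g (phaseTimeMeasure Ω T) :=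
      ((hg₀.comp_snd _).add (integrable_primitive hgm' hg')).congr
        (hrg.mono fun p hp => hp.symm)
    have j1 : Integrable (fun p => f p * (η p.1 * a p.2)) (phaseTimeMeasure Ω T) := by
      refine hfi.mul_bdd (c := E * A)
        (hηm.mul (hac.comp continuous_snd).aestronglyMeasurable) (Eventually.of_forall fun p => ?_)
      rw [norm_mul]
      exact mul_le_mul (hηb p) (haA _) (norm_nonneg _) ((norm_nonneg _).trans (hηb p))
    have j2 : Integrable (fun p => g p * (η p.1 * b p.2)) (phaseTimeMeasure Ω T) := by
      refine hgi.mul_bdd (c := E * B)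
        (hηm.mul (hbc.comp continuous_snd).aestronglyMeasurable) (Eventually.of_forall fun p => ?_)
      rw [norm_mul]
      exact mul_le_mul (hηb p) (hB _) (norm_nonneg _) ((norm_nonneg _).trans (hηb p))
    refine (integral_congr_ae e1).trans ?_
    refine (integral_add j1 j2).trans ?_
    rw [hw]
    exact neg_add_cancel _
  rw [integral_add i1 i2] at key
  have h2 := h₁ ψ hψ
  have h3 : ∫ q, f₁ q * a q ∂phaseMeasure Ω = ∫ q, f₀ q * a q ∂phaseMeasure Ω :=
    integral_congr_ae (hf₁.mono fun q hq => by simp only [hq])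
  have h4 : ∫ q, f₁ q * a q ∂phaseMeasure Ω = -∫ q, g₁ q * b q ∂phaseMeasure Ω := h2
  have h5 : ∫ q, g₁ q * b q ∂phaseMeasure Ω = ∫ q, g₀ q * b q ∂phaseMeasure Ω := by linarith
  exact h5

end

/-! ### The problem differentiated in time -/

section

variable {d : ℕ}

theorem exists_stronglyMeasurable_bounded {α : Type*} [MeasurableSpace α] {P : Measure α}
    {f : α → ℝ} (hf : AEStronglyMeasurable f P) {M : ℝ} (hM : 0 ≤ M) (h : ∀ᵐ x ∂P, |f x| ≤ M) :
    ∃ g : α → ℝ, StronglyMeasurable g ∧ f =ᵐ[P] g ∧ ∀ x, |g x| ≤ M := by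
  refine ⟨fun x => max (-M) (min (hf.mk f x) M),
    (measurable_const.max (hf.stronglyMeasurable_mk.measurable.min
      measurable_const)).stronglyMeasurable, ?_, fun x => ?_⟩
  · filter_upwards [hf.ae_eq_mk, h] with x h1 h2
    rw [← h1, min_eq_left (abs_le.mp h2).2, max_eq_right (abs_le.mp h2).1]
  · exact abs_le.mpr ⟨le_max_left _ _, max_le (by linarith) (min_le_right _ _)⟩

variable [IsProbabilityMeasure (sphereMeasure d)]

theorem ae_ae_scatteringMeasure {Ω : Set (Euc d)} {S : Euc d × Sph d × Sph d → Prop}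
    (h : ∀ᵐ r ∂scatteringMeasure Ω, S r) :
    ∀ᵐ q ∂phaseMeasure Ω, ∀ᵐ v' ∂sphereMeasure d, S (q.1, v', q.2) := by
  have h1 : MeasurePreserving (fun z : (Euc d × Sph d) × Sph d => (z.1.1, z.2, z.1.2))
      ((phaseMeasure Ω).prod (sphereMeasure d)) (scatteringMeasure Ω) := by
    have e1 := measurePreserving_prodAssoc (volume.restrict Ω) (sphereMeasure d) (sphereMeasure d)
    have e2 := (MeasurePreserving.id (volume.restrict Ω)).prod
      (Measure.measurePreserving_swap (μ := sphereMeasure d) (ν := sphereMeasure d))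
    exact e2.comp e1
  exact Measure.ae_ae_of_ae_prod (h1.quasiMeasurePreserving.ae h)

theorem isFiniteMeasure_phaseMeasure {Ω : Set (Euc d)} (hb : Bornology.IsBounded Ω) :
    IsFiniteMeasure (phaseMeasure Ω) := by
  have : IsFiniteMeasure (volume.restrict Ω) :=
    ⟨by rw [Measure.restrict_apply_univ]; exact hb.measure_lt_top⟩
  unfold phaseMeasure
  infer_instance

theorem isFiniteMeasure_phaseTimeMeasure {Ω : Set (Euc d)} (hb : Bornology.IsBounded Ω) (T : ℝ) :
    IsFiniteMeasure (phaseTimeMeasure Ω T) := by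
  have := isFiniteMeasure_phaseMeasure hb
  unfold phaseTimeMeasure
  infer_instance

/-- The derivative `U` of a solution, its initial value `u₀`, `W = ∂ₜU` and `F = v · ∇ₓU`. -/
structure IsDerivedSolution (Ω : Set (Euc d)) (T : ℝ) (σ : Euc d × Sph d → ℝ)
    (μ : Euc d × Sph d × Sph d → ℝ) (Stil S₀init f₀ Xf₀ : Euc d × Sph d → ℝ)
    (S₀t : ℝ × Euc d × Sph d → ℝ) (u₀ : Euc d × Sph d → ℝ) (U W F : ℝ × Euc d × Sph d → ℝ) :
    Prop where
  meas_U : StronglyMeasurable U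
  meas_F : StronglyMeasurable F
  memLp_U : MemLp U 2 (phaseTimeMeasure Ω T)
  memLp_W : MemLp W 2 (phaseTimeMeasure Ω T)
  memLp_F : MemLp F 2 (phaseTimeMeasure Ω T)
  eq_time : ∀ᵐ p ∂phaseTimeMeasure Ω T, U p = u₀ p.2 + ∫ r in (0 : ℝ)..p.1, W (r, p.2)
  eq_ray : ∀ᵐ p ∂phaseTimeMeasure Ω T,
    U p = ∫ r in Iio 0, rayKernel Ω (p.2, r) * F (p.1, rayMap (p.2, r))
  equation : ∀ᵐ p ∂phaseTimeMeasure Ω T,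
    W p + F p + σ p.2 * U p = scattering μ U p + Stil p.2 * S₀t p
  initial : ∀ᵐ q ∂phaseMeasure Ω, u₀ q + Xf₀ q + σ q * f₀ q =
    ∫ v', μ (q.1, v', q.2) * f₀ (q.1, v') ∂sphereMeasure d + Stil q * S₀init q

/-- Neither the equation nor the boundary condition is differentiated. The functions f, v·∇f and S₀
are primitives in time whose constants are their initial values, and ∂ₜf is the primitive of W with
constant u₀. Inserted into the ray formula for f and into the equation, they give identities c + ∫₀ᵗ
H = 0, in which c and H must vanish separately. -/
theorem exists_isDerivedSolution {Ω : Set (Euc d)} (hΩ : IsOpen Ω) (hb : Bornology.IsBounded Ω)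
    (hc : Convex ℝ Ω) (hs : HasSmoothBoundary Ω) {T : ℝ} (hT : 0 < T)
    {σ σ' Stil Stil' f₀ f₀' Xf₀ Xf₀' S₀init : Euc d × Sph d → ℝ}
    {μ μ' : Euc d × Sph d × Sph d → ℝ} {M m N c₃ : ℝ}
    (hσm : StronglyMeasurable σ') (hσ : σ =ᵐ[phaseMeasure Ω] σ') (hσM : ∀ q, |σ' q| ≤ M)
    (hμm : StronglyMeasurable μ') (hμ : μ =ᵐ[scatteringMeasure Ω] μ') (hμM : ∀ r, |μ' r| ≤ m)
    (hSm : StronglyMeasurable Stil') (hS : Stil =ᵐ[phaseMeasure Ω] Stil') (hSM : ∀ q, |Stil' q| ≤ N)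
    {S₀ S₀t S₀t' : ℝ × Euc d × Sph d → ℝ}
    (hS₀m : AEStronglyMeasurable S₀ (phaseTimeMeasure Ω T)) (hc₃ : 0 ≤ c₃)
    (hS₀ : ∀ᵐ p ∂phaseTimeMeasure Ω T, |S₀ p| ≤ c₃)
    (hStm : StronglyMeasurable S₀t') (hSt : S₀t =ᵐ[phaseTimeMeasure Ω T] S₀t')
    (hStM : ∀ p, |S₀t' p| ≤ c₃) (hSw : HasWeakTimeDeriv Ω T S₀ S₀t)
    (hSi : HasInitialValue Ω S₀ S₀init)
    (hf₀ : f₀ =ᵐ[phaseMeasure Ω] f₀')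
    (hX₀ : Xf₀ =ᵐ[phaseMeasure Ω] Xf₀') (hX₀i : Integrable Xf₀' (phaseMeasure Ω))
    (hw₀ : HasWeakTransportDeriv Ω f₀ Xf₀)
    {f ft ftt Xf Xft : ℝ × Euc d × Sph d → ℝ}
    (h : IsSolution Ω T σ μ (fun p => Stil p.2 * S₀ p) f₀ f ft ftt Xf Xft) :
    ∃ u₀ U W F, ft =ᵐ[phaseTimeMeasure Ω T] U ∧
      IsDerivedSolution Ω T σ' μ' Stil' S₀init f₀' Xf₀' S₀t' u₀ U W F := by
  have hfinP := isFiniteMeasure_phaseMeasure hb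
  have hfin := isFiniteMeasure_phaseTimeMeasure hb T
  have hone : (1 : ℝ≥0∞) ≤ 2 := one_le_two
  obtain ⟨fr, hfrm, hfr⟩ := h.memLp_f.aestronglyMeasurable
  obtain ⟨U, hUm, hU⟩ := h.memLp_ft.aestronglyMeasurable
  obtain ⟨W, hWm, hW⟩ := h.memLp_ftt.aestronglyMeasurable
  obtain ⟨G, hGm, hG⟩ := h.memLp_Xf.aestronglyMeasurable
  obtain ⟨F, hFm, hF⟩ := h.memLp_Xft.aestronglyMeasurable
  obtain ⟨R, hRm, hR, hRM⟩ := exists_stronglyMeasurable_bounded hS₀m hc₃ hS₀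
  have hfrL := h.memLp_f.ae_eq hfr
  have hUL := h.memLp_ft.ae_eq hU
  have hWL := h.memLp_ftt.ae_eq hW
  have hGL := h.memLp_Xf.ae_eq hG
  have hFL := h.memLp_Xft.ae_eq hF
  have hfri := hfrL.integrable hone
  have hUi := hUL.integrable hone
  have hWi := hWL.integrable hone
  have hGi := hGL.integrable hone
  have hFi := hFL.integrable hone
  have hRi : Integrable R (phaseTimeMeasure Ω T) :=
    Integrable.of_bound hRm.aestronglyMeasurable c₃ (Eventually.of_forall hRM)
  have hSti : Integrable S₀t' (phaseTimeMeasure Ω T) :=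
    Integrable.of_bound hStm.aestronglyMeasurable c₃ (Eventually.of_forall hStM)
  obtain ⟨f₁, hf₁m, hf₁i, hrf⟩ :=
    (h.deriv_ft.congr hfr hU).exists_ae_eq_add_primitive hΩ hT hfrm hUm hfri hUi
  obtain ⟨u₀, hu₀m, hu₀i, hrU⟩ :=
    (h.deriv_ftt.congr hU hW).exists_ae_eq_add_primitive hΩ hT hUm hWm hUi hWi
  obtain ⟨g₁, hg₁m, hg₁i, hrG⟩ :=
    (h.deriv_Xft.congr hG hF).exists_ae_eq_add_primitive hΩ hT hGm hFm hGi hFi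
  obtain ⟨s₁, hs₁m, hs₁i, hrR⟩ :=
    (hSw.congr hR hSt).exists_ae_eq_add_primitive hΩ hT hRm hStm hRi hSti
  have hf₁ : f₀ =ᵐ[phaseMeasure Ω] f₁ := h.initial.ae_eq hT hfr hUi hrf
  have hs₁ : S₀init =ᵐ[phaseMeasure Ω] s₁ := hSi.ae_eq hT hR hSti hrR
  have hXw := h.deriv_Xf.congr hfr hG
  have hg₁ : Xf₀ =ᵐ[phaseMeasure Ω] g₁ :=
    hXw.ae_eq_initial hΩ hT hUm hUi hFm hFi hf₁i hg₁i hrf hrG hw₀ hf₁ (hX₀i.congr hX₀.symm)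
  obtain ⟨C, hC⟩ := exists_isBoundedKernel_ray hΩ hb (Iio 0)
  have hray := ae_eq_integral_ray hΩ hb hc hs h.incoming hfr hfrm hGm hfri hGi hXw
  have hray2 := hC.kernelOp_primitive hGm hGi hFm hFi hg₁m hg₁i hrG
  let UF : ℝ × Euc d × Sph d → ℝ :=
    fun p => ∫ r in Iio 0, rayKernel Ω (p.2, r) * F (p.1, rayMap (p.2, r))
  have hUFm : StronglyMeasurable UF := (hC.time T).stronglyMeasurable_kernelOp hFm
  have hUFi : Integrable UF (phaseTimeMeasure Ω T) := (hC.time T).integrable_kernelOp hFm hFi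
  have hii : ∀ {k : ℝ × Euc d × Sph d → ℝ}, Integrable k (phaseTimeMeasure Ω T) →
      ∀ᵐ p ∂phaseTimeMeasure Ω T, IntervalIntegrable (fun r => k (r, p.2)) volume 0 p.1 := by
    intro k hk
    have := (Measure.quasiMeasurePreserving_snd (μ := volume.restrict (Ioo 0 T))
      (ν := phaseMeasure Ω)).ae (ae_integrableOn_time hk)
    filter_upwards [this, ae_fst_mem_Ioo] with p hp hpT
    rw [intervalIntegrable_iff_integrableOn_Ioc_of_le hpT.1.le]
    exact hp.mono_set fun r hr => ⟨hr.1, hr.2.trans_lt hpT.2⟩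
  -- Here H = U − UF, so U is the ray integral of F. This single formula encodes both v·∇U = F and
  -- the vanishing of U on the incoming boundary.
  have hUray : ∀ᵐ p ∂phaseTimeMeasure Ω T, U p - UF p = 0 := by
    refine (ae_eq_zero_of_add_primitive_eq_zero hT
      (c := fun q => f₁ q - kernelOp (volume.restrict (Iio 0)) (rayKernel Ω) rayMap g₁ q)
      (H := fun p => U p - UF p) (hUm.sub hUFm) (hUi.sub hUFi) ?_).2
    filter_upwards [hrf, hray, hray2, hii hUi, hii hUFi] with p h1 h2 h3 h4 h5
    rw [intervalIntegral.integral_sub h4 h5]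
    simp only [UF]
    linarith
  have hK := isBoundedKernel_scattering Ω hμm.measurable hμM
  have hK1 : ∀ᵐ p ∂phaseTimeMeasure Ω T, scattering μ f p = scattering μ' fr p := by
    have h1 := (hK.time T).ae_ae hfr
    have h2 := (Measure.quasiMeasurePreserving_snd (μ := volume.restrict (Ioo 0 T))
      (ν := phaseMeasure Ω)).ae (ae_ae_scatteringMeasure hμ)
    filter_upwards [h1, h2] with p hp1 hp2
    refine integral_congr_ae ?_
    filter_upwards [hp1, hp2] with v' h3 h4
    rw [h4]
    by_cases h5 : μ' (p.2.1, v', p.2.2) = 0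
    · rw [h5, zero_mul, zero_mul]
    · rw [h3 h5]
  have hK2 := hK.kernelOp_primitive hfrm hfri hUm hUi hf₁m hf₁i hrf
  let KU : ℝ × Euc d × Sph d → ℝ := scattering μ' U
  have hKUm : StronglyMeasurable KU := (hK.time T).stronglyMeasurable_kernelOp hUm
  have hKUi : Integrable KU (phaseTimeMeasure Ω T) := (hK.time T).integrable_kernelOp hUm hUi
  have hK3 : ∀ᵐ q ∂phaseMeasure Ω, kernelOp (sphereMeasure d)
      (fun z : (Euc d × Sph d) × Sph d => μ' (z.1.1, z.2, z.1.2)) (fun z => (z.1.1, z.2)) f₁ q =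
      kernelOp (sphereMeasure d)
      (fun z : (Euc d × Sph d) × Sph d => μ' (z.1.1, z.2, z.1.2)) (fun z => (z.1.1, z.2)) f₀' q :=
    hK.kernelOp_congr_ae (hf₁.symm.trans hf₀)
  have hsnd := Measure.quasiMeasurePreserving_snd (μ := volume.restrict (Ioo 0 T))
    (ν := phaseMeasure Ω)
  have hσU : Integrable (fun p => σ' p.2 * U p) (phaseTimeMeasure Ω T) :=
    hUi.bdd_mul (c := M) (hσm.comp_measurable measurable_snd).aestronglyMeasurable
      (Eventually.of_forall fun p => hσM _)
  have hSS : Integrable (fun p => Stil' p.2 * S₀t' p) (phaseTimeMeasure Ω T) :=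
    hSti.bdd_mul (c := N) (hSm.comp_measurable measurable_snd).aestronglyMeasurable
      (Eventually.of_forall fun p => hSM _)
  -- Here c is the equation at time zero, which gives u₀, and H is the equation differentiated in
  -- time.
  have hfinal := ae_eq_zero_of_add_primitive_eq_zero hT
    (c := fun q => u₀ q + g₁ q + σ' q * f₁ q - kernelOp (sphereMeasure d)
      (fun z : (Euc d × Sph d) × Sph d => μ' (z.1.1, z.2, z.1.2)) (fun z => (z.1.1, z.2)) f₁ q
      - Stil' q * s₁ q)
    (H := fun p => W p + F p + σ' p.2 * U p - KU p - Stil' p.2 * S₀t' p)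
    ((((hWm.add hFm).add ((hσm.comp_measurable measurable_snd).mul hUm)).sub hKUm).sub
      ((hSm.comp_measurable measurable_snd).mul hStm))
    ((((hWi.add hFi).add hσU).sub hKUi).sub hSS) (by
      filter_upwards [h.equation, hK1, hK2, hrf, hrU, hrG, hrR, hU, hG, hfr, hR, hsnd.ae hσ,
        hsnd.ae hS, hii hWi, hii hFi, hii hσU, hii hKUi, hii hSS] with p e k1 k2 r1 r2 r3 r4 a1 a2
          a3 a4 a5 a6 i1 i2 i3 i4 i5
      rw [intervalIntegral.integral_sub (((i1.add i2).add i3).sub i4) i5,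
        intervalIntegral.integral_sub ((i1.add i2).add i3) i4,
        intervalIntegral.integral_add (i1.add i2) i3, intervalIntegral.integral_add i1 i2,
        intervalIntegral.integral_const_mul, intervalIntegral.integral_const_mul]
      have k3 : scattering μ' fr p = kernelOp (sphereMeasure d)
          (fun z : (Euc d × Sph d) × Sph d => μ' (z.1.1, z.2, z.1.2)) (fun z => (z.1.1, z.2)) f₁
            p.2 + ∫ r in (0 : ℝ)..p.1, KU (r, p.2) := k2
      rw [k1, k3, a1, a2, a3, a5, a6, a4, r1, r2, r3, r4] at e
      linarith)
  refine ⟨u₀, U, W, F, hU, ⟨hUm, hFm, hUL, hWL, hFL, hrU, ?_, ?_, ?_⟩⟩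
  · filter_upwards [hUray] with p hp
    exact sub_eq_zero.mp hp
  · filter_upwards [hfinal.2] with p hp
    have : KU p = scattering μ' U p := rfl
    linarith
  · filter_upwards [hfinal.1, hK3, hf₁, hf₀, hs₁, hg₁, hX₀] with q hq k b1 b2 b3 b4 b5
    have k4 : kernelOp (sphereMeasure d)
      (fun z : (Euc d × Sph d) × Sph d => μ' (z.1.1, z.2, z.1.2)) (fun z => (z.1.1, z.2)) f₀' q =
        ∫ v', μ' (q.1, v', q.2) * f₀' (q.1, v') ∂sphereMeasure d := rfl
    rw [k, k4, ← b1, ← b3, ← b4, b2, b5] at hq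
    linarith

end

section

variable {d : ℕ} [IsProbabilityMeasure (sphereMeasure d)]

/-! ### The outgoing trace -/

theorem rayMap_add (y : Euc d) (v : Sph d) (s r : ℝ) :
    rayMap ((y + s • (v : Euc d), v), r) = rayMap ((y, v), s + r) := by
  simp only [rayMap, Prod.mk.injEq, and_true]
  module

theorem rayKernel_add (Ω : Set (Euc d)) (y : Euc d) (v : Sph d) (s r : ℝ) :
    rayKernel Ω ((y + s • (v : Euc d), v), r) = rayKernel Ω ((y, v), s + r) := by
  simp only [rayKernel]
  congr 1
  module

theorem tendsto_setIntegral_Iio_essRight {g : ℝ → ℝ} (hg : IntegrableOn g (Iio 0)) :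
    Tendsto (fun s : ℝ => ∫ r in Iio (-s), g r) essRight (𝓝 (∫ r in Iio 0, g r)) := by
  have hg' : IntegrableOn g (Iic 0) := by rwa [integrableOn_Iic_iff_integrableOn_Iio]
  have hii : IntervalIntegrable g volume (-1) 0 := by
    rw [intervalIntegrable_iff_integrableOn_Ioc_of_le (by norm_num)]
    exact hg'.mono_set Ioc_subset_Iic_self
  have hcont := intervalIntegral.continuousOn_primitive_interval' hii right_mem_uIcc
  rw [uIcc_of_le (by norm_num)] at hcont
  have h7 := (hcont 0 (right_mem_Icc.mpr (by norm_num))).tendsto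
  rw [intervalIntegral.integral_same] at h7
  have hsmall : ∀ᶠ t in essRight, t ∈ Ioo (0 : ℝ) 1 :=
    Filter.mem_inf_of_left (Ioo_mem_nhdsGT one_pos)
  have h8 : Tendsto (fun s : ℝ => -s) essRight (𝓝[Icc (-1) 0] 0) := by
    refine tendsto_nhdsWithin_iff.mpr ⟨?_, ?_⟩
    · have : Tendsto (fun s : ℝ => -s) (𝓝 0) (𝓝 (-0)) := continuous_neg.tendsto 0
      rw [neg_zero] at this
      exact this.mono_left (inf_le_left.trans nhdsWithin_le_nhds)
    · filter_upwards [hsmall] with s hs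
      exact ⟨by linarith [hs.2], by linarith [hs.1]⟩
  have h9 := (h7.comp h8).add_const (∫ r in Iic 0, g r)
  rw [zero_add] at h9
  simp_rw [← integral_Iic_eq_integral_Iio]
  refine h9.congr' ?_
  filter_upwards [hsmall] with s hs
  have := intervalIntegral.integral_Iic_sub_Iic hg'
    (hg'.mono_set (Iic_subset_Iic.mpr (by linarith [hs.1] : -s ≤ 0)))
  simp only [Function.comp]
  linarith

/-- The boundary points at which the trace is known to be an integral along the ray. -/
def regularSet (Ω : Set (Euc d)) (F : ℝ × Euc d × Sph d → ℝ) (N : Set (ℝ × Euc d × Sph d)) :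
    Set (ℝ × Euc d × Sph d) :=
  {p | ∫⁻ r in Iio 0, ‖rayKernel Ω (p.2, r)‖ₑ * N.indicator 1 (p.1, rayMap (p.2, r)) = 0} ∩
  {p | ∫⁻ r in Iio 0, ‖rayKernel Ω (p.2, r) * F (p.1, rayMap (p.2, r))‖ₑ < ⊤} ∩
  ⋃ n : ℕ, {p | ∫⁻ r in Ioo (-(1 / ((n : ℝ) + 1))) 0, ‖rayKernel Ωᶜ (p.2, r)‖ₑ = 0}

theorem measurable_time_rayMap :
    Measurable fun z : (ℝ × Euc d × Sph d) × ℝ => (z.1.1, rayMap (z.1.2, z.2)) := by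
  have := measurable_rayMap (d := d)
  fun_prop

theorem measurable_time_rayKernel {Ω : Set (Euc d)} (hΩ : MeasurableSet Ω) :
    Measurable fun z : (ℝ × Euc d × Sph d) × ℝ => rayKernel Ω (z.1.2, z.2) :=
  (measurable_rayKernel hΩ).comp (by fun_prop)

theorem measurable_rayKernel_mul_indicator {Ω : Set (Euc d)} (hΩ : IsOpen Ω)
    {N : Set (ℝ × Euc d × Sph d)} (hN : MeasurableSet N) :
    Measurable fun z : (ℝ × Euc d × Sph d) × ℝ => ‖rayKernel Ω (z.1.2, z.2)‖ₑ *
      N.indicator (1 : ℝ × Euc d × Sph d → ℝ≥0∞) (z.1.1, rayMap (z.1.2, z.2)) := by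
  have h1 : Measurable (N.indicator (1 : ℝ × Euc d × Sph d → ℝ≥0∞)) := measurable_one.indicator hN
  exact (measurable_time_rayKernel hΩ.measurableSet).enorm.mul (h1.comp measurable_time_rayMap)

theorem stronglyMeasurable_rayKernel_mul {Ω : Set (Euc d)} (hΩ : IsOpen Ω)
    {F : ℝ × Euc d × Sph d → ℝ} (hF : StronglyMeasurable F) :
    StronglyMeasurable fun z : (ℝ × Euc d × Sph d) × ℝ =>
      rayKernel Ω (z.1.2, z.2) * F (z.1.1, rayMap (z.1.2, z.2)) :=
  ((measurable_time_rayKernel hΩ.measurableSet).mul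
    (hF.measurable.comp measurable_time_rayMap)).stronglyMeasurable

theorem measurableSet_regularSet {Ω : Set (Euc d)} (hΩ : IsOpen Ω) {F : ℝ × Euc d × Sph d → ℝ}
    (hF : StronglyMeasurable F) {N : Set (ℝ × Euc d × Sph d)} (hN : MeasurableSet N) :
    MeasurableSet (regularSet Ω F N) := by
  have m1 := measurable_rayKernel_mul_indicator hΩ hN
  have m2 := (stronglyMeasurable_rayKernel_mul hΩ hF).enorm
  have m3 : Measurable fun z : (ℝ × Euc d × Sph d) × ℝ => ‖rayKernel Ωᶜ (z.1.2, z.2)‖ₑ :=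
    (measurable_time_rayKernel hΩ.measurableSet.compl).enorm
  refine ((measurableSet_eq_fun m1.lintegral_prod_right' measurable_const).inter
    (measurableSet_lt m2.lintegral_prod_right' measurable_const)).inter
    (MeasurableSet.iUnion fun n => ?_)
  exact measurableSet_eq_fun m3.lintegral_prod_right' measurable_const

/-- Just behind a regular point almost every point of the ray is in Ω and off N. There f is the ray
integral up to parameter −s, which converges to the full ray integral because F is integrable along
the ray. -/
theorem outgoingTrace_eq_of_mem_regularSet {Ω : Set (Euc d)} (hΩ : IsOpen Ω)
    {f F : ℝ × Euc d × Sph d → ℝ} (hF : StronglyMeasurable F)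
    {N : Set (ℝ × Euc d × Sph d)} (hN : MeasurableSet N)
    (hf : ∀ p ∉ N, f p = ∫ r in Iio 0, rayKernel Ω (p.2, r) * F (p.1, rayMap (p.2, r)))
    {p : ℝ × Euc d × Sph d} (hp : p ∈ regularSet Ω F N) :
    outgoingTrace f p = ∫ r in Iio 0, rayKernel Ω (p.2, r) * F (p.1, rayMap (p.2, r)) := by
  obtain ⟨t, y, v⟩ := p
  rw [regularSet, mem_inter_iff, mem_inter_iff, mem_iUnion] at hp
  obtain ⟨⟨h1, h2⟩, n, h3⟩ := hp
  rw [mem_ofPred_eq] at h1 h2 h3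
  have hn : (0 : ℝ) < 1 / ((n : ℝ) + 1) := by positivity
  have a1 : Measurable (rayKernel Ω) := measurable_rayKernel hΩ.measurableSet
  have a2 : Measurable (rayKernel Ωᶜ) := measurable_rayKernel hΩ.measurableSet.compl
  have a3 : Measurable (N.indicator (1 : ℝ × Euc d × Sph d → ℝ≥0∞)) := measurable_one.indicator hN
  have a4 : Measurable (rayMap (d := d)) := measurable_rayMap
  have a5 : Measurable F := hF.measurable
  have m1 : Measurable fun r : ℝ => ‖rayKernel Ω ((y, v), r)‖ₑ *
      N.indicator (1 : ℝ × Euc d × Sph d → ℝ≥0∞) (t, rayMap ((y, v), r)) := by fun_prop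
  have m2 : Measurable fun r : ℝ =>
      rayKernel Ω ((y, v), r) * F (t, rayMap ((y, v), r)) := by fun_prop
  have m3 : Measurable fun r : ℝ => ‖rayKernel Ωᶜ ((y, v), r)‖ₑ := by fun_prop
  rw [lintegral_eq_zero_iff m1, EventuallyEq, ae_restrict_iff' measurableSet_Iio] at h1
  rw [lintegral_eq_zero_iff m3, EventuallyEq, ae_restrict_iff' measurableSet_Ioo] at h3
  have hint : IntegrableOn (fun r => rayKernel Ω ((y, v), r) * F (t, rayMap ((y, v), r)))
      (Iio 0) := ⟨m2.aestronglyMeasurable, h2⟩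
  refine Tendsto.limUnder_eq ?_
  refine essRight_congr hn ?_ (tendsto_setIntegral_Iio_essRight hint)
  filter_upwards [(Measure.measurePreserving_neg volume).quasiMeasurePreserving.ae h1,
    (Measure.measurePreserving_neg volume).quasiMeasurePreserving.ae h3] with s q1 q3 hs
  have hΩs : y + (-s) • (v : Euc d) ∈ Ω := by
    by_contra hc
    have h4 : rayKernel Ωᶜ ((y, v), -s) = 1 := indicator_of_mem (s := Ωᶜ) hc _
    have h5 : ‖rayKernel Ωᶜ ((y, v), -s)‖ₑ = 0 := q3 ⟨by linarith [hs.2], by linarith [hs.1]⟩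
    rw [h4, enorm_one] at h5
    exact one_ne_zero h5
  have hNs : (t, rayMap ((y, v), -s)) ∉ N := by
    intro hmem
    have h4 : rayKernel Ω ((y, v), -s) = 1 := indicator_of_mem (s := Ω) hΩs _
    have h5 : ‖rayKernel Ω ((y, v), -s)‖ₑ *
        N.indicator (1 : ℝ × Euc d × Sph d → ℝ≥0∞) (t, rayMap ((y, v), -s)) = 0 :=
      q1 (neg_lt_zero.mpr hs.1)
    rw [h4, enorm_one, one_mul, indicator_of_mem hmem, Pi.one_apply] at h5
    exact one_ne_zero h5
  have e1 : y - s • (v : Euc d) = y + (-s) • (v : Euc d) := by module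
  have e2 : rayMap ((y, v), -s) = (y + (-s) • (v : Euc d), v) := rfl
  simp only [e1]
  rw [← e2, hf _ hNs, e2]
  simp only [rayKernel_add, rayMap_add]
  have hmp := measurePreserving_add_left (volume : Measure ℝ) (-s)
  have := hmp.setIntegral_preimage_emb (MeasurableEquiv.addLeft (-s)).measurableEmbedding
    (fun r => rayKernel Ω ((y, v), r) * F (t, rayMap ((y, v), r))) (Iio (-s))
  have hpre : (fun x => -s + x) ⁻¹' Iio (-s) = Iio 0 := by
    ext r
    simp
  rw [hpre] at this
  exact this.symm

/-- Shifting the parameter by the exit time identifies the ray behind the exit point with the chord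
through p. What holds along the chord of almost every p therefore holds behind its exit point. -/
theorem ae_exitPoint_mem_regularSet {Ω : Set (Euc d)} (hΩ : IsOpen Ω) (hb : Bornology.IsBounded Ω)
    (hc : Convex ℝ Ω) {T : ℝ} {F : ℝ × Euc d × Sph d → ℝ} (hFm : StronglyMeasurable F)
    (hF : Integrable F (phaseTimeMeasure Ω T)) {N : Set (ℝ × Euc d × Sph d)}
    (hN0 : phaseTimeMeasure Ω T N = 0) :
    ∀ᵐ p ∂phaseTimeMeasure Ω T, (p.1, exitPoint Ω p.2.1 p.2.2, p.2.2) ∈ regularSet Ω F N ∧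
      ∫ r in Iio 0, rayKernel Ω ((exitPoint Ω p.2.1 p.2.2, p.2.2), r) *
        F (p.1, rayMap ((exitPoint Ω p.2.1 p.2.2, p.2.2), r)) =
      ∫ r in chord Ω p.2.1 p.2.2, F (p.1, p.2.1 + r • (p.2.2 : Euc d), p.2.2) := by
  filter_upwards [ae_ray hΩ hb (measure_eq_zero_iff_ae_notMem.mp hN0),
    ae_integrableOn_chord hΩ hb hFm hF, ae_mem_phaseTimeMeasure hΩ] with p h1 h2 hp
  obtain ⟨t, x, v⟩ := p
  simp only at h1 h2 hp ⊢
  have hv := norm_eq_of_mem_sphere v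
  have t1 := exitTime_pos hΩ hb hc hp.2 hv
  have t2 := exitTime_pos hΩ hb hc hp.2 (v := -v) (by rwa [norm_neg])
  have hch := chord_eq hΩ hb hc hp.2 hv
  set a := exitTime Ω x v with ha
  have hmp := measurePreserving_add_left (volume : Measure ℝ) a
  have hemb := (MeasurableEquiv.addLeft a).measurableEmbedding
  have hpre : (fun r => a + r) ⁻¹' Iio a = Iio 0 := by ext r; simp
  simp only [exitPoint, ← ha]
  have hsub : chord Ω x v ∩ Iio a = chord Ω x v := by
    rw [hch]
    exact inter_eq_left.mpr fun r hr => hr.2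
  have hi1 : Integrable (fun r => rayKernel Ω ((x, v), r) * F (t, rayMap ((x, v), r))) := by
    rw [← integrable_indicator_iff (isOpen_chord hΩ _ _).measurableSet] at h2
    refine h2.congr (Eventually.of_forall fun r => ?_)
    exact (rayKernel_mul Ω (x, v) r fun r => F (t, x + r • (v : Euc d), v)).symm
  refine ⟨⟨⟨?_, ?_⟩, mem_iUnion.mpr ?_⟩, ?_⟩
  · simp only [mem_ofPred_eq, rayKernel_add, rayMap_add]
    rw [lintegral_congr_ae, lintegral_zero]
    refine ae_restrict_of_ae ?_
    filter_upwards [hmp.quasiMeasurePreserving.ae h1] with r hr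
    by_cases hm : x + (a + r) • (v : Euc d) ∈ Ω
    · have : (t, rayMap ((x, v), a + r)) ∉ N := hr hm
      rw [indicator_of_notMem this, mul_zero]
    · rw [rayKernel, indicator_of_notMem hm, enorm_zero, zero_mul]
  · simp only [mem_ofPred_eq, rayKernel_add, rayMap_add]
    exact (hmp.integrable_comp_of_integrable hi1).integrableOn.2
  · obtain ⟨n, hn⟩ := exists_nat_one_div_lt (add_pos t1 t2)
    refine ⟨n, ?_⟩
    simp only [mem_ofPred_eq, rayKernel_add]
    rw [setLIntegral_congr_fun measurableSet_Ioo (g := fun _ => 0), lintegral_zero]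
    intro r hr
    have hm : a + r ∈ chord Ω x v := by
      rw [hch]
      exact ⟨by linarith [hr.1], by linarith [hr.2]⟩
    have hm' : x + (a + r) • (v : Euc d) ∉ Ωᶜ := not_not.mpr hm
    simp only [rayKernel, indicator_of_notMem hm', enorm_zero]
  · simp only [rayKernel_add, rayMap_add]
    have := hmp.setIntegral_preimage_emb hemb
      (fun r => rayKernel Ω ((x, v), r) * F (t, rayMap ((x, v), r))) (Iio a)
    rw [hpre] at this
    refine this.trans ?_
    have h5 := integral_rayKernel hΩ (x, v) (Iio a) fun r => F (t, rayMap ((x, v), r))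
    refine h5.trans ?_
    simp only
    rw [hsub]
    rfl

/-- At an exit point the trace of f is the integral of F over the whole chord, and
`lintegral_exitPoint_le` passes from the phase space to the boundary. Only this inequality is
needed, because the trace stands on the larger side of the stability estimate. -/
theorem lintegral_chord_sq_le {Ω : Set (Euc d)} (hΩ : IsOpen Ω) (hb : Bornology.IsBounded Ω)
    (hc : Convex ℝ Ω) (hs : HasSmoothBoundary Ω) {T : ℝ} {f F : ℝ × Euc d × Sph d → ℝ}
    (hFm : StronglyMeasurable F) (hF : Integrable F (phaseTimeMeasure Ω T))
    (hf : ∀ᵐ p ∂phaseTimeMeasure Ω T,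
      f p = ∫ r in Iio 0, rayKernel Ω (p.2, r) * F (p.1, rayMap (p.2, r))) :
    ∫⁻ p, (chordLength Ω p.2.1 p.2.2)⁻¹ *
        ‖∫ r in chord Ω p.2.1 p.2.2, F (p.1, p.2.1 + r • (p.2.2 : Euc d), p.2.2)‖ₑ ^ 2
        ∂phaseTimeMeasure Ω T ≤
      eLpNorm (outgoingTrace f) 2 (outgoingMeasure Ω T) ^ 2 := by
  obtain ⟨N, hN, hNm, hN0⟩ := exists_measurable_superset_of_null (ae_iff.mp hf)
  have hfN : ∀ p ∉ N, f p = ∫ r in Iio 0, rayKernel Ω (p.2, r) * F (p.1, rayMap (p.2, r)) :=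
    fun p hp => by
      by_contra hne
      exact hp (hN hne)
  have hEm := measurableSet_regularSet hΩ hFm hNm
  let O : ℝ × Euc d × Sph d → ℝ :=
    fun p => ∫ r in Iio 0, rayKernel Ω (p.2, r) * F (p.1, rayMap (p.2, r))
  have hOm : Measurable O := by
    have h1 := stronglyMeasurable_rayKernel_mul hΩ hFm
    exact (h1.integral_prod_right' (ν := volume.restrict (Iio 0))).measurable
  -- Restriction to the measurable set of regular points discards the boundary points at which the
  -- trace is unknown. Measurability of the trace itself is then never needed.
  let G : ℝ × Euc d × Sph d → ℝ≥0∞ := (regularSet Ω F N).indicator fun p => ‖O p‖ₑ ^ 2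
  have hGm : Measurable G := (hOm.enorm.pow_const 2).indicator hEm
  have hnv : Measurable fun p : ℝ × Euc d × Sph d =>
      inner ℝ (outerNormal Ω p.2.1) (p.2.2 : Euc d) := by
    have h1 : Measurable fun p : ℝ × Euc d × Sph d => outerNormal Ω p.2.1 :=
      (hs.measurable_outerNormal hΩ).comp (by fun_prop)
    have h2 : Measurable fun p : ℝ × Euc d × Sph d => (p.2.2 : Euc d) := by fun_prop
    exact h1.inner h2
  calc ∫⁻ p, (chordLength Ω p.2.1 p.2.2)⁻¹ *
        ‖∫ r in chord Ω p.2.1 p.2.2, F (p.1, p.2.1 + r • (p.2.2 : Euc d), p.2.2)‖ₑ ^ 2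
        ∂phaseTimeMeasure Ω T
      = ∫⁻ p, (chordLength Ω p.2.1 p.2.2)⁻¹ * G (p.1, exitPoint Ω p.2.1 p.2.2, p.2.2)
        ∂phaseTimeMeasure Ω T := by
        refine lintegral_congr_ae ?_
        filter_upwards [ae_exitPoint_mem_regularSet hΩ hb hc hFm hF hN0] with p hp
        rw [← hp.2]
        simp only [G, indicator_of_mem hp.1, O]
    _ ≤ ∫⁻ p, ENNReal.ofReal (inner ℝ (outerNormal Ω p.2.1) (p.2.2 : Euc d)) * G p
        ∂boundaryMeasure Ω T :=
        lintegral_exitPoint_le hΩ hb hc hs (w := fun v => (v : Euc d)) (by fun_prop)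
          (fun v => norm_eq_of_mem_sphere v) hGm
    _ = ∫⁻ p, G p ∂outgoingMeasure Ω T := by
        rw [outgoingMeasure, lintegral_withDensity_eq_lintegral_mul _ hnv.ennreal_ofReal hGm,
          setLIntegral_eq_of_support_subset]
        · rfl
        · intro p hp
          by_contra hnp
          refine hp ?_
          have : ENNReal.ofReal (inner ℝ (outerNormal Ω p.2.1) (p.2.2 : Euc d)) = 0 :=
            ENNReal.ofReal_of_nonpos (not_lt.mp hnp)
          simp [this]
    _ ≤ ∫⁻ p, ‖outgoingTrace f p‖ₑ ^ 2 ∂outgoingMeasure Ω T := by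
        refine lintegral_mono fun p => ?_
        by_cases hp : p ∈ regularSet Ω F N
        · simp only [G, indicator_of_mem hp, O]
          rw [outgoingTrace_eq_of_mem_regularSet hΩ hFm hNm hfN hp]
        · simp only [G, indicator_of_notMem hp, zero_le]
    _ = eLpNorm (outgoingTrace f) 2 (outgoingMeasure Ω T) ^ 2 := by
        rw [eLpNorm_eq_lintegral_rpow_enorm_toReal (by norm_num) (by norm_num)]
        simp only [ENNReal.toReal_ofNat, one_div]
        rw [← ENNReal.rpow_natCast, ← ENNReal.rpow_mul]
        norm_num

end

section

variable {d : ℕ}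

/-! ### Averaging over the chords -/

theorem lintegral_inv_chordLength_eq {Ω : Set (Euc d)} (hΩ : IsOpen Ω) (hb : Bornology.IsBounded Ω)
    (hc : Convex ℝ Ω) {x v : Euc d} (hx : x ∈ Ω) (hv : ‖v‖ = 1) :
    ∫⁻ s : ℝ, Ω.indicator (fun z => (chordLength Ω z v)⁻¹) (x - s • v) = 1 := by
  have h1 : ∀ s : ℝ, Ω.indicator (fun z => (chordLength Ω z v)⁻¹) (x - s • v) =
      (-chord Ω x v).indicator (fun _ => (chordLength Ω x v)⁻¹) s := by
    intro s
    have h2 : x - s • v = x + (-s) • v := by module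
    have h3 : s ∈ -chord Ω x v ↔ x - s • v ∈ Ω := by rw [Set.mem_neg, mem_chord, h2]
    by_cases hs : x - s • v ∈ Ω
    · rw [indicator_of_mem hs, indicator_of_mem (h3.mpr hs), h2, chordLength_add_smul]
    · rw [indicator_of_notMem hs, indicator_of_notMem (mt h3.mp hs)]
  simp_rw [h1]
  rw [lintegral_indicator_const (isOpen_chord hΩ x v).neg.measurableSet, Measure.measure_neg]
  exact ENNReal.inv_mul_cancel (chordLength_pos hΩ hb hc hx hv).ne'
    (chordLength_ne_top hΩ hb hc hx hv)

variable [IsProbabilityMeasure (sphereMeasure d)]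

/-- The substitution q ↦ rayMap (q, −r) moves the weight ℓ⁻¹ to the other points of the chord, along
which its integral is one. Chord integrals thus become phase space integrals without a
disintegration over the boundary. -/
theorem lintegral_chord_average {Ω : Set (Euc d)} (hΩ : IsOpen Ω) (hb : Bornology.IsBounded Ω)
    (hc : Convex ℝ Ω) {φ : Euc d × Sph d → ℝ≥0∞} (hφ : Measurable φ) :
    ∫⁻ q, (∫⁻ r : ℝ, (chordLength Ω q.1 q.2)⁻¹ * ‖rayKernel Ω (q, r)‖ₑ * φ (rayMap (q, r)))
      ∂phaseMeasure Ω = ∫⁻ q, φ q ∂phaseMeasure Ω := by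
  set m : Measure (Euc d × Sph d) := volume.prod (sphereMeasure d) with hm
  have hΩm : MeasurableSet (Ω ×ˢ (univ : Set (Sph d))) := hΩ.measurableSet.prod MeasurableSet.univ
  have hℓ : Measurable fun q : Euc d × Sph d => (chordLength Ω q.1 q.2)⁻¹ := by
    have h1 : Measurable fun q : Euc d × Sph d => (q.1, (q.2 : Euc d)) := by fun_prop
    exact ((measurable_chordLength hΩ).comp h1).inv
  let A : Euc d × Sph d → ℝ≥0∞ := (Ω ×ˢ univ).indicator fun q => (chordLength Ω q.1 q.2)⁻¹
  let B : Euc d × Sph d → ℝ≥0∞ := (Ω ×ˢ univ).indicator φ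
  have hA : Measurable A := hℓ.indicator hΩm
  have hB : Measurable B := hφ.indicator hΩm
  have hR : Measurable (rayMap (d := d)) := measurable_rayMap
  have m1 : Measurable fun z : (Euc d × Sph d) × ℝ => A z.1 * B (rayMap z) := by fun_prop
  have m2 : Measurable fun z : (Euc d × Sph d) × ℝ => A (rayMap (z.1, -z.2)) * B z.1 := by fun_prop
  have hmp : ∀ r : ℝ, MeasurePreserving (fun q : Euc d × Sph d => rayMap (q, r)) m m := fun r =>
    measurePreserving_transport r
  calc ∫⁻ q, (∫⁻ r : ℝ, (chordLength Ω q.1 q.2)⁻¹ * ‖rayKernel Ω (q, r)‖ₑ * φ (rayMap (q, r)))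
      ∂phaseMeasure Ω
      = ∫⁻ q, (∫⁻ r : ℝ, A q * B (rayMap (q, r))) ∂m := by
        rw [phaseMeasure_eq_restrict, ← lintegral_indicator hΩm]
        refine lintegral_congr fun q => ?_
        by_cases hq : q ∈ Ω ×ˢ (univ : Set (Sph d))
        · rw [indicator_of_mem hq]
          refine lintegral_congr fun r => ?_
          simp only [A, indicator_of_mem hq, B]
          by_cases hr : q.1 + r • (q.2 : Euc d) ∈ Ω
          · have hmem : rayMap (q, r) ∈ Ω ×ˢ (univ : Set (Sph d)) := ⟨hr, mem_univ _⟩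
            rw [indicator_of_mem hmem, rayKernel, indicator_of_mem hr, Pi.one_apply, enorm_one,
              mul_one]
          · have hmem : rayMap (q, r) ∉ Ω ×ˢ (univ : Set (Sph d)) := fun h => hr h.1
            rw [indicator_of_notMem hmem, rayKernel, indicator_of_notMem hr, enorm_zero,
              mul_zero, zero_mul]
        · simp only [A, indicator_of_notMem hq, zero_mul, lintegral_zero]
    _ = ∫⁻ r : ℝ, (∫⁻ q, A q * B (rayMap (q, r)) ∂m) := lintegral_lintegral_swap m1.aemeasurable
    _ = ∫⁻ r : ℝ, (∫⁻ q, A (rayMap (q, -r)) * B q ∂m) := by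
        refine lintegral_congr fun r => ?_
        have h1 : Measurable fun q => A (rayMap (q, -r)) * B q := by fun_prop
        rw [← (hmp r).lintegral_comp h1]
        refine lintegral_congr fun q => ?_
        have h2 : rayMap (rayMap (q, r), -r) = q := by
          have h3 : q.1 + r • (q.2 : Euc d) + (-r) • (q.2 : Euc d) = q.1 := by module
          exact Prod.ext h3 rfl
        rw [h2]
    _ = ∫⁻ q, (∫⁻ r : ℝ, A (rayMap (q, -r)) * B q) ∂m :=
        (lintegral_lintegral_swap m2.aemeasurable).symm
    _ = ∫⁻ q, φ q ∂phaseMeasure Ω := by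
        rw [phaseMeasure_eq_restrict, ← lintegral_indicator hΩm]
        refine lintegral_congr fun q => ?_
        have h1 : Measurable fun r : ℝ => A (rayMap (q, -r)) := by fun_prop
        rw [lintegral_mul_const _ h1]
        by_cases hq : q ∈ Ω ×ˢ (univ : Set (Sph d))
        · have h2 : ∀ r : ℝ, A (rayMap (q, -r)) =
              Ω.indicator (fun z => (chordLength Ω z q.2)⁻¹) (q.1 - r • (q.2 : Euc d)) := by
            intro r
            have h3 : q.1 - r • (q.2 : Euc d) = q.1 + (-r) • (q.2 : Euc d) := by module
            by_cases hr : q.1 + (-r) • (q.2 : Euc d) ∈ Ω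
            · have hmem : rayMap (q, -r) ∈ Ω ×ˢ (univ : Set (Sph d)) := ⟨hr, mem_univ _⟩
              simp only [A]
              rw [indicator_of_mem hmem, h3, indicator_of_mem hr]
              rfl
            · have hmem : rayMap (q, -r) ∉ Ω ×ˢ (univ : Set (Sph d)) := fun h => hr h.1
              simp only [A]
              rw [indicator_of_notMem hmem, h3, indicator_of_notMem hr]
          simp_rw [h2]
          rw [lintegral_inv_chordLength_eq hΩ hb hc hq.1 (norm_eq_of_mem_sphere q.2), one_mul]
        · simp only [B, indicator_of_notMem hq, mul_zero]

def rayWeight (Ω : Set (Euc d)) (z : (ℝ × Euc d × Sph d) × ℝ) : ℝ≥0∞ :=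
  (chordLength Ω z.1.2.1 z.1.2.2)⁻¹ * ‖rayKernel Ω (z.1.2, z.2)‖ₑ

theorem measurable_rayWeight {Ω : Set (Euc d)} (hΩ : IsOpen Ω) : Measurable (rayWeight Ω) := by
  have h1 : Measurable fun z : (ℝ × Euc d × Sph d) × ℝ => (z.1.2.1, (z.1.2.2 : Euc d)) := by
    fun_prop
  exact ((measurable_chordLength hΩ).comp h1).inv.mul
    (measurable_time_rayKernel hΩ.measurableSet).enorm

/-- As an identity of measures the averaging also yields integrability and the integrals of signed
functions. -/
theorem map_withDensity_rayWeight {Ω : Set (Euc d)} (hΩ : IsOpen Ω) (hb : Bornology.IsBounded Ω)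
    (hc : Convex ℝ Ω) (T : ℝ) :
    Measure.map (fun z : (ℝ × Euc d × Sph d) × ℝ => (z.1.1, rayMap (z.1.2, z.2)))
      (((phaseTimeMeasure Ω T).prod volume).withDensity (rayWeight Ω)) = phaseTimeMeasure Ω T := by
  refine Measure.ext_of_lintegral _ fun φ hφ => ?_
  have hR := measurable_time_rayMap (d := d)
  have hW := measurable_rayWeight hΩ
  have h1 : Measurable fun z : (ℝ × Euc d × Sph d) × ℝ =>
      φ (z.1.1, rayMap (z.1.2, z.2)) := hφ.comp hR
  have h2 : Measurable fun z : (ℝ × Euc d × Sph d) × ℝ =>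
      rayWeight Ω z * φ (z.1.1, rayMap (z.1.2, z.2)) := hW.mul h1
  rw [lintegral_map hφ hR, lintegral_withDensity_eq_lintegral_mul _ hW h1]
  refine (lintegral_prod _ h2.aemeasurable).trans ?_
  rw [phaseTimeMeasure, lintegral_prod _ h2.lintegral_prod_right'.aemeasurable,
    lintegral_prod _ hφ.aemeasurable]
  refine lintegral_congr fun t => ?_
  have h3 : Measurable fun q => φ (t, q) := hφ.comp measurable_prodMk_left
  exact lintegral_chord_average hΩ hb hc h3

/-- The integral over the phase space as an average of integrals over chords. -/
theorem integral_chord_average {Ω : Set (Euc d)} (hΩ : IsOpen Ω) (hb : Bornology.IsBounded Ω)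
    (hc : Convex ℝ Ω) {T : ℝ} {H : ℝ × Euc d × Sph d → ℝ}
    (hH : Integrable H (phaseTimeMeasure Ω T)) :
    Integrable (fun p : ℝ × Euc d × Sph d => (chordLength Ω p.2.1 p.2.2).toReal⁻¹ *
        ∫ r in chord Ω p.2.1 p.2.2, H (p.1, p.2.1 + r • (p.2.2 : Euc d), p.2.2))
        (phaseTimeMeasure Ω T) ∧
      ∫ p, H p ∂phaseTimeMeasure Ω T = ∫ p, ((chordLength Ω p.2.1 p.2.2).toReal⁻¹ *
        ∫ r in chord Ω p.2.1 p.2.2, H (p.1, p.2.1 + r • (p.2.2 : Euc d), p.2.2))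
          ∂phaseTimeMeasure Ω T := by
  have hmap := map_withDensity_rayWeight hΩ hb hc T
  have hR := measurable_time_rayMap (d := d)
  have hW := measurable_rayWeight hΩ
  have hH' := hH
  rw [← hmap] at hH'
  have hfin : ∀ᵐ z ∂(phaseTimeMeasure Ω T).prod (volume : Measure ℝ), rayWeight Ω z < ⊤ := by
    have := (Measure.quasiMeasurePreserving_fst (μ := phaseTimeMeasure Ω T)
      (ν := (volume : Measure ℝ))).ae (ae_mem_phaseTimeMeasure hΩ)
    filter_upwards [this] with z hz
    refine ENNReal.mul_lt_top ?_ enorm_lt_top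
    rw [ENNReal.inv_lt_top]
    exact chordLength_pos hΩ hb hc hz.2 (norm_eq_of_mem_sphere _)
  have h1 := (integrable_withDensity_iff_integrable_smul' hW hfin).mp
    (hH'.comp_measurable hR)
  have key : ∀ p : ℝ × Euc d × Sph d, ∫ r : ℝ, (rayWeight Ω (p, r)).toReal •
      H (p.1, rayMap (p.2, r)) = (chordLength Ω p.2.1 p.2.2).toReal⁻¹ *
        ∫ r in chord Ω p.2.1 p.2.2, H (p.1, p.2.1 + r • (p.2.2 : Euc d), p.2.2) := by
    intro p
    have h2 : ∀ r : ℝ, (rayWeight Ω (p, r)).toReal • H (p.1, rayMap (p.2, r)) =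
        (chordLength Ω p.2.1 p.2.2).toReal⁻¹ * (chord Ω p.2.1 p.2.2).indicator
          (fun r => H (p.1, p.2.1 + r • (p.2.2 : Euc d), p.2.2)) r := by
      intro r
      rw [← rayKernel_mul Ω p.2 r, rayWeight, ENNReal.toReal_mul, ENNReal.toReal_inv, smul_eq_mul,
        mul_assoc]
      congr 2
      by_cases hr : p.2.1 + r • (p.2.2 : Euc d) ∈ Ω
      · simp only [rayKernel, indicator_of_mem hr, Pi.one_apply, enorm_one, ENNReal.toReal_one]
      · simp only [rayKernel, indicator_of_notMem hr, enorm_zero, ENNReal.toReal_zero]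
    simp_rw [h2]
    rw [integral_const_mul, integral_indicator (isOpen_chord hΩ _ _).measurableSet]
  constructor
  · exact h1.integral_prod_left.congr (Eventually.of_forall key)
  · calc ∫ p, H p ∂phaseTimeMeasure Ω T
        = ∫ z, H (z.1.1, rayMap (z.1.2, z.2))
            ∂((phaseTimeMeasure Ω T).prod volume).withDensity (rayWeight Ω) := by
          conv_lhs => rw [← hmap]
          exact integral_map hR.aemeasurable hH'.aestronglyMeasurable
      _ = ∫ z, (rayWeight Ω z).toReal • H (z.1.1, rayMap (z.1.2, z.2))
            ∂((phaseTimeMeasure Ω T).prod volume) :=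
          integral_withDensity_eq_integral_toReal_smul hW hfin _
      _ = _ := (integral_prod _ h1).trans (integral_congr_ae (Eventually.of_forall key))

/-! ### Products of primitives -/

/-- The function h is merely integrable, so the square of its primitive is only absolutely
continuous, which is enough for the product rule in integrated form. -/
theorem integral_sq_mul_add {a b : ℝ} {h e : ℝ → ℝ}
    (hh : IntervalIntegrable h volume a b) (c : ℝ) (he : ContDiff ℝ 1 e) :
    ∫ t in a..b, (2 * (c + ∫ r in a..t, h r) * h t * e t +
        (c + ∫ r in a..t, h r) ^ 2 * deriv e t) =
      (c + ∫ r in a..b, h r) ^ 2 * e b - c ^ 2 * e a := by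
  let g : ℝ → ℝ := fun t => c + ∫ r in a..t, h r
  have hg : AbsolutelyContinuousOnInterval g a b := by
    have h1 := hh.absolutelyContinuousOnInterval_intervalIntegral left_mem_uIcc
    have h2 : AbsolutelyContinuousOnInterval (fun _ : ℝ => c) a b :=
      (contDiff_const (n := 1)).contDiffOn.absolutelyContinuousOnInterval
    exact h2.add h1
  have he' : AbsolutelyContinuousOnInterval e a b :=
    he.contDiffOn.absolutelyContinuousOnInterval
  have h1 := (hg.mul hg).integral_deriv_mul_eq_sub he'
  have ha : g a = c := by simp [g]
  simp only [Pi.mul_apply, ha] at h1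
  calc _ = ∫ t in a..b, (deriv (g * g) t * e t + g t * g t * deriv e t) := by
        refine intervalIntegral.integral_congr_ae ?_
        filter_upwards [hh.ae_hasDerivAt_integral] with t ht htm
        have h2 : HasDerivAt g (h t) t :=
          (ht (uIoc_subset_uIcc htm) a left_mem_uIcc).const_add c
        rw [(h2.mul h2).deriv]
        simp only [g]
        ring
    _ = _ := by
        rw [h1]
        simp only [g]
        ring

end

section

variable {d : ℕ} [IsProbabilityMeasure (sphereMeasure d)]

/-! ### Energy identities -/

/-- Along ∂ₜ + v·∇ₓ the logarithm of the weight grows at the rate 2(a γ·v − b). The Carleman weight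
has a = s and b = sβ; a = 0 gives the usual exponential factor of energy estimates. -/
def expWeight (γ : Euc d) (a b t : ℝ) (x : Euc d) : ℝ :=
  Real.exp (2 * (a * inner ℝ γ x - b * t))

theorem continuous_expWeight (γ : Euc d) (a b : ℝ) :
    Continuous fun p : ℝ × Euc d × Sph d => expWeight γ a b p.1 p.2.1 := by
  unfold expWeight
  fun_prop

theorem expWeight_pos (γ : Euc d) (a b t : ℝ) (x : Euc d) : 0 < expWeight γ a b t x :=
  Real.exp_pos _

theorem exists_expWeight_le {Ω : Set (Euc d)} (hb : Bornology.IsBounded Ω) (γ : Euc d)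
    (a b T : ℝ) : ∃ K, ∀ t ∈ Icc 0 T, ∀ x ∈ closure Ω, expWeight γ a b t x ≤ K := by
  have hc : IsCompact (Icc 0 T ×ˢ closure Ω) := isCompact_Icc.prod hb.isCompact_closure
  have hw : Continuous fun p : ℝ × Euc d => expWeight γ a b p.1 p.2 := by
    unfold expWeight
    fun_prop
  obtain ⟨K, hK⟩ := hc.exists_bound_of_continuousOn hw.continuousOn
  exact ⟨K, fun t ht x hx => (le_abs_self _).trans (hK (t, x) ⟨ht, hx⟩)⟩

/-- On each chord U is the primitive of F that is zero at the entry point. Integrating the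
derivative of U²w along the chord leaves the exit value alone, where U is the integral of F over the
chord. The chord identities are then averaged. -/
theorem integral_transport_energy {Ω : Set (Euc d)} (hΩ : IsOpen Ω) (hb : Bornology.IsBounded Ω)
    (hc : Convex ℝ Ω) {T : ℝ} {U F : ℝ × Euc d × Sph d → ℝ} (hFm : StronglyMeasurable F)
    (hU : MemLp U 2 (phaseTimeMeasure Ω T)) (hF : MemLp F 2 (phaseTimeMeasure Ω T))
    (hray : ∀ᵐ p ∂phaseTimeMeasure Ω T,
      U p = ∫ r in Iio 0, rayKernel Ω (p.2, r) * F (p.1, rayMap (p.2, r)))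
    (γ : Euc d) (a b : ℝ) {A : Set (Sph d)} (hA : MeasurableSet A) :
    Integrable (fun p => A.indicator (1 : Sph d → ℝ) p.2.2 * (2 * U p * F p +
      2 * a * inner ℝ γ (p.2.2 : Euc d) * U p ^ 2) * expWeight γ a b p.1 p.2.1)
      (phaseTimeMeasure Ω T) ∧
    Integrable (fun p : ℝ × Euc d × Sph d => A.indicator (1 : Sph d → ℝ) p.2.2 *
      (chordLength Ω p.2.1 p.2.2).toReal⁻¹ *
      (∫ r in chord Ω p.2.1 p.2.2, F (p.1, p.2.1 + r • (p.2.2 : Euc d), p.2.2)) ^ 2 *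
      expWeight γ a b p.1 (exitPoint Ω p.2.1 p.2.2)) (phaseTimeMeasure Ω T) ∧
    ∫ p, A.indicator (1 : Sph d → ℝ) p.2.2 * (2 * U p * F p +
      2 * a * inner ℝ γ (p.2.2 : Euc d) * U p ^ 2) * expWeight γ a b p.1 p.2.1
      ∂phaseTimeMeasure Ω T =
    ∫ p, A.indicator (1 : Sph d → ℝ) p.2.2 * (chordLength Ω p.2.1 p.2.2).toReal⁻¹ *
      (∫ r in chord Ω p.2.1 p.2.2, F (p.1, p.2.1 + r • (p.2.2 : Euc d), p.2.2)) ^ 2 *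
      expWeight γ a b p.1 (exitPoint Ω p.2.1 p.2.2) ∂phaseTimeMeasure Ω T := by
  have hfin := isFiniteMeasure_phaseTimeMeasure hb T
  have hFi : Integrable F (phaseTimeMeasure Ω T) := hF.integrable one_le_two
  obtain ⟨K, hK⟩ := exists_expWeight_le hb γ a b T
  have hAm : Measurable fun p : ℝ × Euc d × Sph d => A.indicator (1 : Sph d → ℝ) p.2.2 :=
    (measurable_one.indicator hA).comp (by fun_prop)
  have hA1 : ∀ v : Sph d, ‖A.indicator (1 : Sph d → ℝ) v‖ ≤ 1 := fun v => by
    refine (norm_indicator_le_norm_self _ _).trans ?_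
    simp
  have hwm := continuous_expWeight (d := d) γ a b
  have hH : Integrable (fun p => A.indicator (1 : Sph d → ℝ) p.2.2 * (2 * U p * F p +
      2 * a * inner ℝ γ (p.2.2 : Euc d) * U p ^ 2) * expWeight γ a b p.1 p.2.1)
      (phaseTimeMeasure Ω T) := by
    have h1 : Integrable (fun p => 2 * U p * F p) (phaseTimeMeasure Ω T) := by
      have := (hU.integrable_mul hF).const_mul 2
      refine this.congr (Eventually.of_forall fun p => ?_)
      simp only [Pi.mul_apply]; ring
    have h2 : Integrable (fun p => 2 * a * inner ℝ γ (p.2.2 : Euc d) * U p ^ 2)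
        (phaseTimeMeasure Ω T) := by
      refine hU.integrable_sq.bdd_mul (c := |2 * a| * ‖γ‖)
        (by fun_prop : Continuous fun p : ℝ × Euc d × Sph d =>
          2 * a * inner ℝ γ (p.2.2 : Euc d)).aestronglyMeasurable (Eventually.of_forall fun p => ?_)
      rw [norm_mul, Real.norm_eq_abs]
      refine mul_le_mul_of_nonneg_left ?_ (abs_nonneg _)
      refine (norm_inner_le_norm _ _).trans ?_
      rw [norm_eq_of_mem_sphere, mul_one]
    have h3 : Integrable (fun p => A.indicator (1 : Sph d → ℝ) p.2.2 * (2 * U p * F p +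
      2 * a * inner ℝ γ (p.2.2 : Euc d) * U p ^ 2)) (phaseTimeMeasure Ω T) :=
      (h1.add h2).bdd_mul (c := 1) hAm.aestronglyMeasurable (Eventually.of_forall fun p => hA1 _)
    refine h3.mul_bdd (c := K) hwm.aestronglyMeasurable ?_
    filter_upwards [ae_mem_phaseTimeMeasure hΩ] with p hp
    rw [Real.norm_eq_abs, abs_of_pos (expWeight_pos _ _ _ _ _)]
    exact hK _ (Ioo_subset_Icc_self hp.1) _ (subset_closure hp.2)
  obtain ⟨hI, hE⟩ := integral_chord_average hΩ hb hc hH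
  have key : ∀ᵐ p ∂phaseTimeMeasure Ω T, (chordLength Ω p.2.1 p.2.2).toReal⁻¹ *
      (∫ r in chord Ω p.2.1 p.2.2, A.indicator (1 : Sph d → ℝ) p.2.2 *
        (2 * U (p.1, p.2.1 + r • (p.2.2 : Euc d), p.2.2) *
          F (p.1, p.2.1 + r • (p.2.2 : Euc d), p.2.2) +
        2 * a * inner ℝ γ (p.2.2 : Euc d) * U (p.1, p.2.1 + r • (p.2.2 : Euc d), p.2.2) ^ 2) *
          expWeight γ a b p.1 (p.2.1 + r • (p.2.2 : Euc d))) =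
      A.indicator (1 : Sph d → ℝ) p.2.2 * (chordLength Ω p.2.1 p.2.2).toReal⁻¹ *
      (∫ r in chord Ω p.2.1 p.2.2, F (p.1, p.2.1 + r • (p.2.2 : Euc d), p.2.2)) ^ 2 *
      expWeight γ a b p.1 (exitPoint Ω p.2.1 p.2.2) := by
    filter_upwards [ae_ray hΩ hb hray, ae_integrableOn_chord hΩ hb hFm hFi,
      ae_mem_phaseTimeMeasure hΩ] with p h1 h2 hp
    obtain ⟨t, x, v⟩ := p
    simp only at h1 h2 hp ⊢
    have hv := norm_eq_of_mem_sphere v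
    have hv' : ‖-(v : Euc d)‖ = 1 := by rwa [norm_neg]
    have t1 := exitTime_pos hΩ hb hc hp.2 hv
    have t2 := exitTime_pos hΩ hb hc hp.2 hv'
    have hch := chord_eq hΩ hb hc hp.2 hv
    set τ := exitTime Ω x v with hτ
    set θ := exitTime Ω x (-v) with hθ
    set φ : ℝ → ℝ := fun r => F (t, x + r • (v : Euc d), v) with hφ
    have hle : -θ ≤ τ := by linarith
    have hii : IntervalIntegrable φ volume (-θ) τ := by
      rw [intervalIntegrable_iff_integrableOn_Ioo_of_le hle, ← hch]
      exact h2
    set e : ℝ → ℝ := fun r => expWeight γ a b t (x + r • (v : Euc d)) with he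
    have hed : ∀ r, HasDerivAt e (2 * a * inner ℝ γ (v : Euc d) * e r) r := by
      intro r
      have d1 : HasDerivAt (fun r : ℝ => 2 * (a * inner ℝ γ (x + r • (v : Euc d)) - b * t))
          (2 * a * inner ℝ γ (v : Euc d)) r := by
        have d2 : HasDerivAt (fun r : ℝ => 2 * (a * (inner ℝ γ x + r * inner ℝ γ (v : Euc d))
            - b * t)) (2 * (a * (1 * inner ℝ γ (v : Euc d)))) r :=
          (((((hasDerivAt_id r).mul_const _).const_add _).const_mul a).sub_const _).const_mul 2
        have d3 : 2 * (a * (1 * inner ℝ γ (v : Euc d))) = 2 * a * inner ℝ γ (v : Euc d) := by ring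
        rw [d3] at d2
        simpa only [inner_add_right, inner_smul_right] using d2
      have := d1.exp
      rw [mul_comm (Real.exp _)] at this
      exact this
    have hec : ContDiff ℝ 1 e := by
      simp only [he, expWeight, inner_add_right, inner_smul_right]
      fun_prop
    -- Seen from the point of parameter `r`, the entry point is at distance θ + r, so all the ray
    -- formulas on a chord start at the same parameter −θ.
    have hU' : ∀ᵐ r : ℝ, r ∈ Ioo (-θ) τ →
        U (t, x + r • (v : Euc d), v) = ∫ s in (-θ)..r, φ s := by
      filter_upwards [h1] with r hr hrm
      have hrc : r ∈ chord Ω x v := hch ▸ hrm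
      rw [hr hrc]
      have h3 := integral_rayKernel_Iio hΩ hb hc (q := (x + r • (v : Euc d), v))
        (mem_chord.mp hrc) fun s => F (t, rayMap ((x + r • (v : Euc d), v), s))
      refine h3.trans ?_
      have h4 : exitTime Ω (x + r • (v : Euc d)) (-v) = θ + r := by
        have e1 : x + r • (v : Euc d) = x + (-r) • (-v : Euc d) := by module
        have e2 : x + (-r) • (-v : Euc d) ∈ Ω := e1 ▸ mem_chord.mp hrc
        rw [e1, exitTime_add_smul hΩ hb hc hp.2 e2 hv', sub_neg_eq_add]
      simp only [h4, rayMap_add]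
      have h5 := intervalIntegral.integral_comp_add_left (a := -(θ + r)) (b := 0) φ r
      rw [show r + -(θ + r) = -θ by ring, add_zero] at h5
      exact h5
    have hmain := integral_sq_mul_add hii 0 hec
    have hO : ∫ r in chord Ω x v, φ r = ∫ r in (-θ)..τ, φ r := by
      rw [hch, intervalIntegral.integral_of_le hle, integral_Ioc_eq_integral_Ioo]
    have hL : ∫ r in chord Ω x v, A.indicator (1 : Sph d → ℝ) v *
        (2 * U (t, x + r • (v : Euc d), v) * φ r +
        2 * a * inner ℝ γ (v : Euc d) * U (t, x + r • (v : Euc d), v) ^ 2) * e r =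
        A.indicator (1 : Sph d → ℝ) v * ((∫ r in (-θ)..τ, φ r) ^ 2 * e τ) := by
      have h6 : ∫ r in (-θ)..τ, (2 * (0 + ∫ r in (-θ)..r, φ r) * φ r * e r +
          (0 + ∫ r in (-θ)..r, φ r) ^ 2 * deriv e r) = (∫ r in (-θ)..τ, φ r) ^ 2 * e τ := by
        rw [hmain]; ring
      rw [← h6, hch, intervalIntegral.integral_of_le hle, integral_Ioc_eq_integral_Ioo,
        ← integral_const_mul]
      refine setIntegral_congr_ae measurableSet_Ioo ?_
      filter_upwards [hU'] with r hr hrm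
      rw [hr hrm, (hed r).deriv]
      ring
    rw [hO]
    refine (congrArg _ hL).trans ?_
    simp only [he, exitPoint, ← hτ]
    ring
  exact ⟨hH, hI.congr key, hE.trans (integral_congr_ae key)⟩

section TimeEnergy
variable {α : Type*} [MeasurableSpace α] {P : Measure α} [SFinite P] {T : ℝ}

/-- The counterpart in time, where both end values survive. The bounded factor B will carry the
velocity cut-off and the spatial part of the weight. -/
theorem integral_time_energy (hT : 0 < T) {U W : ℝ × α → ℝ} {u₀ B : α → ℝ}
    (hU : MemLp U 2 ((volume.restrict (Ioo 0 T)).prod P))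
    (hW : MemLp W 2 ((volume.restrict (Ioo 0 T)).prod P))
    (hWi : Integrable W ((volume.restrict (Ioo 0 T)).prod P))
    (hrep : ∀ᵐ p ∂(volume.restrict (Ioo 0 T)).prod P,
      U p = u₀ p.2 + ∫ r in (0 : ℝ)..p.1, W (r, p.2))
    (hBm : AEStronglyMeasurable B P) {K : ℝ} (hB : ∀ᵐ q ∂P, ‖B q‖ ≤ K) {e : ℝ → ℝ}
    (he : ContDiff ℝ 1 e) :
    Integrable (fun p => B p.2 * (2 * U p * W p * e p.1 + U p ^ 2 * deriv e p.1))
      ((volume.restrict (Ioo 0 T)).prod P) ∧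
    Integrable (fun q => B q * ((u₀ q + ∫ r in (0 : ℝ)..T, W (r, q)) ^ 2 * e T -
      u₀ q ^ 2 * e 0)) P ∧
    ∫ p, B p.2 * (2 * U p * W p * e p.1 + U p ^ 2 * deriv e p.1)
      ∂(volume.restrict (Ioo 0 T)).prod P =
    ∫ q, B q * ((u₀ q + ∫ r in (0 : ℝ)..T, W (r, q)) ^ 2 * e T - u₀ q ^ 2 * e 0) ∂P := by
  obtain ⟨E, hE⟩ := isCompact_Icc.exists_bound_of_continuousOn (s := Icc 0 T)
    he.continuous.continuousOn
  have hdc : Continuous (deriv e) := he.continuous_deriv le_rfl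
  obtain ⟨E', hE'⟩ := isCompact_Icc.exists_bound_of_continuousOn (s := Icc 0 T) hdc.continuousOn
  have hH : Integrable (fun p => B p.2 * (2 * U p * W p * e p.1 + U p ^ 2 * deriv e p.1))
      ((volume.restrict (Ioo 0 T)).prod P) := by
    have h1 : Integrable (fun p => 2 * U p * W p) ((volume.restrict (Ioo 0 T)).prod P) := by
      have := (hU.integrable_mul hW).const_mul 2
      refine this.congr (Eventually.of_forall fun p => ?_)
      simp only [Pi.mul_apply]; ring
    have h2 : Integrable (fun p => 2 * U p * W p * e p.1)
        ((volume.restrict (Ioo 0 T)).prod P) := by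
      refine h1.mul_bdd (c := E)
        (he.continuous.measurable.comp measurable_fst).aestronglyMeasurable ?_
      filter_upwards [ae_fst_mem_Ioo] with p hp
      exact hE _ (Ioo_subset_Icc_self hp)
    have h3 : Integrable (fun p => U p ^ 2 * deriv e p.1)
        ((volume.restrict (Ioo 0 T)).prod P) := by
      refine hU.integrable_sq.mul_bdd (c := E')
        (hdc.measurable.comp measurable_fst).aestronglyMeasurable ?_
      filter_upwards [ae_fst_mem_Ioo] with p hp
      exact hE' _ (Ioo_subset_Icc_self hp)
    exact (h2.add h3).bdd_mul (c := K)
      (hBm.comp_quasiMeasurePreserving Measure.quasiMeasurePreserving_snd)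
      (Measure.quasiMeasurePreserving_snd.ae hB)
  have key : ∀ᵐ q ∂P, ∫ t in Ioo 0 T, B q * (2 * U (t, q) * W (t, q) * e t +
      U (t, q) ^ 2 * deriv e t) =
      B q * ((u₀ q + ∫ r in (0 : ℝ)..T, W (r, q)) ^ 2 * e T - u₀ q ^ 2 * e 0) := by
    filter_upwards [ae_ae_of_ae_prod_swap hrep, ae_integrableOn_time hWi] with q h1 h2
    have hii : IntervalIntegrable (fun r => W (r, q)) volume 0 T := by
      rwa [intervalIntegrable_iff_integrableOn_Ioo_of_le hT.le]
    rw [← integral_sq_mul_add hii (u₀ q) he, integral_const_mul,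
      intervalIntegral.integral_of_le hT.le, integral_Ioc_eq_integral_Ioo]
    congr 1
    refine integral_congr_ae ?_
    filter_upwards [h1] with t ht
    simp only [ht]
  exact ⟨hH, hH.integral_prod_right.congr key,
    (integral_prod_symm _ hH).trans (integral_congr_ae key)⟩

theorem integrable_sq_endpoints (hT : 0 < T) {U W : ℝ × α → ℝ} {u₀ : α → ℝ}
    (hU : MemLp U 2 ((volume.restrict (Ioo 0 T)).prod P))
    (hW : MemLp W 2 ((volume.restrict (Ioo 0 T)).prod P))
    (hWi : Integrable W ((volume.restrict (Ioo 0 T)).prod P))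
    (hrep : ∀ᵐ p ∂(volume.restrict (Ioo 0 T)).prod P,
      U p = u₀ p.2 + ∫ r in (0 : ℝ)..p.1, W (r, p.2)) :
    Integrable (fun q => u₀ q ^ 2) P ∧
      Integrable (fun q => (u₀ q + ∫ r in (0 : ℝ)..T, W (r, q)) ^ 2) P := by
  -- The multipliers t and T − t each vanish at one end, so each isolates the square of the other
  -- end value and proves it integrable.
  have h1 := (integral_time_energy hT hU hW hWi hrep (B := fun _ => (1 : ℝ)) (K := 1)
    aestronglyMeasurable_const (Eventually.of_forall fun _ => by simp)
    (e := fun t => t) contDiff_id).2.1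
  have h2 := (integral_time_energy hT hU hW hWi hrep (B := fun _ => (1 : ℝ)) (K := 1)
    aestronglyMeasurable_const (Eventually.of_forall fun _ => by simp)
    (e := fun t => T - t) (contDiff_const.sub contDiff_id)).2.1
  constructor
  · refine (h2.const_mul (-T⁻¹)).congr (Eventually.of_forall fun q => ?_)
    simp only
    field_simp
    ring
  · refine (h1.const_mul T⁻¹).congr (Eventually.of_forall fun q => ?_)
    simp only
    field_simp
    ring

end TimeEnergy

end

section

variable {d : ℕ}

theorem sq_integral_le {α : Type*} [MeasurableSpace α] {P : Measure α} [IsProbabilityMeasure P]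
    {g : α → ℝ} (hg : Integrable g P) (hg2 : Integrable (fun x => g x ^ 2) P) :
    (∫ x, g x ∂P) ^ 2 ≤ ∫ x, g x ^ 2 ∂P := by
  set c := ∫ x, g x ∂P with hc
  have h1 : 0 ≤ ∫ x, (g x - c) ^ 2 ∂P := integral_nonneg fun x => sq_nonneg _
  have h2 : ∫ x, (g x - c) ^ 2 ∂P = ∫ x, g x ^ 2 ∂P - c ^ 2 := by
    have e1 : ∀ x, (g x - c) ^ 2 = (g x ^ 2 - 2 * c * g x) + c ^ 2 := fun x => by ring
    simp_rw [e1]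
    have i1 : Integrable (fun x => 2 * c * g x) P := hg.const_mul _
    have i2 : Integrable (fun x => g x ^ 2 - 2 * c * g x) P := hg2.sub i1
    rw [integral_add i2 (integrable_const _), integral_sub hg2 i1, integral_const_mul,
      integral_const, ← hc]
    simp
    ring
  linarith

variable [IsProbabilityMeasure (sphereMeasure d)]

/-! ### Estimates of the scattering operator -/

theorem integrable_velocityAverage {Ω : Set (Euc d)} {g : Euc d × Sph d → ℝ}
    (hgm : StronglyMeasurable g) (hg : Integrable g (phaseMeasure Ω)) :
    Integrable (fun q : Euc d × Sph d => ∫ v', g (q.1, v') ∂sphereMeasure d) (phaseMeasure Ω) := by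
  have hK := isBoundedKernel_scattering Ω (μ := fun _ => (1 : ℝ)) measurable_const (m := 1)
    (fun r => by simp)
  have := hK.integrable_kernelOp hgm hg
  refine this.congr (Eventually.of_forall fun q => ?_)
  simp only [kernelOp, one_mul]

theorem integral_velocityAverage {Ω : Set (Euc d)} {g : Euc d × Sph d → ℝ}
    (hgm : StronglyMeasurable g) (hg : Integrable g (phaseMeasure Ω)) :
    ∫ q : Euc d × Sph d, (∫ v', g (q.1, v') ∂sphereMeasure d) ∂phaseMeasure Ω =
      ∫ q, g q ∂phaseMeasure Ω := by
  have h1 := integrable_velocityAverage hgm hg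
  rw [phaseMeasure] at h1 hg ⊢
  rw [integral_prod _ h1, integral_prod _ hg]
  simp

theorem ae_sq_scattering_le {Ω : Set (Euc d)} {μ : Euc d × Sph d × Sph d → ℝ}
    (hμm : StronglyMeasurable μ) {m : ℝ} (hμ : ∀ r, |μ r| ≤ m) {g : Euc d × Sph d → ℝ}
    (hgm : StronglyMeasurable g) (hg : Integrable g (phaseMeasure Ω))
    (hg2 : Integrable (fun q => g q ^ 2) (phaseMeasure Ω)) :
    ∀ᵐ q ∂phaseMeasure Ω, (∫ v', μ (q.1, v', q.2) * g (q.1, v') ∂sphereMeasure d) ^ 2 ≤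
      m ^ 2 * ∫ v', g (q.1, v') ^ 2 ∂sphereMeasure d := by
  have hK := isBoundedKernel_scattering Ω (μ := fun _ => (1 : ℝ)) measurable_const (m := 1)
    (fun r => by simp)
  filter_upwards [hK.ae_integrable hgm hg, hK.ae_integrable (hgm.pow 2) hg2] with q h1 h2
  simp only [one_mul, Pi.pow_apply] at h1 h2
  have hm : StronglyMeasurable fun v' : Sph d => μ (q.1, v', q.2) :=
    hμm.comp_measurable (by fun_prop)
  have h3 : Integrable (fun v' => μ (q.1, v', q.2) * g (q.1, v')) (sphereMeasure d) :=
    h1.bdd_mul (c := m) hm.aestronglyMeasurable (Eventually.of_forall fun v' => hμ _)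
  have hle : ∀ v', (μ (q.1, v', q.2) * g (q.1, v')) ^ 2 ≤ m ^ 2 * g (q.1, v') ^ 2 := fun v' => by
    rw [mul_pow]
    refine mul_le_mul_of_nonneg_right ?_ (sq_nonneg _)
    rw [← sq_abs]
    exact pow_le_pow_left₀ (abs_nonneg _) (hμ _) 2
  have h4 : Integrable (fun v' => (μ (q.1, v', q.2) * g (q.1, v')) ^ 2) (sphereMeasure d) := by
    refine (h2.const_mul (m ^ 2)).mono' (h3.aestronglyMeasurable.pow 2)
      (Eventually.of_forall fun v' => ?_)
    rw [Real.norm_eq_abs, abs_of_nonneg (sq_nonneg _)]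
    exact hle v'
  refine (sq_integral_le h3 h4).trans ?_
  rw [← integral_const_mul]
  exact integral_mono h4 (h2.const_mul _) hle

/-- A weight depending on x alone commutes with averages over velocities, and Jensen's inequality
for the probability measure on the sphere gives the factor m². -/
theorem integral_sq_scattering_le {Ω : Set (Euc d)} {μ : Euc d × Sph d × Sph d → ℝ}
    (hμm : StronglyMeasurable μ) {m : ℝ} (hμ : ∀ r, |μ r| ≤ m) {g : Euc d × Sph d → ℝ}
    (hgm : StronglyMeasurable g) (hg : Integrable g (phaseMeasure Ω))
    (hg2 : Integrable (fun q => g q ^ 2) (phaseMeasure Ω)) {ρ : Euc d → ℝ} (hρm : Measurable ρ)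
    (hρ0 : ∀ x, 0 ≤ ρ x) {K : ℝ} (hρK : ∀ x ∈ Ω, ρ x ≤ K) (hΩ : IsOpen Ω) :
    Integrable (fun q => (∫ v', μ (q.1, v', q.2) * g (q.1, v') ∂sphereMeasure d) ^ 2 * ρ q.1)
      (phaseMeasure Ω) ∧
    ∫ q, (∫ v', μ (q.1, v', q.2) * g (q.1, v') ∂sphereMeasure d) ^ 2 * ρ q.1 ∂phaseMeasure Ω ≤
      m ^ 2 * ∫ q, g q ^ 2 * ρ q.1 ∂phaseMeasure Ω := by
  have hK := isBoundedKernel_scattering Ω hμm.measurable hμ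
  have hKm : StronglyMeasurable fun q : Euc d × Sph d =>
      ∫ v', μ (q.1, v', q.2) * g (q.1, v') ∂sphereMeasure d := hK.stronglyMeasurable_kernelOp hgm
  have hρm' : Measurable fun q : Euc d × Sph d => ρ q.1 := hρm.comp measurable_fst
  have hG : Integrable (fun q => g q ^ 2 * ρ q.1) (phaseMeasure Ω) := by
    refine hg2.mul_bdd (c := K) hρm'.aestronglyMeasurable ?_
    filter_upwards [ae_fst_mem hΩ] with q hq
    rw [Real.norm_eq_abs, abs_of_nonneg (hρ0 _)]
    exact hρK _ hq
  have hGm : StronglyMeasurable fun q : Euc d × Sph d => g q ^ 2 * ρ q.1 :=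
    (hgm.pow 2).mul hρm'.stronglyMeasurable
  have hle : ∀ᵐ q ∂phaseMeasure Ω,
      (∫ v', μ (q.1, v', q.2) * g (q.1, v') ∂sphereMeasure d) ^ 2 * ρ q.1 ≤
        m ^ 2 * ∫ v', g (q.1, v') ^ 2 * ρ q.1 ∂sphereMeasure d := by
    filter_upwards [ae_sq_scattering_le hμm hμ hgm hg hg2] with q hq
    rw [integral_mul_const, ← mul_assoc]
    exact mul_le_mul_of_nonneg_right hq (hρ0 _)
  have hav := integrable_velocityAverage hGm hG
  have hI : Integrable (fun q => (∫ v', μ (q.1, v', q.2) * g (q.1, v') ∂sphereMeasure d) ^ 2 *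
      ρ q.1) (phaseMeasure Ω) := by
    refine (hav.const_mul (m ^ 2)).mono'
      ((hKm.pow 2).mul hρm'.stronglyMeasurable).aestronglyMeasurable ?_
    filter_upwards [hle] with q hq
    rw [Real.norm_eq_abs, abs_of_nonneg (mul_nonneg (sq_nonneg _) (hρ0 _))]
    exact hq
  refine ⟨hI, (integral_mono_ae hI (hav.const_mul _) hle).trans ?_⟩
  rw [integral_const_mul, integral_velocityAverage hGm hG]

theorem integral_sq_scattering_le_time {Ω : Set (Euc d)} (hΩ : IsOpen Ω)
    (hb : Bornology.IsBounded Ω) {T : ℝ} {μ : Euc d × Sph d × Sph d → ℝ}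
    (hμm : StronglyMeasurable μ) {m : ℝ} (hμ : ∀ r, |μ r| ≤ m) {U : ℝ × Euc d × Sph d → ℝ}
    (hUm : StronglyMeasurable U) (hU : MemLp U 2 (phaseTimeMeasure Ω T)) (γ : Euc d) (a b : ℝ) :
    Integrable (fun p => scattering μ U p ^ 2 * expWeight γ a b p.1 p.2.1)
      (phaseTimeMeasure Ω T) ∧
    ∫ p, scattering μ U p ^ 2 * expWeight γ a b p.1 p.2.1 ∂phaseTimeMeasure Ω T ≤
      m ^ 2 * ∫ p, U p ^ 2 * expWeight γ a b p.1 p.2.1 ∂phaseTimeMeasure Ω T := by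
  have hfin := isFiniteMeasure_phaseTimeMeasure hb T
  obtain ⟨K, hK⟩ := exists_expWeight_le hb γ a b T
  have hKer := (isBoundedKernel_scattering Ω hμm.measurable hμ).time T
  have hSm : StronglyMeasurable (scattering μ U) := hKer.stronglyMeasurable_kernelOp hUm
  have hwm := continuous_expWeight (d := d) γ a b
  have hU1 := hU.integrable one_le_two
  have hU2 := hU.integrable_sq
  have hG : Integrable (fun p => U p ^ 2 * expWeight γ a b p.1 p.2.1) (phaseTimeMeasure Ω T) := by
    refine hU2.mul_bdd (c := K) hwm.aestronglyMeasurable ?_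
    filter_upwards [ae_mem_phaseTimeMeasure hΩ] with p hp
    rw [Real.norm_eq_abs, abs_of_pos (expWeight_pos _ _ _ _ _)]
    exact hK _ (Ioo_subset_Icc_self hp.1) _ (subset_closure hp.2)
  have hslice : ∀ᵐ t ∂volume.restrict (Ioo 0 T),
      Integrable (fun q => scattering μ U (t, q) ^ 2 * expWeight γ a b t q.1) (phaseMeasure Ω) ∧
      ∫ q, scattering μ U (t, q) ^ 2 * expWeight γ a b t q.1 ∂phaseMeasure Ω ≤
      m ^ 2 * ∫ q, U (t, q) ^ 2 * expWeight γ a b t q.1 ∂phaseMeasure Ω := by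
    filter_upwards [hU1.prod_right_ae, hU2.prod_right_ae, ae_restrict_mem measurableSet_Ioo]
      with t h1 h2 ht
    have hm : StronglyMeasurable fun q => U (t, q) :=
      hUm.comp_measurable measurable_prodMk_left
    have hw : Measurable fun x => expWeight γ a b t x := by
      unfold expWeight
      fun_prop
    exact integral_sq_scattering_le hμm hμ hm h1 h2 hw (fun x => (expWeight_pos _ _ _ _ _).le)
      (fun x hx => hK t (Ioo_subset_Icc_self ht) x (subset_closure hx)) hΩ
  have hM : StronglyMeasurable fun p => scattering μ U p ^ 2 * expWeight γ a b p.1 p.2.1 :=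
    (hSm.pow 2).mul hwm.stronglyMeasurable
  have hGt : Integrable (fun t => ∫ q, U (t, q) ^ 2 * expWeight γ a b t q.1 ∂phaseMeasure Ω)
      (volume.restrict (Ioo 0 T)) := hG.integral_prod_left
  have hSt : Integrable (fun t => ∫ q, scattering μ U (t, q) ^ 2 * expWeight γ a b t q.1
      ∂phaseMeasure Ω) (volume.restrict (Ioo 0 T)) := by
    refine (hGt.const_mul (m ^ 2)).mono' hM.integral_prod_right'.aestronglyMeasurable ?_
    filter_upwards [hslice] with t ht
    rw [Real.norm_eq_abs, abs_of_nonneg (integral_nonneg fun q =>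
      mul_nonneg (sq_nonneg _) (expWeight_pos _ _ _ _ _).le)]
    exact ht.2
  have hI : Integrable (fun p => scattering μ U p ^ 2 * expWeight γ a b p.1 p.2.1)
      (phaseTimeMeasure Ω T) := by
    refine (integrable_prod_iff hM.aestronglyMeasurable).mpr ⟨hslice.mono fun t ht => ht.1, ?_⟩
    refine hSt.congr (Eventually.of_forall fun t => integral_congr_ae
      (Eventually.of_forall fun q => ?_))
    simp only
    rw [Real.norm_eq_abs, abs_of_nonneg (mul_nonneg (sq_nonneg _) (expWeight_pos _ _ _ _ _).le)]
  refine ⟨hI, ?_⟩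
  have e1 := integral_prod _ hI
  have e2 := integral_prod _ hG
  refine e1.le.trans (le_trans ?_ (congrArg (m ^ 2 * ·) e2).ge)
  simp only
  rw [← integral_const_mul]
  exact integral_mono_ae hSt (hGt.const_mul _) (hslice.mono fun t ht => ht.2)

/-! ### The energy identity -/

/-- The final value of the solution of the derived problem. -/
def finalValue (T : ℝ) (u₀ : Euc d × Sph d → ℝ) (W : ℝ × Euc d × Sph d → ℝ) (q : Euc d × Sph d) :
    ℝ :=
  u₀ q + ∫ r in (0 : ℝ)..T, W (r, q)

/-- The flow through the outgoing boundary, as an integral over the phase space. -/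
def outflow (Ω : Set (Euc d)) (T : ℝ) (F : ℝ × Euc d × Sph d → ℝ) (γ : Euc d) (a b : ℝ)
    (A : Set (Sph d)) : ℝ :=
  ∫ p, A.indicator (1 : Sph d → ℝ) p.2.2 * (chordLength Ω p.2.1 p.2.2).toReal⁻¹ *
      (∫ r in chord Ω p.2.1 p.2.2, F (p.1, p.2.1 + r • (p.2.2 : Euc d), p.2.2)) ^ 2 *
      expWeight γ a b p.1 (exitPoint Ω p.2.1 p.2.2) ∂phaseTimeMeasure Ω T

theorem indicator_one_nonneg {α : Type*} (A : Set α) (v : α) :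
    0 ≤ A.indicator (1 : α → ℝ) v := indicator_nonneg (fun _ _ => zero_le_one) v

theorem indicator_one_le {α : Type*} (A : Set α) (v : α) :
    A.indicator (1 : α → ℝ) v ≤ 1 := indicator_le_self' (fun _ _ => zero_le_one) v

theorem norm_indicator_one_le {α : Type*} (A : Set α) (v : α) :
    ‖A.indicator (1 : α → ℝ) v‖ ≤ 1 := by
  rw [Real.norm_eq_abs, abs_of_nonneg (indicator_one_nonneg A v)]
  exact indicator_one_le A v

theorem outflow_nonneg (Ω : Set (Euc d)) (T : ℝ) (F : ℝ × Euc d × Sph d → ℝ) (γ : Euc d)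
    (a b : ℝ) (A : Set (Sph d)) : 0 ≤ outflow Ω T F γ a b A :=
  integral_nonneg fun p => mul_nonneg (mul_nonneg (mul_nonneg (indicator_one_nonneg A _)
    (by positivity)) (sq_nonneg _)) (expWeight_pos _ _ _ _ _).le

theorem integrable_cutoff_phase {Ω : Set (Euc d)} (hΩ : IsOpen Ω) (hb : Bornology.IsBounded Ω)
    {T : ℝ} {t : ℝ} (ht : t ∈ Icc 0 T) {g : Euc d × Sph d → ℝ} (hg : Integrable g (phaseMeasure Ω))
    (γ : Euc d) (a b : ℝ) {A : Set (Sph d)} (hA : MeasurableSet A) :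
    Integrable (fun q => A.indicator (1 : Sph d → ℝ) q.2 * g q * expWeight γ a b t q.1)
      (phaseMeasure Ω) := by
  obtain ⟨K, hK⟩ := exists_expWeight_le hb γ a b T
  have hAm : Measurable fun q : Euc d × Sph d => A.indicator (1 : Sph d → ℝ) q.2 :=
    (measurable_one.indicator hA).comp measurable_snd
  have hwm : Measurable fun q : Euc d × Sph d => expWeight γ a b t q.1 := by
    unfold expWeight
    fun_prop
  refine (hg.bdd_mul (c := 1) hAm.aestronglyMeasurable
    (Eventually.of_forall fun q => norm_indicator_one_le A _)).mul_bdd (c := K)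
      hwm.aestronglyMeasurable ?_
  filter_upwards [ae_fst_mem hΩ] with q hq
  rw [Real.norm_eq_abs, abs_of_pos (expWeight_pos _ _ _ _ _)]
  exact hK _ ht _ (subset_closure hq)

theorem integrable_cutoff_time {Ω : Set (Euc d)} (hΩ : IsOpen Ω) (hb : Bornology.IsBounded Ω)
    {T : ℝ} {g : ℝ × Euc d × Sph d → ℝ} (hg : Integrable g (phaseTimeMeasure Ω T))
    (γ : Euc d) (a b : ℝ) {A : Set (Sph d)} (hA : MeasurableSet A) :
    Integrable (fun p => A.indicator (1 : Sph d → ℝ) p.2.2 * g p * expWeight γ a b p.1 p.2.1)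
      (phaseTimeMeasure Ω T) := by
  obtain ⟨K, hK⟩ := exists_expWeight_le hb γ a b T
  have hAm : Measurable fun p : ℝ × Euc d × Sph d => A.indicator (1 : Sph d → ℝ) p.2.2 :=
    (measurable_one.indicator hA).comp (by fun_prop)
  refine (hg.bdd_mul (c := 1) hAm.aestronglyMeasurable
    (Eventually.of_forall fun q => norm_indicator_one_le A _)).mul_bdd (c := K)
      (continuous_expWeight γ a b).aestronglyMeasurable ?_
  filter_upwards [ae_mem_phaseTimeMeasure hΩ] with p hp
  rw [Real.norm_eq_abs, abs_of_pos (expWeight_pos _ _ _ _ _)]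
  exact hK _ (Ioo_subset_Icc_self hp.1) _ (subset_closure hp.2)

/-- The weight is a function of x times an exponential in t, so the identity on chords and the
identity in time are applied separately and added. Characteristics in space-time never appear. -/
theorem IsDerivedSolution.energy_identity {Ω : Set (Euc d)} (hΩ : IsOpen Ω)
    (hb : Bornology.IsBounded Ω) (hc : Convex ℝ Ω) {T : ℝ} (hT : 0 < T)
    {σ Stil S₀init f₀ Xf₀ u₀ : Euc d × Sph d → ℝ} {μ : Euc d × Sph d × Sph d → ℝ}
    {S₀t U W F : ℝ × Euc d × Sph d → ℝ}
    (h : IsDerivedSolution Ω T σ μ Stil S₀init f₀ Xf₀ S₀t u₀ U W F) (γ : Euc d) (a b : ℝ)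
    {A : Set (Sph d)} (hA : MeasurableSet A) :
    Integrable (fun p => A.indicator (1 : Sph d → ℝ) p.2.2 * (2 * U p * (W p + F p) +
      2 * (a * inner ℝ γ (p.2.2 : Euc d) - b) * U p ^ 2) * expWeight γ a b p.1 p.2.1)
      (phaseTimeMeasure Ω T) ∧
    ∫ p, A.indicator (1 : Sph d → ℝ) p.2.2 * (2 * U p * (W p + F p) +
      2 * (a * inner ℝ γ (p.2.2 : Euc d) - b) * U p ^ 2) * expWeight γ a b p.1 p.2.1
      ∂phaseTimeMeasure Ω T =
    ∫ q, A.indicator (1 : Sph d → ℝ) q.2 * finalValue T u₀ W q ^ 2 * expWeight γ a b T q.1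
      ∂phaseMeasure Ω -
    ∫ q, A.indicator (1 : Sph d → ℝ) q.2 * u₀ q ^ 2 * expWeight γ a b 0 q.1 ∂phaseMeasure Ω +
    outflow Ω T F γ a b A := by
  have hfin := isFiniteMeasure_phaseTimeMeasure hb T
  have hWi : Integrable W (phaseTimeMeasure Ω T) := h.memLp_W.integrable one_le_two
  obtain ⟨s1, -, s3⟩ := integral_transport_energy hΩ hb hc h.meas_F h.memLp_U h.memLp_F h.eq_ray
    γ a b hA
  obtain ⟨K, hK⟩ := exists_expWeight_le hb γ a 0 T
  have hBm : Measurable fun q : Euc d × Sph d =>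
      A.indicator (1 : Sph d → ℝ) q.2 * expWeight γ a 0 0 q.1 := by
    have h1 : Measurable fun q : Euc d × Sph d => A.indicator (1 : Sph d → ℝ) q.2 :=
      (measurable_one.indicator hA).comp measurable_snd
    have h2 : Measurable fun q : Euc d × Sph d => expWeight γ a 0 0 q.1 := by
      unfold expWeight
      fun_prop
    exact h1.mul h2
  have hB : ∀ᵐ q ∂phaseMeasure Ω,
      ‖A.indicator (1 : Sph d → ℝ) q.2 * expWeight γ a 0 0 q.1‖ ≤ 1 * K := by
    filter_upwards [ae_fst_mem hΩ] with q hq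
    rw [norm_mul]
    refine mul_le_mul (norm_indicator_one_le A _) ?_ (norm_nonneg _) zero_le_one
    rw [Real.norm_eq_abs, abs_of_pos (expWeight_pos _ _ _ _ _)]
    exact hK _ ⟨le_rfl, hT.le⟩ _ (subset_closure hq)
  have hed : ∀ t, HasDerivAt (fun t : ℝ => Real.exp (-2 * b * t))
      (Real.exp (-2 * b * t) * (-2 * b * 1)) t := fun t =>
    ((hasDerivAt_id t).const_mul (-2 * b)).exp
  have hsplit : ∀ t x, expWeight γ a 0 0 x * Real.exp (-2 * b * t) = expWeight γ a b t x := by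
    intro t x
    rw [expWeight, expWeight, ← Real.exp_add]
    congr 1
    ring
  obtain ⟨t1, -, t3⟩ := integral_time_energy hT h.memLp_U h.memLp_W hWi h.eq_time
    hBm.aestronglyMeasurable hB (e := fun t => Real.exp (-2 * b * t)) (by fun_prop)
  obtain ⟨z1, z2⟩ := integrable_sq_endpoints hT h.memLp_U h.memLp_W hWi h.eq_time
  have z2 : Integrable (fun q => finalValue T u₀ W q ^ 2) (phaseMeasure Ω) := z2
  have hsum : ∀ p : ℝ × Euc d × Sph d,
      A.indicator (1 : Sph d → ℝ) p.2.2 * (2 * U p * (W p + F p) +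
        2 * (a * inner ℝ γ (p.2.2 : Euc d) - b) * U p ^ 2) * expWeight γ a b p.1 p.2.1 =
      A.indicator (1 : Sph d → ℝ) p.2.2 * expWeight γ a 0 0 p.2.1 *
        (2 * U p * W p * Real.exp (-2 * b * p.1) +
          U p ^ 2 * deriv (fun t => Real.exp (-2 * b * t)) p.1) +
      A.indicator (1 : Sph d → ℝ) p.2.2 * (2 * U p * F p +
        2 * a * inner ℝ γ (p.2.2 : Euc d) * U p ^ 2) * expWeight γ a b p.1 p.2.1 := by
    intro p
    rw [(hed p.1).deriv, ← hsplit]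
    ring
  simp_rw [hsum]
  refine ⟨t1.add s1, ?_⟩
  have e1 := integral_add t1 s1
  refine e1.trans ?_
  have e2 : ∀ q : Euc d × Sph d, A.indicator (1 : Sph d → ℝ) q.2 * expWeight γ a 0 0 q.1 *
      ((u₀ q + ∫ r in (0 : ℝ)..T, W (r, q)) ^ 2 * Real.exp (-2 * b * T) -
        u₀ q ^ 2 * Real.exp (-2 * b * 0)) =
      A.indicator (1 : Sph d → ℝ) q.2 * finalValue T u₀ W q ^ 2 * expWeight γ a b T q.1 -
      A.indicator (1 : Sph d → ℝ) q.2 * u₀ q ^ 2 * expWeight γ a b 0 q.1 := by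
    intro q
    rw [← hsplit T, ← hsplit 0, finalValue]
    ring
  simp_rw [e2] at t3
  rw [integral_sub (integrable_cutoff_phase hΩ hb (right_mem_Icc.mpr hT.le) z2 γ a b hA)
    (integrable_cutoff_phase hΩ hb (left_mem_Icc.mpr hT.le) z1 γ a b hA)] at t3
  exact congrArg₂ (· + ·) t3 s3

end

section

variable {d : ℕ} [IsProbabilityMeasure (sphereMeasure d)]

/-! ### Weighted energies -/

/-- The integral of `g w` over the times and the velocities in `A`. -/
def timeEnergy (Ω : Set (Euc d)) (T : ℝ) (γ : Euc d) (a b : ℝ) (A : Set (Sph d))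
    (g : ℝ × Euc d × Sph d → ℝ) : ℝ :=
  ∫ p, A.indicator (1 : Sph d → ℝ) p.2.2 * g p * expWeight γ a b p.1 p.2.1 ∂phaseTimeMeasure Ω T

/-- The integral of `g w` at time `t` over the velocities in `A`. -/
def phaseEnergy (Ω : Set (Euc d)) (γ : Euc d) (a b t : ℝ) (A : Set (Sph d))
    (g : Euc d × Sph d → ℝ) : ℝ :=
  ∫ q, A.indicator (1 : Sph d → ℝ) q.2 * g q * expWeight γ a b t q.1 ∂phaseMeasure Ω

theorem timeEnergy_nonneg {Ω : Set (Euc d)} {T : ℝ} {γ : Euc d} {a b : ℝ} {A : Set (Sph d)}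
    {g : ℝ × Euc d × Sph d → ℝ} (hg : ∀ p, 0 ≤ g p) : 0 ≤ timeEnergy Ω T γ a b A g :=
  integral_nonneg fun p => mul_nonneg (mul_nonneg (indicator_one_nonneg A _) (hg p))
    (expWeight_pos _ _ _ _ _).le

theorem phaseEnergy_nonneg {Ω : Set (Euc d)} {γ : Euc d} {a b t : ℝ} {A : Set (Sph d)}
    {g : Euc d × Sph d → ℝ} (hg : ∀ p, 0 ≤ g p) : 0 ≤ phaseEnergy Ω γ a b t A g :=
  integral_nonneg fun p => mul_nonneg (mul_nonneg (indicator_one_nonneg A _) (hg p))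
    (expWeight_pos _ _ _ _ _).le

theorem timeEnergy_mono {Ω : Set (Euc d)} (hΩ : IsOpen Ω) (hb : Bornology.IsBounded Ω) {T : ℝ}
    {γ : Euc d} {a b : ℝ} {A : Set (Sph d)} (hA : MeasurableSet A) {f g : ℝ × Euc d × Sph d → ℝ}
    (hf : Integrable (fun p => A.indicator (1 : Sph d → ℝ) p.2.2 * f p *
      expWeight γ a b p.1 p.2.1) (phaseTimeMeasure Ω T))
    (hg : Integrable g (phaseTimeMeasure Ω T))
    (h : ∀ᵐ p ∂phaseTimeMeasure Ω T, p.2.2 ∈ A → f p ≤ g p) :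
    timeEnergy Ω T γ a b A f ≤ timeEnergy Ω T γ a b A g := by
  refine integral_mono_ae hf (integrable_cutoff_time hΩ hb hg γ a b hA) ?_
  filter_upwards [h] with p hp
  by_cases hpA : p.2.2 ∈ A
  · simp only [indicator_of_mem hpA, Pi.one_apply, one_mul]
    exact mul_le_mul_of_nonneg_right (hp hpA) (expWeight_pos _ _ _ _ _).le
  · simp only [indicator_of_notMem hpA, zero_mul, le_refl]

/-- The integrand of the energy identity is known to be integrable only together with its cut-off
and weight. It is on the larger side here, and on the smaller side in `timeEnergy_mono`. -/
theorem timeEnergy_mono_left {Ω : Set (Euc d)} (hΩ : IsOpen Ω) (hb : Bornology.IsBounded Ω) {T : ℝ}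
    {γ : Euc d} {a b : ℝ} {A : Set (Sph d)} (hA : MeasurableSet A) {f g : ℝ × Euc d × Sph d → ℝ}
    (hf : Integrable f (phaseTimeMeasure Ω T))
    (hg : Integrable (fun p => A.indicator (1 : Sph d → ℝ) p.2.2 * g p *
      expWeight γ a b p.1 p.2.1) (phaseTimeMeasure Ω T))
    (h : ∀ᵐ p ∂phaseTimeMeasure Ω T, p.2.2 ∈ A → f p ≤ g p) :
    timeEnergy Ω T γ a b A f ≤ timeEnergy Ω T γ a b A g := by
  refine integral_mono_ae (integrable_cutoff_time hΩ hb hf γ a b hA) hg ?_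
  filter_upwards [h] with p hp
  by_cases hpA : p.2.2 ∈ A
  · simp only [indicator_of_mem hpA, Pi.one_apply, one_mul]
    exact mul_le_mul_of_nonneg_right (hp hpA) (expWeight_pos _ _ _ _ _).le
  · simp only [indicator_of_notMem hpA, zero_mul, le_refl]

theorem timeEnergy_add {Ω : Set (Euc d)} (hΩ : IsOpen Ω) (hb : Bornology.IsBounded Ω) {T : ℝ}
    {γ : Euc d} {a b : ℝ} {A : Set (Sph d)} (hA : MeasurableSet A) {f g : ℝ × Euc d × Sph d → ℝ}
    (hf : Integrable f (phaseTimeMeasure Ω T)) (hg : Integrable g (phaseTimeMeasure Ω T)) :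
    timeEnergy Ω T γ a b A (fun p => f p + g p) =
      timeEnergy Ω T γ a b A f + timeEnergy Ω T γ a b A g := by
  rw [timeEnergy, timeEnergy, timeEnergy,
    ← integral_add (integrable_cutoff_time hΩ hb hf γ a b hA)
      (integrable_cutoff_time hΩ hb hg γ a b hA)]
  congr 1
  ext p
  ring

theorem timeEnergy_const_mul {Ω : Set (Euc d)} {T : ℝ} {γ : Euc d} {a b : ℝ} {A : Set (Sph d)}
    (c : ℝ) (f : ℝ × Euc d × Sph d → ℝ) :
    timeEnergy Ω T γ a b A (fun p => c * f p) = c * timeEnergy Ω T γ a b A f := by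
  rw [timeEnergy, timeEnergy, ← integral_const_mul]
  congr 1
  ext p
  ring

/-- The energy of a time independent function. -/
theorem timeEnergy_snd_le {Ω : Set (Euc d)} (hΩ : IsOpen Ω) (hb : Bornology.IsBounded Ω) {T : ℝ}
    (hT : 0 < T) {γ : Euc d} {a b : ℝ} (hb0 : 0 ≤ b) {A : Set (Sph d)} (hA : MeasurableSet A)
    {g : Euc d × Sph d → ℝ} (hg : Integrable g (phaseMeasure Ω)) (hg0 : ∀ q, 0 ≤ g q) :
    timeEnergy Ω T γ a b A (fun p => g p.2) ≤ T * phaseEnergy Ω γ a b 0 A g := by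
  have h1 : Integrable (fun q => A.indicator (1 : Sph d → ℝ) q.2 * g q * expWeight γ a b 0 q.1)
      (phaseMeasure Ω) := integrable_cutoff_phase hΩ hb (left_mem_Icc.mpr hT.le) hg γ a b hA
  have h2 : Integrable (fun p : ℝ × Euc d × Sph d => g p.2) (phaseTimeMeasure Ω T) :=
    hg.comp_snd _
  have h3 : ∫ p, A.indicator (1 : Sph d → ℝ) p.2.2 * g p.2 * expWeight γ a b 0 p.2.1
      ∂phaseTimeMeasure Ω T = T * phaseEnergy Ω γ a b 0 A g := by
    rw [phaseTimeMeasure, integral_prod _ (h1.comp_snd _), phaseEnergy]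
    simp [hT.le]
  rw [← h3]
  refine integral_mono_ae (integrable_cutoff_time hΩ hb h2 γ a b hA) (h1.comp_snd _) ?_
  filter_upwards [ae_mem_phaseTimeMeasure hΩ] with p hp
  refine mul_le_mul_of_nonneg_left ?_ (mul_nonneg (indicator_one_nonneg A _) (hg0 _))
  refine Real.exp_le_exp.mpr ?_
  nlinarith [hp.1.1, mul_nonneg hb0 hp.1.1.le]

/-- The coefficients and sources in the energy estimates. -/
structure IsBoundedData (Ω : Set (Euc d)) (γ : Euc d) (γ₀ M m N c₃ : ℝ) (σ Stil : Euc d × Sph d → ℝ)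
    (μ : Euc d × Sph d × Sph d → ℝ) (S₀t : ℝ × Euc d × Sph d → ℝ) : Prop where
  sigma_meas : StronglyMeasurable σ
  sigma_nonneg : ∀ᵐ q ∂phaseMeasure Ω, 0 ≤ σ q
  sigma_le : ∀ q, |σ q| ≤ M
  mu_meas : StronglyMeasurable μ
  mu_le : ∀ r, |μ r| ≤ m
  mu_zero : ∀ r, r.2.2 ∉ velocitySet γ γ₀ → μ r = 0
  source_meas : StronglyMeasurable Stil
  source_le : ∀ q, |Stil q| ≤ N
  rate_le : ∀ p, |S₀t p| ≤ c₃

/-! ### Decay, Carleman and growth estimates -/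

section Estimates

variable {Ω : Set (Euc d)} {T γ₀ M m N c₃ : ℝ} {γ : Euc d}
  {σ Stil S₀init f₀ Xf₀ u₀ : Euc d × Sph d → ℝ} {μ : Euc d × Sph d × Sph d → ℝ}
  {S₀t U W F : ℝ × Euc d × Sph d → ℝ}

theorem IsBoundedData.integrable_sq (D : IsBoundedData Ω γ γ₀ M m N c₃ σ Stil μ S₀t)
    (hb : Bornology.IsBounded Ω) : Integrable (fun q => Stil q ^ 2) (phaseMeasure Ω) := by
  have := isFiniteMeasure_phaseMeasure hb
  refine Integrable.of_bound (D.source_meas.pow 2).aestronglyMeasurable (N ^ 2)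
    (Eventually.of_forall fun q => ?_)
  rw [Real.norm_eq_abs, abs_pow]
  exact pow_le_pow_left₀ (abs_nonneg _) (D.source_le q) 2

theorem IsBoundedData.sq_source_le (D : IsBoundedData Ω γ γ₀ M m N c₃ σ Stil μ S₀t)
    (p : ℝ × Euc d × Sph d) : (Stil p.2 * S₀t p) ^ 2 ≤ c₃ ^ 2 * Stil p.2 ^ 2 := by
  rw [mul_pow, mul_comm]
  refine mul_le_mul_of_nonneg_right ?_ (sq_nonneg _)
  rw [← sq_abs]
  exact pow_le_pow_left₀ (abs_nonneg _) (D.rate_le p) 2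

theorem IsDerivedSolution.energy_eq (h : IsDerivedSolution Ω T σ μ Stil S₀init f₀ Xf₀ S₀t u₀ U W F)
    (hΩ : IsOpen Ω) (hb : Bornology.IsBounded Ω) (hc : Convex ℝ Ω) (hT : 0 < T) (a b : ℝ)
    {A : Set (Sph d)} (hA : MeasurableSet A) :
    Integrable (fun p => A.indicator (1 : Sph d → ℝ) p.2.2 * (2 * U p * (W p + F p) +
      2 * (a * inner ℝ γ (p.2.2 : Euc d) - b) * U p ^ 2) * expWeight γ a b p.1 p.2.1)
      (phaseTimeMeasure Ω T) ∧
    timeEnergy Ω T γ a b A (fun p => 2 * U p * (W p + F p) +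
      2 * (a * inner ℝ γ (p.2.2 : Euc d) - b) * U p ^ 2) =
      phaseEnergy Ω γ a b T A (fun q => finalValue T u₀ W q ^ 2) -
      phaseEnergy Ω γ a b 0 A (fun q => u₀ q ^ 2) + outflow Ω T F γ a b A :=
  h.energy_identity hΩ hb hc hT γ a b hA

theorem IsBoundedData.integrable_sq_source
    (D : IsBoundedData Ω γ γ₀ M m N c₃ σ Stil μ S₀t) (hb : Bornology.IsBounded Ω) :
    Integrable (fun p : ℝ × Euc d × Sph d => Stil p.2 ^ 2) (phaseTimeMeasure Ω T) :=
  (D.integrable_sq hb).comp_snd _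

theorem ae_sigma_nonneg (D : IsBoundedData Ω γ γ₀ M m N c₃ σ Stil μ S₀t) :
    ∀ᵐ p ∂phaseTimeMeasure Ω T, 0 ≤ σ p.2 :=
  (Measure.quasiMeasurePreserving_snd (μ := volume.restrict (Ioo 0 T))
    (ν := phaseMeasure Ω)).ae D.sigma_nonneg

/-- The energy decays along velocities for which the weight decreases and which are not
reached by scattering. -/
theorem IsDerivedSolution.decay_le (h : IsDerivedSolution Ω T σ μ Stil S₀init f₀ Xf₀ S₀t u₀ U W F)
    (D : IsBoundedData Ω γ γ₀ M m N c₃ σ Stil μ S₀t)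
    (hΩ : IsOpen Ω) (hb : Bornology.IsBounded Ω) (hc : Convex ℝ Ω) (hT : 0 < T) {a b κ : ℝ}
    (hκ : 0 < κ) {A : Set (Sph d)} (hA : MeasurableSet A) (hAV : ∀ v ∈ A, v ∉ velocitySet γ γ₀)
    (hAκ : ∀ v ∈ A, a * inner ℝ γ (v : Euc d) - b ≤ -κ) :
    κ * timeEnergy Ω T γ a b A (fun p => U p ^ 2) ≤
      phaseEnergy Ω γ a b 0 A (fun q => u₀ q ^ 2) +
        κ⁻¹ * c₃ ^ 2 * timeEnergy Ω T γ a b A (fun p => Stil p.2 ^ 2) := by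
  obtain ⟨h1, h2⟩ := h.energy_eq (γ := γ) hΩ hb hc hT a b hA
  have i1 : Integrable (fun p => -κ * U p ^ 2) (phaseTimeMeasure Ω T) :=
    h.memLp_U.integrable_sq.const_mul _
  have i2 : Integrable (fun p : ℝ × Euc d × Sph d => κ⁻¹ * c₃ ^ 2 * Stil p.2 ^ 2)
      (phaseTimeMeasure Ω T) := (D.integrable_sq_source hb).const_mul _
  have h3 := timeEnergy_mono hΩ hb hA h1 (i1.add i2) (by
    filter_upwards [h.equation, ae_sigma_nonneg (T := T) D] with p hp hσ hpA
    -- The kernel vanishes unless the outgoing velocity is in V, so nothing is scattered into `A`.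
    have hK : scattering μ U p = 0 := by
      rw [scattering]
      simp_rw [D.mu_zero (p.2.1, _, p.2.2) (hAV _ hpA), zero_mul]
      exact integral_zero _ _
    have hS := D.sq_source_le p
    have hWF : W p + F p = Stil p.2 * S₀t p - σ p.2 * U p := by rw [hK] at hp; linarith
    -- Young's inequality with parameter κ: half of the decay 2κU² pays for the source.
    have e1 : 2 * U p * (Stil p.2 * S₀t p) ≤ κ * U p ^ 2 + κ⁻¹ * (Stil p.2 * S₀t p) ^ 2 := by
      have e2 : 0 ≤ κ⁻¹ * (κ * U p - Stil p.2 * S₀t p) ^ 2 :=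
        mul_nonneg (inv_pos.mpr hκ).le (sq_nonneg _)
      have e3 : κ⁻¹ * (κ * U p - Stil p.2 * S₀t p) ^ 2 =
          κ * U p ^ 2 + κ⁻¹ * (Stil p.2 * S₀t p) ^ 2 - 2 * U p * (Stil p.2 * S₀t p) := by
        field_simp
        ring
      linarith
    have e4 : κ⁻¹ * (Stil p.2 * S₀t p) ^ 2 ≤ κ⁻¹ * (c₃ ^ 2 * Stil p.2 ^ 2) :=
      mul_le_mul_of_nonneg_left hS (inv_pos.mpr hκ).le
    have e5 := mul_le_mul_of_nonneg_right (hAκ _ hpA) (sq_nonneg (U p))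
    have e6 : 0 ≤ σ p.2 * U p ^ 2 := mul_nonneg hσ (sq_nonneg _)
    simp only [Pi.add_apply]
    rw [hWF]
    linarith)
  rw [h2] at h3
  have h4 := timeEnergy_add (γ := γ) (a := a) (b := b) hΩ hb hA i1 i2
  rw [timeEnergy_const_mul, timeEnergy_const_mul] at h4
  have h5 : 0 ≤ phaseEnergy Ω γ a b T A (fun q => finalValue T u₀ W q ^ 2) :=
    phaseEnergy_nonneg fun q => sq_nonneg _
  have h6 := outflow_nonneg Ω T F γ a b A
  have h7 := h3.trans_eq h4
  linarith

theorem IsDerivedSolution.timeEnergy_sq_scattering_le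
    (h : IsDerivedSolution Ω T σ μ Stil S₀init f₀ Xf₀ S₀t u₀ U W F)
    (D : IsBoundedData Ω γ γ₀ M m N c₃ σ Stil μ S₀t)
    (hΩ : IsOpen Ω) (hb : Bornology.IsBounded Ω) (a b : ℝ) {A : Set (Sph d)}
    (hA : MeasurableSet A) :
    Integrable (fun p => scattering μ U p ^ 2) (phaseTimeMeasure Ω T) ∧
    timeEnergy Ω T γ a b A (fun p => scattering μ U p ^ 2) ≤
      m ^ 2 * timeEnergy Ω T γ a b univ (fun p => U p ^ 2) := by
  have h0 := (integral_sq_scattering_le_time hΩ hb D.mu_meas D.mu_le h.meas_U h.memLp_U γ 0 0).1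
  have hI : Integrable (fun p => scattering μ U p ^ 2) (phaseTimeMeasure Ω T) := by
    simpa [expWeight] using h0
  obtain ⟨h1, h2⟩ :=
    integral_sq_scattering_le_time hΩ hb D.mu_meas D.mu_le h.meas_U h.memLp_U γ a b
  refine ⟨hI, le_trans (integral_mono (integrable_cutoff_time hΩ hb hI γ a b hA) h1 fun p => ?_)
    (h2.trans_eq ?_)⟩
  · have := mul_nonneg (sq_nonneg (scattering μ U p)) (expWeight_pos γ a b p.1 p.2.1).le
    simp only
    rw [mul_assoc]
    exact mul_le_of_le_one_left this (indicator_one_le A _)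
  · simp [timeEnergy]

/-- The Carleman estimate. -/
theorem IsDerivedSolution.carleman_le
    (h : IsDerivedSolution Ω T σ μ Stil S₀init f₀ Xf₀ S₀t u₀ U W F)
    (D : IsBoundedData Ω γ γ₀ M m N c₃ σ Stil μ S₀t)
    (hΩ : IsOpen Ω) (hb : Bornology.IsBounded Ω) (hc : Convex ℝ Ω) (hT : 0 < T) {a b κ : ℝ}
    (hκ : 0 < κ) {A : Set (Sph d)} (hA : MeasurableSet A)
    (hAκ : ∀ v ∈ A, κ ≤ a * inner ℝ γ (v : Euc d) - b) :
    (κ - 2 * M - 1) * timeEnergy Ω T γ a b A (fun p => U p ^ 2) +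
      phaseEnergy Ω γ a b 0 A (fun q => u₀ q ^ 2) ≤
      phaseEnergy Ω γ a b T A (fun q => finalValue T u₀ W q ^ 2) + outflow Ω T F γ a b A +
        m ^ 2 * timeEnergy Ω T γ a b univ (fun p => U p ^ 2) +
        κ⁻¹ * c₃ ^ 2 * timeEnergy Ω T γ a b A (fun p => Stil p.2 ^ 2) := by
  obtain ⟨h1, h2⟩ := h.energy_eq (γ := γ) hΩ hb hc hT a b hA
  obtain ⟨k1, k2⟩ := h.timeEnergy_sq_scattering_le D hΩ hb a b hA
  have i1 : Integrable (fun p => (κ - 2 * M - 1) * U p ^ 2) (phaseTimeMeasure Ω T) :=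
    h.memLp_U.integrable_sq.const_mul _
  have i2 : Integrable (fun p : ℝ × Euc d × Sph d => (-(κ⁻¹ * c₃ ^ 2)) * Stil p.2 ^ 2)
      (phaseTimeMeasure Ω T) := (D.integrable_sq_source hb).const_mul _
  have i3 : Integrable (fun p => (-1) * scattering μ U p ^ 2) (phaseTimeMeasure Ω T) :=
    k1.const_mul _
  have i4 : Integrable (fun p => (κ - 2 * M - 1) * U p ^ 2 + (-(κ⁻¹ * c₃ ^ 2)) * Stil p.2 ^ 2)
    (phaseTimeMeasure Ω T) := i1.add i2
  have h3 := timeEnergy_mono_left hΩ hb hA (i4.add i3) h1 (by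
    filter_upwards [h.equation] with p hp hpA
    have hS := D.sq_source_le p
    have hWF : W p + F p = scattering μ U p + Stil p.2 * S₀t p - σ p.2 * U p := by linarith
    -- Of the gain 2κU², the source costs κU², the absorption 2MU² and the scattering U². This
    -- leaves the coefficient κ − 2M − 1.
    have e1 : -(2 * U p * (Stil p.2 * S₀t p)) ≤ κ * U p ^ 2 + κ⁻¹ * (Stil p.2 * S₀t p) ^ 2 := by
      have e2 : 0 ≤ κ⁻¹ * (κ * U p + Stil p.2 * S₀t p) ^ 2 :=
        mul_nonneg (inv_pos.mpr hκ).le (sq_nonneg _)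
      have e3 : κ⁻¹ * (κ * U p + Stil p.2 * S₀t p) ^ 2 =
          κ * U p ^ 2 + κ⁻¹ * (Stil p.2 * S₀t p) ^ 2 + 2 * U p * (Stil p.2 * S₀t p) := by
        field_simp
        ring
      linarith
    have e4 : κ⁻¹ * (Stil p.2 * S₀t p) ^ 2 ≤ κ⁻¹ * (c₃ ^ 2 * Stil p.2 ^ 2) :=
      mul_le_mul_of_nonneg_left hS (inv_pos.mpr hκ).le
    have e5 := mul_le_mul_of_nonneg_right (hAκ _ hpA) (sq_nonneg (U p))
    have e6 : σ p.2 * U p ^ 2 ≤ M * U p ^ 2 :=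
      mul_le_mul_of_nonneg_right (abs_le.mp (D.sigma_le _)).2 (sq_nonneg _)
    have e7 := sq_nonneg (U p + scattering μ U p)
    simp only [Pi.add_apply]
    rw [hWF]
    nlinarith)
  rw [h2] at h3
  have h4 := timeEnergy_add (γ := γ) (a := a) (b := b) hΩ hb hA i4 i3
  have h5 := timeEnergy_add (γ := γ) (a := a) (b := b) hΩ hb hA i1 i2
  rw [timeEnergy_const_mul, timeEnergy_const_mul] at h5
  rw [h5, timeEnergy_const_mul] at h4
  have h7 := h4.symm.trans_le h3
  linarith

/-- The growth of the energy. -/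
theorem IsDerivedSolution.final_le
    (h : IsDerivedSolution Ω T σ μ Stil S₀init f₀ Xf₀ S₀t u₀ U W F)
    (D : IsBoundedData Ω γ γ₀ M m N c₃ σ Stil μ S₀t)
    (hΩ : IsOpen Ω) (hb : Bornology.IsBounded Ω) (hc : Convex ℝ Ω) (hT : 0 < T) {b : ℝ}
    (hbm : 2 * b = 2 + m ^ 2) :
    phaseEnergy Ω γ 0 b T univ (fun q => finalValue T u₀ W q ^ 2) ≤
      phaseEnergy Ω γ 0 b 0 univ (fun q => u₀ q ^ 2) +
        c₃ ^ 2 * timeEnergy Ω T γ 0 b univ (fun p => Stil p.2 ^ 2) := by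
  have hA : MeasurableSet (univ : Set (Sph d)) := MeasurableSet.univ
  obtain ⟨h1, h2⟩ := h.energy_eq (γ := γ) hΩ hb hc hT 0 b hA
  obtain ⟨k1, k2⟩ := h.timeEnergy_sq_scattering_le D hΩ hb 0 b hA
  have i1 : Integrable (fun p => (-m ^ 2) * U p ^ 2) (phaseTimeMeasure Ω T) :=
    h.memLp_U.integrable_sq.const_mul _
  have i2 : Integrable (fun p : ℝ × Euc d × Sph d => c₃ ^ 2 * Stil p.2 ^ 2)
      (phaseTimeMeasure Ω T) := (D.integrable_sq_source hb).const_mul _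
  have i4 : Integrable (fun p => (-m ^ 2) * U p ^ 2 + c₃ ^ 2 * Stil p.2 ^ 2)
    (phaseTimeMeasure Ω T) := i1.add i2
  have h3 := timeEnergy_mono hΩ hb hA h1 (i4.add k1) (by
    filter_upwards [h.equation, ae_sigma_nonneg (T := T) D] with p hp hσ _
    have hS := D.sq_source_le p
    have hWF : W p + F p = scattering μ U p + Stil p.2 * S₀t p - σ p.2 * U p := by linarith
    have e1 := sq_nonneg (U p - Stil p.2 * S₀t p)
    have e6 : 0 ≤ σ p.2 * U p ^ 2 := mul_nonneg hσ (sq_nonneg _)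
    have e7 := sq_nonneg (U p - scattering μ U p)
    simp only [Pi.add_apply]
    rw [hWF]
    -- In 2b = 2 + m² the number 2 pays for the products of U with the scattering and with the
    -- source, and m² balances the scattered energy.
    have e8 : 2 * (0 * inner ℝ γ (p.2.2 : Euc d) - b) * U p ^ 2 = -(2 + m ^ 2) * U p ^ 2 := by
      rw [← hbm]; ring
    rw [e8]
    nlinarith)
  rw [h2] at h3
  have h4 := timeEnergy_add (γ := γ) (a := 0) (b := b) hΩ hb hA i4 k1
  have h5 := timeEnergy_add (γ := γ) (a := 0) (b := b) hΩ hb hA i1 i2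
  rw [timeEnergy_const_mul, timeEnergy_const_mul] at h5
  rw [h5] at h4
  have h7 := h3.trans_eq h4
  have h6 := outflow_nonneg Ω T F γ 0 b univ
  linarith

/-- Exit points are in the closure of Ω, where K bounds the weight, and the unweighted outflow is
bounded by `lintegral_chord_sq_le`. The inequality is stated in the extended reals because the norm
of the trace may be infinite. -/
theorem IsDerivedSolution.ofReal_outflow_le
    (h : IsDerivedSolution Ω T σ μ Stil S₀init f₀ Xf₀ S₀t u₀ U W F)
    (hΩ : IsOpen Ω) (hb : Bornology.IsBounded Ω) (hc : Convex ℝ Ω) (hs : HasSmoothBoundary Ω)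
    {ft : ℝ × Euc d × Sph d → ℝ} (hft : ft =ᵐ[phaseTimeMeasure Ω T] U) {a b K : ℝ}
    (hK : ∀ t ∈ Icc 0 T, ∀ x ∈ closure Ω, expWeight γ a b t x ≤ K) {A : Set (Sph d)}
    (hA : MeasurableSet A) :
    ENNReal.ofReal (outflow Ω T F γ a b A) ≤
      ENNReal.ofReal K * eLpNorm (outgoingTrace ft) 2 (outgoingMeasure Ω T) ^ 2 := by
  have hfin := isFiniteMeasure_phaseTimeMeasure hb T
  have hFi : Integrable F (phaseTimeMeasure Ω T) := h.memLp_F.integrable one_le_two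
  have hray : ∀ᵐ p ∂phaseTimeMeasure Ω T,
      ft p = ∫ r in Iio 0, rayKernel Ω (p.2, r) * F (p.1, rayMap (p.2, r)) := by
    filter_upwards [hft, h.eq_ray] with p h1 h2
    rw [h1, h2]
  have hint := (integral_transport_energy hΩ hb hc h.meas_F h.memLp_U h.memLp_F h.eq_ray γ a b
    hA).2.1
  rw [outflow, ofReal_integral_eq_lintegral_ofReal hint (Eventually.of_forall fun p =>
    mul_nonneg (mul_nonneg (mul_nonneg (indicator_one_nonneg A _)
    (by positivity)) (sq_nonneg _)) (expWeight_pos _ _ _ _ _).le)]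
  refine le_trans ?_ (mul_le_mul_right (lintegral_chord_sq_le hΩ hb hc hs h.meas_F hFi hray) _)
  rw [← lintegral_const_mul' _ _ ENNReal.ofReal_ne_top]
  refine lintegral_mono_ae ?_
  filter_upwards [ae_mem_phaseTimeMeasure hΩ] with p hp
  have hv := norm_eq_of_mem_sphere p.2.2
  have hex := (exitPoint_mem_frontier hΩ hb hc hp.2 hv).1
  set O := ∫ r in chord Ω p.2.1 p.2.2, F (p.1, p.2.1 + r • (p.2.2 : Euc d), p.2.2)
  have hℓ : (chordLength Ω p.2.1 p.2.2)⁻¹ =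
      ENNReal.ofReal (chordLength Ω p.2.1 p.2.2).toReal⁻¹ := by
    rw [← ENNReal.toReal_inv, ENNReal.ofReal_toReal]
    exact ENNReal.inv_ne_top.mpr (chordLength_pos hΩ hb hc hp.2 hv).ne'
  have hK0 : 0 ≤ K := (expWeight_pos _ _ _ _ _).le.trans (hK _ (Ioo_subset_Icc_self hp.1) _ hex)
  have hO : ‖O‖ₑ ^ 2 = ENNReal.ofReal (O ^ 2) := by
    rw [← ofReal_norm, ← ENNReal.ofReal_pow (norm_nonneg _), Real.norm_eq_abs, sq_abs]
  rw [hℓ, hO, ← ENNReal.ofReal_mul (by positivity), ← ENNReal.ofReal_mul hK0]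
  refine ENNReal.ofReal_le_ofReal ?_
  have h3 : 0 ≤ (chordLength Ω p.2.1 p.2.2).toReal⁻¹ * O ^ 2 := by positivity
  calc A.indicator (1 : Sph d → ℝ) p.2.2 * (chordLength Ω p.2.1 p.2.2).toReal⁻¹ * O ^ 2 *
        expWeight γ a b p.1 (exitPoint Ω p.2.1 p.2.2)
      = (A.indicator (1 : Sph d → ℝ) p.2.2 * expWeight γ a b p.1 (exitPoint Ω p.2.1 p.2.2)) *
        ((chordLength Ω p.2.1 p.2.2).toReal⁻¹ * O ^ 2) := by ring
    _ ≤ (1 * K) * ((chordLength Ω p.2.1 p.2.2).toReal⁻¹ * O ^ 2) := by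
        refine mul_le_mul_of_nonneg_right ?_ h3
        exact mul_le_mul (indicator_one_le A _) (hK _ (Ioo_subset_Icc_self hp.1) _ hex)
          (expWeight_pos _ _ _ _ _).le zero_le_one
    _ = _ := by ring

end Estimates

end

section

variable {d : ℕ}

/-! ### Reflection of the velocities -/

-- The spherical measure of a set is proportional to the volume of the cone over it, and the volume
-- is invariant under reflection.
open scoped Pointwise in
theorem measurePreserving_neg_sphereMeasure :
    MeasurePreserving (fun v : Sph d => -v) (sphereMeasure d) (sphereMeasure d) := by
  have hm : Measurable fun v : Sph d => -v := continuous_neg.measurable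
  refine ⟨hm, Measure.ext fun s hs => ?_⟩
  rw [Measure.map_apply hm hs, sphereMeasure, Measure.smul_apply, Measure.smul_apply,
    Measure.toSphere_apply' _ (hm hs), Measure.toSphere_apply' _ hs]
  have : Ioo (0 : ℝ) 1 • (Subtype.val '' ((fun v : Sph d => -v) ⁻¹' s) : Set (Euc d)) =
      -(Ioo (0 : ℝ) 1 • (Subtype.val '' s : Set (Euc d))) := by
    ext x
    simp only [Set.mem_neg, Set.mem_smul, mem_image, mem_preimage, exists_exists_and_eq_and]
    constructor
    · rintro ⟨r, hr, v, hv, rfl⟩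
      refine ⟨r, hr, -v, hv, ?_⟩
      rw [coe_neg_sphere, smul_neg]
    · rintro ⟨r, hr, v, hv, h⟩
      refine ⟨r, hr, -v, by rwa [neg_neg], ?_⟩
      rw [coe_neg_sphere, smul_neg, h, neg_neg]
  rw [this, Measure.measure_neg]

/-! ### Choice of the parameter -/

/-- As s → ∞ all coefficients of the source that have to be absorbed tend to zero: that of the final
energy exponentially, the others as powers of 1/s. The bound k₀ reserves room for absorbing the
energy of U on V. -/
theorem exists_large_parameter {E₁ E₂ m δ η ε k₀ : ℝ} (hδ : 0 < δ) (hη : 0 < η) (hε : 0 < ε) :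
    ∃ s : ℝ, 0 < s ∧ k₀ ≤ s * δ ∧
      Real.exp (-(2 * s * η)) * E₁ + (m ^ 2 * ((s * δ)⁻¹) ^ 2 + (s * δ)⁻¹) * E₂ ≤ ε := by
  have h1 : Tendsto (fun s : ℝ => s * δ) atTop atTop := tendsto_id.atTop_mul_const hδ
  have h2 : Tendsto (fun s : ℝ => (s * δ)⁻¹) atTop (𝓝 0) := tendsto_inv_atTop_zero.comp h1
  have h3 : Tendsto (fun s : ℝ => 2 * s * η) atTop atTop :=
    (tendsto_id.const_mul_atTop two_pos).atTop_mul_const hη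
  have h4 : Tendsto (fun s : ℝ => Real.exp (-(2 * s * η))) atTop (𝓝 0) :=
    Real.tendsto_exp_neg_atTop_nhds_zero.comp h3
  have h5 : Tendsto (fun s : ℝ => Real.exp (-(2 * s * η)) * E₁ +
      (m ^ 2 * ((s * δ)⁻¹) ^ 2 + (s * δ)⁻¹) * E₂) atTop
      (𝓝 (0 * E₁ + (m ^ 2 * 0 ^ 2 + 0) * E₂)) :=
    (h4.mul_const _).add ((((h2.pow 2).const_mul _).add h2).mul_const _)
  have h6 : 0 * E₁ + (m ^ 2 * 0 ^ 2 + 0) * E₂ < ε := by simpa using hε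
  obtain ⟨s, a, b, c⟩ := ((eventually_gt_atTop (0 : ℝ)).and ((h1.eventually_ge_atTop k₀).and
    (h5.eventually_le_const h6))).exists
  exact ⟨s, a, b, c⟩

/-- Z is the weighted energy of the source, R the energy of the initial residual, D the boundary
data, Q the energy of u₀ on V, I₁ and I₂ the energies of U for γ·v ≤ −γ₀ and for |γ·v| < γ₀, and JT
and Jo the final energy and the outflow. By `hε`, Z enters the bound for Q with coefficient at most
c₁²/8. The factor 4 in `hZ` makes this c₁²/2, which is absorbed on the left. -/
theorem stability_of_estimates {Z R D Q I₁ I₂ JT Jo k m c₁ c₃ T K₀ K₂ E₁ E₃ ex : ℝ}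
    (hk : 0 < k)
    (h1 : k * I₁ ≤ K₀ * R + k⁻¹ * c₃ ^ 2 * (T * Z))
    (h2 : I₂ ≤ K₂ * R)
    (hQ : Q ≤ JT + Jo + m ^ 2 * (I₁ + I₂) + k⁻¹ * c₃ ^ 2 * (T * Z))
    (hJT : JT ≤ ex * (E₁ * Z + E₃ * R)) (hJo : Jo ≤ K₀ * D)
    (hZ : c₁ ^ 2 * Z ≤ 2 * (2 * Q + 2 * (K₀ * R)))
    (hZ0 : 0 ≤ Z)
    (hε : ex * E₁ + (m ^ 2 * k⁻¹ ^ 2 + k⁻¹) * (c₃ ^ 2 * T) ≤ c₁ ^ 2 / 8) :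
    c₁ ^ 2 * Z ≤ 8 * ((ex * E₃ + m ^ 2 * (k⁻¹ * K₀ + K₂) + K₀) * R + K₀ * D) := by
  have hki : 0 < k⁻¹ := inv_pos.mpr hk
  have e1 : I₁ ≤ k⁻¹ * (K₀ * R) + k⁻¹ ^ 2 * (c₃ ^ 2 * (T * Z)) := by
    have := mul_le_mul_of_nonneg_left h1 hki.le
    rw [inv_mul_cancel_left₀ hk.ne'] at this
    linarith
  have e2 : m ^ 2 * (I₁ + I₂) ≤
      m ^ 2 * (k⁻¹ * (K₀ * R) + k⁻¹ ^ 2 * (c₃ ^ 2 * (T * Z)) + K₂ * R) :=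
    mul_le_mul_of_nonneg_left (by linarith) (sq_nonneg m)
  have e3 : (ex * E₁ + (m ^ 2 * k⁻¹ ^ 2 + k⁻¹) * (c₃ ^ 2 * T)) * Z ≤ c₁ ^ 2 / 8 * Z :=
    mul_le_mul_of_nonneg_right hε hZ0
  have e4 : c₁ ^ 2 * Z ≤ 4 * ((ex * E₁ + (m ^ 2 * k⁻¹ ^ 2 + k⁻¹) * (c₃ ^ 2 * T)) * Z) +
      4 * ((ex * E₃ + m ^ 2 * (k⁻¹ * K₀ + K₂) + K₀) * R + K₀ * D) := by linarith
  linarith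

/-! ### Estimates of the initial values -/

variable [IsProbabilityMeasure (sphereMeasure d)]

theorem phaseEnergy_mono {Ω : Set (Euc d)} (hΩ : IsOpen Ω) (hb : Bornology.IsBounded Ω) {t : ℝ}
    {γ : Euc d} {a b : ℝ} {A : Set (Sph d)} (hA : MeasurableSet A) {f g : Euc d × Sph d → ℝ}
    (ht : 0 ≤ t)
    (hf : Integrable f (phaseMeasure Ω)) (hg : Integrable g (phaseMeasure Ω))
    (h : ∀ᵐ q ∂phaseMeasure Ω, q.2 ∈ A → f q ≤ g q) :
    phaseEnergy Ω γ a b t A f ≤ phaseEnergy Ω γ a b t A g := by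
  refine integral_mono_ae (integrable_cutoff_phase hΩ hb ⟨ht, le_rfl⟩ hf γ a b hA)
    (integrable_cutoff_phase hΩ hb ⟨ht, le_rfl⟩ hg γ a b hA) ?_
  filter_upwards [h] with p hp
  by_cases hpA : p.2 ∈ A
  · simp only [indicator_of_mem hpA, Pi.one_apply, one_mul]
    exact mul_le_mul_of_nonneg_right (hp hpA) (expWeight_pos _ _ _ _ _).le
  · simp only [indicator_of_notMem hpA, zero_mul, le_refl]

theorem phaseEnergy_mono_set {Ω : Set (Euc d)} (hΩ : IsOpen Ω) (hb : Bornology.IsBounded Ω) {t : ℝ}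
    {γ : Euc d} {a b : ℝ} {A B : Set (Sph d)} (hA : MeasurableSet A) (hB : MeasurableSet B)
    (hAB : A ⊆ B) {f : Euc d × Sph d → ℝ} (ht : 0 ≤ t)
    (hf : Integrable f (phaseMeasure Ω)) (hf0 : ∀ q, 0 ≤ f q) :
    phaseEnergy Ω γ a b t A f ≤ phaseEnergy Ω γ a b t B f := by
  refine integral_mono (integrable_cutoff_phase hΩ hb ⟨ht, le_rfl⟩ hf γ a b hA)
    (integrable_cutoff_phase hΩ hb ⟨ht, le_rfl⟩ hf γ a b hB) fun q => ?_
  refine mul_le_mul_of_nonneg_right (mul_le_mul_of_nonneg_right ?_ (hf0 q))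
    (expWeight_pos _ _ _ _ _).le
  exact indicator_le_indicator_of_subset hAB (fun _ => zero_le_one) _

theorem phaseEnergy_add {Ω : Set (Euc d)} (hΩ : IsOpen Ω) (hb : Bornology.IsBounded Ω) {t : ℝ}
    {γ : Euc d} {a b : ℝ} {A : Set (Sph d)} (hA : MeasurableSet A) {f g : Euc d × Sph d → ℝ}
    (ht : 0 ≤ t)
    (hf : Integrable f (phaseMeasure Ω)) (hg : Integrable g (phaseMeasure Ω)) :
    phaseEnergy Ω γ a b t A (fun q => f q + g q) =
      phaseEnergy Ω γ a b t A f + phaseEnergy Ω γ a b t A g := by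
  rw [phaseEnergy, phaseEnergy, phaseEnergy,
    ← integral_add (integrable_cutoff_phase hΩ hb ⟨ht, le_rfl⟩ hf γ a b hA)
      (integrable_cutoff_phase hΩ hb ⟨ht, le_rfl⟩ hg γ a b hA)]
  congr 1
  ext p
  ring

theorem phaseEnergy_const_mul {Ω : Set (Euc d)} {t : ℝ} {γ : Euc d} {a b : ℝ} {A : Set (Sph d)}
    (c : ℝ) (f : Euc d × Sph d → ℝ) :
    phaseEnergy Ω γ a b t A (fun p => c * f p) = c * phaseEnergy Ω γ a b t A f := by
  rw [phaseEnergy, phaseEnergy, ← integral_const_mul]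
  congr 1
  ext p
  ring

theorem phaseEnergy_le_integral {Ω : Set (Euc d)} (hΩ : IsOpen Ω) (hb : Bornology.IsBounded Ω)
    {t : ℝ} {γ : Euc d} {a b K : ℝ} {A : Set (Sph d)} (hA : MeasurableSet A)
    {f : Euc d × Sph d → ℝ} (ht : 0 ≤ t) (hf : Integrable f (phaseMeasure Ω)) (hf0 : ∀ q, 0 ≤ f q)
    (hK : ∀ x ∈ Ω, expWeight γ a b t x ≤ K) :
    phaseEnergy Ω γ a b t A f ≤ K * ∫ q, f q ∂phaseMeasure Ω := by
  rw [← integral_const_mul]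
  refine integral_mono_ae (integrable_cutoff_phase hΩ hb ⟨ht, le_rfl⟩ hf γ a b hA)
    (hf.const_mul K) ?_
  filter_upwards [ae_fst_mem hΩ] with q hq
  calc A.indicator (1 : Sph d → ℝ) q.2 * f q * expWeight γ a b t q.1
      ≤ 1 * f q * expWeight γ a b t q.1 :=
        mul_le_mul_of_nonneg_right (mul_le_mul_of_nonneg_right (indicator_one_le A _) (hf0 q))
          (expWeight_pos _ _ _ _ _).le
    _ ≤ K * f q := by
        rw [one_mul, mul_comm]
        exact mul_le_mul_of_nonneg_right (hK _ hq) (hf0 q)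

theorem integral_le_phaseEnergy {Ω : Set (Euc d)} (hΩ : IsOpen Ω) (hb : Bornology.IsBounded Ω)
    {t : ℝ} {γ : Euc d} {a b K : ℝ} {f : Euc d × Sph d → ℝ} (ht : 0 ≤ t)
    (hf : Integrable f (phaseMeasure Ω)) (hf0 : ∀ q, 0 ≤ f q)
    (hK : ∀ x ∈ Ω, K ≤ expWeight γ a b t x) :
    K * ∫ q, f q ∂phaseMeasure Ω ≤ phaseEnergy Ω γ a b t univ f := by
  rw [← integral_const_mul]
  refine integral_mono_ae (hf.const_mul K)
    (integrable_cutoff_phase hΩ hb ⟨ht, le_rfl⟩ hf γ a b MeasurableSet.univ) ?_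
  filter_upwards [ae_fst_mem hΩ] with q hq
  simp only [indicator_univ, Pi.one_apply, one_mul]
  rw [mul_comm]
  exact mul_le_mul_of_nonneg_left (hK _ hq) (hf0 q)

theorem measurePreserving_reflection (Ω : Set (Euc d)) :
    MeasurePreserving (fun q : Euc d × Sph d => (q.1, -q.2)) (phaseMeasure Ω) (phaseMeasure Ω) :=
  (MeasurePreserving.id (volume.restrict Ω)).prod measurePreserving_neg_sphereMeasure

/-- The energy of an even function vanishing near the velocities orthogonal to `γ`. -/
theorem phaseEnergy_univ_le {Ω : Set (Euc d)} (hΩ : IsOpen Ω) (hb : Bornology.IsBounded Ω)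
    {γ : Euc d} {γ₀ a b : ℝ} {S : Euc d × Sph d → ℝ} 
    (hS2 : Integrable (fun q => S q ^ 2) (phaseMeasure Ω))
    (heven : ∀ᵐ q ∂phaseMeasure Ω, S q = S (q.1, -q.2))
    (hzero : ∀ᵐ q ∂phaseMeasure Ω, |inner ℝ γ (q.2 : Euc d)| ≤ γ₀ → S q = 0)
    (hV : MeasurableSet (velocitySet γ γ₀)) :
    phaseEnergy Ω γ a b 0 univ (fun q => S q ^ 2) ≤
      2 * phaseEnergy Ω γ a b 0 (velocitySet γ γ₀) (fun q => S q ^ 2) := by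
  set V := velocitySet γ γ₀ with hVdef
  have h0 : (0 : ℝ) ≤ 0 := le_rfl
  have i0 := integrable_cutoff_phase hΩ hb (T := 0) ⟨h0, le_rfl⟩ hS2 γ a b MeasurableSet.univ
  have i1 := integrable_cutoff_phase hΩ hb (T := 0) ⟨h0, le_rfl⟩ hS2 γ a b hV
  have hmp := measurePreserving_reflection (d := d) Ω
  have i2 : Integrable (fun q : Euc d × Sph d => V.indicator (1 : Sph d → ℝ) (-q.2) *
      S (q.1, -q.2) ^ 2 * expWeight γ a b 0 q.1) (phaseMeasure Ω) :=
    hmp.integrable_comp_of_integrable i1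
  have e2 : ∫ q : Euc d × Sph d, V.indicator (1 : Sph d → ℝ) (-q.2) * S (q.1, -q.2) ^ 2 *
      expWeight γ a b 0 q.1 ∂phaseMeasure Ω = phaseEnergy Ω γ a b 0 V (fun q => S q ^ 2) := by
    have h1 := i1.aestronglyMeasurable
    rw [← hmp.map_eq] at h1
    have h2 := integral_map hmp.measurable.aemeasurable h1
    rw [hmp.map_eq] at h2
    exact h2.symm
  have e3 : phaseEnergy Ω γ a b 0 univ (fun q => S q ^ 2) ≤
      ∫ q : Euc d × Sph d, (V.indicator (1 : Sph d → ℝ) q.2 * S q ^ 2 *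
      expWeight γ a b 0 q.1 + V.indicator (1 : Sph d → ℝ) (-q.2) * S (q.1, -q.2) ^ 2 *
      expWeight γ a b 0 q.1) ∂phaseMeasure Ω := by
    refine integral_mono_ae i0 (i1.add i2) ?_
    filter_upwards [heven, hzero] with q h1 h2
    simp only [indicator_univ, Pi.one_apply, one_mul]
    rw [← h1]
    have hw := expWeight_pos γ a b 0 q.1
    have n1 := indicator_one_nonneg V q.2
    have n2 := indicator_one_nonneg V (-q.2)
    have n3 : 0 ≤ S q ^ 2 * expWeight γ a b 0 q.1 := mul_nonneg (sq_nonneg _) hw.le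
    by_cases hc1 : q.2 ∈ V
    · rw [indicator_of_mem hc1, Pi.one_apply]
      nlinarith [mul_nonneg n2 n3]
    · by_cases hc2 : -q.2 ∈ V
      · rw [indicator_of_mem hc2, Pi.one_apply]
        nlinarith [mul_nonneg n1 n3]
      · have h3 : |inner ℝ γ (q.2 : Euc d)| ≤ γ₀ := by
          rw [abs_le]
          simp only [hVdef, velocitySet, mem_ofPred_eq, not_le, coe_neg_sphere,
            inner_neg_right] at hc1 hc2
          exact ⟨by linarith, hc1.le⟩
        rw [h2 h3]
        simp
  rw [integral_add i1 i2] at e3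
  refine e3.trans_eq ?_
  have e4 : ∫ q : Euc d × Sph d, V.indicator (1 : Sph d → ℝ) q.2 * S q ^ 2 *
      expWeight γ a b 0 q.1 ∂phaseMeasure Ω = phaseEnergy Ω γ a b 0 V (fun q => S q ^ 2) := rfl
  refine (congrArg₂ (· + ·) e4 e2).trans ?_
  ring

end

section

variable {d : ℕ} [IsProbabilityMeasure (sphereMeasure d)]

/-! ### Bounds for the weight -/

theorem expWeight_le {γ x : Euc d} {s β t H : ℝ} (hs : 0 ≤ s) (hβ : 0 ≤ β) (ht : 0 ≤ t)
    (hx : inner ℝ γ x ≤ H) : expWeight γ s (s * β) t x ≤ Real.exp (2 * s * H) := by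
  refine Real.exp_le_exp.mpr ?_
  nlinarith [mul_le_mul_of_nonneg_left hx hs, mul_nonneg (mul_nonneg hs hβ) ht]

theorem le_expWeight_zero {γ x : Euc d} {s b L : ℝ} (hs : 0 ≤ s) (hx : L ≤ inner ℝ γ x) :
    Real.exp (2 * s * L) ≤ expWeight γ s b 0 x := by
  refine Real.exp_le_exp.mpr ?_
  nlinarith [mul_le_mul_of_nonneg_left hx hs]

/-- When L is the minimum of γ·x, the first factor is a lower bound for the weight at time zero. The
second is exponentially small in s as soon as βT exceeds H − L, which is how the condition on T and
the width enters. -/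
theorem expWeight_final_le {γ x : Euc d} {s β T L H : ℝ} (hs : 0 ≤ s) (hx : inner ℝ γ x ≤ H) :
    expWeight γ s (s * β) T x ≤
      Real.exp (2 * s * L) * Real.exp (-(2 * s * (β * T - (H - L)))) := by
  rw [← Real.exp_add]
  refine Real.exp_le_exp.mpr ?_
  nlinarith [mul_le_mul_of_nonneg_left hx hs]

theorem expWeight_zero_left (γ : Euc d) (b t : ℝ) (x : Euc d) :
    expWeight γ 0 b t x = Real.exp (-(2 * b * t)) := by
  rw [expWeight]
  congr 1
  ring

theorem measurable_inner_velocity (γ : Euc d) :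
    Measurable fun v : Sph d => inner ℝ γ (v : Euc d) := by fun_prop

theorem measurableSet_velocitySet (γ : Euc d) (γ₀ : ℝ) : MeasurableSet (velocitySet γ γ₀) :=
  measurableSet_le measurable_const (measurable_inner_velocity γ)

/-! ### The part of the initial value that does not depend on the source -/

def initialResidual (σ : Euc d × Sph d → ℝ) (μ : Euc d × Sph d × Sph d → ℝ)
    (f₀ Xf₀ : Euc d × Sph d → ℝ) (q : Euc d × Sph d) : ℝ :=
  ∫ v', μ (q.1, v', q.2) * f₀ (q.1, v') ∂sphereMeasure d - Xf₀ q - σ q * f₀ q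

/-! ### Energies of the velocities outside V -/

section Stability

variable {Ω : Set (Euc d)} {T γ₀ M m N c₃ : ℝ} {γ : Euc d}
  {σ Stil S₀init f₀ Xf₀ u₀ : Euc d × Sph d → ℝ} {μ : Euc d × Sph d × Sph d → ℝ}
  {S₀t U W F : ℝ × Euc d × Sph d → ℝ}

theorem IsBoundedData.integral_sq_residual_le (D : IsBoundedData Ω γ γ₀ M m N c₃ σ Stil μ S₀t)
    (hΩ : IsOpen Ω) (hb : Bornology.IsBounded Ω) (hfm : StronglyMeasurable f₀)
    (hf : MemLp f₀ 2 (phaseMeasure Ω)) (hXm : StronglyMeasurable Xf₀)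
    (hX : MemLp Xf₀ 2 (phaseMeasure Ω)) :
    Integrable (fun q => initialResidual σ μ f₀ Xf₀ q ^ 2) (phaseMeasure Ω) ∧
      ∫ q, initialResidual σ μ f₀ Xf₀ q ^ 2 ∂phaseMeasure Ω ≤
        3 * (∫ q, Xf₀ q ^ 2 ∂phaseMeasure Ω + (M ^ 2 + m ^ 2) * ∫ q, f₀ q ^ 2 ∂phaseMeasure Ω) := by
  have hfin := isFiniteMeasure_phaseMeasure hb
  have hi := hf.integrable one_le_two
  obtain ⟨h1, h2⟩ := integral_sq_scattering_le D.mu_meas D.mu_le hfm hi hf.integrable_sq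
    (ρ := fun _ => 1) measurable_const (fun _ => zero_le_one) (fun _ _ => le_rfl) hΩ
  simp only [mul_one] at h1 h2
  have hKm : StronglyMeasurable fun q : Euc d × Sph d =>
      ∫ v', μ (q.1, v', q.2) * f₀ (q.1, v') ∂sphereMeasure d :=
    (isBoundedKernel_scattering Ω D.mu_meas.measurable D.mu_le).stronglyMeasurable_kernelOp hfm
  have hRm : StronglyMeasurable (initialResidual σ μ f₀ Xf₀) :=
    (hKm.sub hXm).sub (D.sigma_meas.mul hfm)
  have i1 : Integrable (fun q => (M ^ 2) * f₀ q ^ 2) (phaseMeasure Ω) :=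
    hf.integrable_sq.const_mul _
  have i2 : Integrable (fun q => Xf₀ q ^ 2 + M ^ 2 * f₀ q ^ 2) (phaseMeasure Ω) :=
    hX.integrable_sq.add i1
  have i3 : Integrable (fun q => 3 * ((∫ v', μ (q.1, v', q.2) * f₀ (q.1, v') ∂sphereMeasure d) ^ 2 +
      (Xf₀ q ^ 2 + M ^ 2 * f₀ q ^ 2))) (phaseMeasure Ω) := (h1.add i2).const_mul 3
  have hle : ∀ q, initialResidual σ μ f₀ Xf₀ q ^ 2 ≤
      3 * ((∫ v', μ (q.1, v', q.2) * f₀ (q.1, v') ∂sphereMeasure d) ^ 2 +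
      (Xf₀ q ^ 2 + M ^ 2 * f₀ q ^ 2)) := by
    intro q
    have h3 : (σ q * f₀ q) ^ 2 ≤ M ^ 2 * f₀ q ^ 2 := by
      rw [mul_pow]
      refine mul_le_mul_of_nonneg_right ?_ (sq_nonneg _)
      rw [← sq_abs]
      exact pow_le_pow_left₀ (abs_nonneg _) (D.sigma_le q) 2
    rw [initialResidual]
    generalize (∫ v', μ (q.1, v', q.2) * f₀ (q.1, v') ∂sphereMeasure d) = z
    nlinarith [sq_nonneg (z + Xf₀ q), sq_nonneg (z + σ q * f₀ q), sq_nonneg (Xf₀ q - σ q * f₀ q)]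
  have hI : Integrable (fun q => initialResidual σ μ f₀ Xf₀ q ^ 2) (phaseMeasure Ω) := by
    refine i3.mono' (hRm.pow 2).aestronglyMeasurable (Eventually.of_forall fun q => ?_)
    rw [Real.norm_eq_abs, abs_of_nonneg (sq_nonneg _)]
    exact hle q
  refine ⟨hI, (integral_mono hI i3 hle).trans ?_⟩
  rw [integral_const_mul, integral_add h1 i2, integral_add hX.integrable_sq i1, integral_const_mul]
  linarith

theorem IsDerivedSolution.integrable_sq_initial
    (h : IsDerivedSolution Ω T σ μ Stil S₀init f₀ Xf₀ S₀t u₀ U W F)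
    (hb : Bornology.IsBounded Ω) (hT : 0 < T) :
    Integrable (fun q => u₀ q ^ 2) (phaseMeasure Ω) ∧
      Integrable (fun q => finalValue T u₀ W q ^ 2) (phaseMeasure Ω) := by
  have hfin := isFiniteMeasure_phaseTimeMeasure hb T
  exact integrable_sq_endpoints hT h.memLp_U h.memLp_W (h.memLp_W.integrable one_le_two) h.eq_time

theorem IsDerivedSolution.initial_eq
    (h : IsDerivedSolution Ω T σ μ Stil S₀init f₀ Xf₀ S₀t u₀ U W F) :
    ∀ᵐ q ∂phaseMeasure Ω, u₀ q = initialResidual σ μ f₀ Xf₀ q + Stil q * S₀init q := by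
  filter_upwards [h.initial] with q hq
  rw [initialResidual]
  linarith

/-- Velocities with `γ · v ≤ -γ₀`. -/
theorem IsDerivedSolution.timeEnergy_opposite_le
    (h : IsDerivedSolution Ω T σ μ Stil S₀init f₀ Xf₀ S₀t u₀ U W F)
    (D : IsBoundedData Ω γ γ₀ M m N c₃ σ Stil μ S₀t)
    (hΩ : IsOpen Ω) (hb : Bornology.IsBounded Ω) (hc : Convex ℝ Ω) (hT : 0 < T) {s β K : ℝ}
    (hs : 0 < s) (hβ : 0 < β) (hβγ : β < γ₀)
    (hR : Integrable (fun q => initialResidual σ μ f₀ Xf₀ q ^ 2) (phaseMeasure Ω))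
    (hS₀ : ∀ᵐ q ∂phaseMeasure Ω, q.2 ∉ velocitySet γ γ₀ → S₀init q = 0)
    (hK : ∀ x ∈ Ω, expWeight γ s (s * β) 0 x ≤ K) :
    s * (γ₀ - β) * timeEnergy Ω T γ s (s * β) {v | inner ℝ γ (v : Euc d) ≤ -γ₀}
        (fun p => U p ^ 2) ≤
      K * ∫ q, initialResidual σ μ f₀ Xf₀ q ^ 2 ∂phaseMeasure Ω +
        (s * (γ₀ - β))⁻¹ * c₃ ^ 2 *
          (T * phaseEnergy Ω γ s (s * β) 0 univ (fun q => Stil q ^ 2)) := by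
  -- These velocities would allow the larger rate s(γ₀ + β). The rate of the Carleman estimate is
  -- used so that one parameter serves both.
  have hk : 0 < s * (γ₀ - β) := mul_pos hs (by linarith)
  have hA : MeasurableSet {v : Sph d | inner ℝ γ (v : Euc d) ≤ -γ₀} :=
    measurableSet_le (measurable_inner_velocity γ) measurable_const
  have hAV : ∀ v ∈ {v : Sph d | inner ℝ γ (v : Euc d) ≤ -γ₀}, v ∉ velocitySet γ γ₀ := by
    intro v hv hv'
    simp only [velocitySet, mem_ofPred_eq] at hv hv'
    linarith
  have h1 := h.decay_le D hΩ hb hc hT (a := s) (b := s * β) hk hA hAV (by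
    intro v hv
    simp only [mem_ofPred_eq] at hv
    nlinarith [mul_le_mul_of_nonneg_left hv hs.le])
  -- Outside V the initial source factor is zero, and u₀ reduces to the residual.
  have h2 := (phaseEnergy_mono hΩ hb (a := s) (b := s * β) (γ := γ) hA le_rfl
    (h.integrable_sq_initial hb hT).1 hR (by
      filter_upwards [h.initial_eq, hS₀] with q e1 e2 hq
      rw [e1, e2 (hAV _ hq), mul_zero, add_zero])).trans
    (phaseEnergy_le_integral hΩ hb hA le_rfl hR (fun _ => sq_nonneg _) hK)
  have h3 := (timeEnergy_snd_le hΩ hb hT (γ := γ) (a := s) (mul_nonneg hs.le hβ.le) hA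
    (D.integrable_sq hb) (fun _ => sq_nonneg _)).trans (mul_le_mul_of_nonneg_left
    (phaseEnergy_mono_set hΩ hb (a := s) (b := s * β) (γ := γ) hA MeasurableSet.univ
      (subset_univ _) le_rfl (D.integrable_sq hb) (fun _ => sq_nonneg _)) hT.le)
  have h4 := mul_le_mul_of_nonneg_left h3
    (mul_nonneg (inv_nonneg.mpr hk.le) (sq_nonneg c₃))
  exact h1.trans (add_le_add h2 h4)

/-- Velocities with `|γ · v| < γ₀`. -/
theorem IsDerivedSolution.timeEnergy_transversal_le
    (h : IsDerivedSolution Ω T σ μ Stil S₀init f₀ Xf₀ S₀t u₀ U W F)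
    (D : IsBoundedData Ω γ γ₀ M m N c₃ σ Stil μ S₀t)
    (hΩ : IsOpen Ω) (hb : Bornology.IsBounded Ω) (hc : Convex ℝ Ω) (hT : 0 < T) {a b K : ℝ}
    (hR : Integrable (fun q => initialResidual σ μ f₀ Xf₀ q ^ 2) (phaseMeasure Ω))
    (hzero : ∀ᵐ q ∂phaseMeasure Ω, |inner ℝ γ (q.2 : Euc d)| ≤ γ₀ → Stil q = 0)
    (hK : ∀ t ∈ Icc 0 T, ∀ x ∈ Ω, expWeight γ a b t x ≤ K) (hK0 : 0 ≤ K) :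
    timeEnergy Ω T γ a b {v | |inner ℝ γ (v : Euc d)| < γ₀} (fun p => U p ^ 2) ≤
      K * Real.exp (2 * T) * ∫ q, initialResidual σ μ f₀ Xf₀ q ^ 2 ∂phaseMeasure Ω := by
  set A : Set (Sph d) := {v | |inner ℝ γ (v : Euc d)| < γ₀} with hAdef
  have hA : MeasurableSet A :=
    measurableSet_lt (measurable_inner_velocity γ).abs measurable_const
  have hAV : ∀ v ∈ A, v ∉ velocitySet γ γ₀ := by
    intro v hv hv'
    simp only [hAdef, velocitySet, mem_ofPred_eq] at hv hv'
    linarith [le_abs_self (inner ℝ γ (v : Euc d))]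
  have hSA : ∀ᵐ q ∂phaseMeasure Ω, q.2 ∈ A → Stil q = 0 := by
    filter_upwards [hzero] with q hq hqA
    exact hq (le_of_lt hqA)
  -- On these velocities aγ·v − b need not have a sign. The plain weight exp(−2t) is used instead,
  -- and the comparison of the weights in `h4` costs the factor K exp(2T).
  have h1 := h.decay_le D hΩ hb hc hT (a := 0) (b := 1) one_pos hA hAV (by intros; simp)
  have h2 := (phaseEnergy_mono hΩ hb (a := 0) (b := 1) (γ := γ) hA le_rfl
    (h.integrable_sq_initial hb hT).1 hR (by
      filter_upwards [h.initial_eq, hSA] with q e1 e2 hq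
      rw [e1, e2 hq, zero_mul, add_zero])).trans
    (phaseEnergy_le_integral (K := 1) hΩ hb hA le_rfl hR (fun _ => sq_nonneg _) (by
      intro x _
      simp [expWeight_zero_left]))
  have h3 : timeEnergy Ω T γ 0 1 A (fun p => Stil p.2 ^ 2) = 0 := by
    refine integral_eq_zero_of_ae ?_
    filter_upwards [(Measure.quasiMeasurePreserving_snd (μ := volume.restrict (Ioo 0 T))
      (ν := phaseMeasure Ω)).ae hSA] with p hp
    by_cases hpA : p.2.2 ∈ A
    · simp [hp hpA]
    · simp [indicator_of_notMem hpA]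
  have h4 : timeEnergy Ω T γ a b A (fun p => U p ^ 2) ≤
      K * Real.exp (2 * T) * timeEnergy Ω T γ 0 1 A (fun p => U p ^ 2) := by
    rw [timeEnergy, timeEnergy, ← integral_const_mul]
    refine integral_mono_ae (integrable_cutoff_time hΩ hb h.memLp_U.integrable_sq γ a b hA)
      ((integrable_cutoff_time hΩ hb h.memLp_U.integrable_sq γ 0 1 hA).const_mul _) ?_
    filter_upwards [ae_mem_phaseTimeMeasure hΩ] with p hp
    have e1 := mul_nonneg (indicator_one_nonneg A p.2.2) (sq_nonneg (U p))
    have e2 : expWeight γ a b p.1 p.2.1 ≤ K * Real.exp (2 * T) * expWeight γ 0 1 p.1 p.2.1 := by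
      refine (hK p.1 (Ioo_subset_Icc_self hp.1) _ hp.2).trans ?_
      rw [expWeight_zero_left, mul_assoc, ← Real.exp_add]
      refine le_mul_of_one_le_right hK0 (Real.one_le_exp ?_)
      linarith [hp.1.2]
    refine (mul_le_mul_of_nonneg_left e2 e1).trans_eq ?_
    ring
  refine h4.trans (mul_le_mul_of_nonneg_left ?_ (mul_nonneg hK0 (Real.exp_pos _).le))
  rw [h3] at h1
  linarith

theorem timeEnergy_univ_eq (hΩ : IsOpen Ω) (hb : Bornology.IsBounded Ω) {a b : ℝ} (hγ₀ : 0 < γ₀)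
    {g : ℝ × Euc d × Sph d → ℝ} (hg : Integrable g (phaseTimeMeasure Ω T)) :
    timeEnergy Ω T γ a b univ g = timeEnergy Ω T γ a b (velocitySet γ γ₀) g +
      (timeEnergy Ω T γ a b {v | inner ℝ γ (v : Euc d) ≤ -γ₀} g +
        timeEnergy Ω T γ a b {v | |inner ℝ γ (v : Euc d)| < γ₀} g) := by
  have hA : MeasurableSet {v : Sph d | inner ℝ γ (v : Euc d) ≤ -γ₀} :=
    measurableSet_le (measurable_inner_velocity γ) measurable_const
  have hB : MeasurableSet {v : Sph d | |inner ℝ γ (v : Euc d)| < γ₀} :=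
    measurableSet_lt (measurable_inner_velocity γ).abs measurable_const
  have i1 := integrable_cutoff_time hΩ hb hg γ a b (measurableSet_velocitySet γ γ₀)
  have i2 := integrable_cutoff_time hΩ hb hg γ a b hA
  have i3 := integrable_cutoff_time hΩ hb hg γ a b hB
  rw [timeEnergy, timeEnergy, timeEnergy, timeEnergy, ← integral_add i2 i3]
  refine Eq.trans ?_ (integral_add i1 (i2.add i3))
  congr 1
  ext p
  simp only [← add_mul]
  congr 2
  simp only [indicator_apply, velocitySet, mem_ofPred_eq, mem_univ, if_true, Pi.one_apply]
  generalize inner ℝ γ (p.2.2 : Euc d) = y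
  rcases le_or_gt γ₀ y with h1 | h1
  · rw [if_pos h1, if_neg (by linarith), if_neg (by rw [abs_lt]; intro h; linarith [h.2])]
    ring
  · rcases le_or_gt y (-γ₀) with h2 | h2
    · rw [if_neg h1.not_ge, if_pos h2, if_neg (by rw [abs_lt]; intro h; linarith [h.1])]
      ring
    · rw [if_neg h1.not_ge, if_neg h2.not_ge, if_pos (abs_lt.mpr ⟨h2, h1⟩)]
      ring

end Stability

end

/-! ### The stability constant -/

section

variable {d : ℕ} [IsProbabilityMeasure (sphereMeasure d)]

theorem three_mul_add_mul_le {M m D f X : ℝ} (hD : 0 ≤ D) (hf : 0 ≤ f) (hX : 0 ≤ X) :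
    3 * (X + (M ^ 2 + m ^ 2) * f) ≤ 3 * (1 + M ^ 2 + m ^ 2) * (D + f + X) := by
  have h := mul_nonneg (add_nonneg (sq_nonneg M) (sq_nonneg m)) (add_nonneg hD hX)
  linarith

section Stability

variable {Ω : Set (Euc d)} {T γ₀ M m N c₃ : ℝ} {γ : Euc d}
  {σ Stil S₀init f₀ Xf₀ u₀ : Euc d × Sph d → ℝ} {μ : Euc d × Sph d × Sph d → ℝ}
  {S₀t U W F : ℝ × Euc d × Sph d → ℝ}

/-- Ordinary growth of the energy, with a weight depending on time only. The constants do not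
involve s, so the exponential smallness of the final Carleman weight prevails over them. -/
theorem IsDerivedSolution.integral_sq_final_le
    (h : IsDerivedSolution Ω T σ μ Stil S₀init f₀ Xf₀ S₀t u₀ U W F)
    (D : IsBoundedData Ω γ γ₀ M m N c₃ σ Stil μ S₀t)
    (hΩ : IsOpen Ω) (hb : Bornology.IsBounded Ω) (hc : Convex ℝ Ω) (hT : 0 < T) {c₂ : ℝ}
    (hR : Integrable (fun q => initialResidual σ μ f₀ Xf₀ q ^ 2) (phaseMeasure Ω))
    (hS₀ : ∀ᵐ q ∂phaseMeasure Ω, |S₀init q| ≤ c₂) :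
    ∫ q, finalValue T u₀ W q ^ 2 ∂phaseMeasure Ω ≤
      Real.exp ((2 + m ^ 2) * T) *
        ((2 * c₂ ^ 2 + c₃ ^ 2 * T) * ∫ q, Stil q ^ 2 ∂phaseMeasure Ω +
          2 * ∫ q, initialResidual σ μ f₀ Xf₀ q ^ 2 ∂phaseMeasure Ω) := by
  have hu : MeasurableSet (univ : Set (Sph d)) := MeasurableSet.univ
  have hS := D.integrable_sq hb
  have h1 := h.final_le D hΩ hb hc hT (b := (2 + m ^ 2) / 2) (by ring)
  obtain ⟨i1, i2⟩ := h.integrable_sq_initial hb hT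
  have j1 := phaseEnergy_le_integral (γ := γ) (a := 0) (b := (2 + m ^ 2) / 2) (K := 1) hΩ hb hu
    le_rfl i1 (fun _ => sq_nonneg _) (by intro x _; simp [expWeight_zero_left])
  have j2 := phaseEnergy_le_integral (γ := γ) (a := 0) (b := (2 + m ^ 2) / 2) (K := 1) hΩ hb hu
    le_rfl hS (fun _ => sq_nonneg _) (by intro x _; simp [expWeight_zero_left])
  have j3 := integral_le_phaseEnergy (γ := γ) (a := 0) (b := (2 + m ^ 2) / 2)
    (K := Real.exp (-((2 + m ^ 2) * T))) hΩ hb hT.le i2 (fun _ => sq_nonneg _) (by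
      intro x _
      rw [expWeight_zero_left]
      exact (congrArg Real.exp (by ring)).le)
  have j4 := timeEnergy_snd_le (γ := γ) (a := 0) (b := (2 + m ^ 2) / 2) hΩ hb hT (by positivity)
    hu hS (fun _ => sq_nonneg _)
  have j5 : ∫ q, u₀ q ^ 2 ∂phaseMeasure Ω ≤
      2 * ∫ q, initialResidual σ μ f₀ Xf₀ q ^ 2 ∂phaseMeasure Ω +
        2 * c₂ ^ 2 * ∫ q, Stil q ^ 2 ∂phaseMeasure Ω := by
    rw [← integral_const_mul, ← integral_const_mul,
      ← integral_add (hR.const_mul 2) (hS.const_mul (2 * c₂ ^ 2))]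
    refine integral_mono_ae i1 ((hR.const_mul 2).add (hS.const_mul (2 * c₂ ^ 2))) ?_
    filter_upwards [h.initial_eq, hS₀] with q e1 e2
    have e3 : S₀init q ^ 2 ≤ c₂ ^ 2 := by
      rw [← sq_abs]
      exact pow_le_pow_left₀ (abs_nonneg _) e2 2
    simp only [e1]
    nlinarith [sq_nonneg (initialResidual σ μ f₀ Xf₀ q - Stil q * S₀init q),
      mul_le_mul_of_nonneg_left e3 (sq_nonneg (Stil q))]
  have j6 : c₃ ^ 2 * timeEnergy Ω T γ 0 ((2 + m ^ 2) / 2) univ (fun p => Stil p.2 ^ 2) ≤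
      c₃ ^ 2 * (T * (1 * ∫ q, Stil q ^ 2 ∂phaseMeasure Ω)) :=
    mul_le_mul_of_nonneg_left (j4.trans (mul_le_mul_of_nonneg_left j2 hT.le)) (sq_nonneg _)
  have j7 : Real.exp (-((2 + m ^ 2) * T)) * ∫ q, finalValue T u₀ W q ^ 2 ∂phaseMeasure Ω ≤
      (2 * c₂ ^ 2 + c₃ ^ 2 * T) * ∫ q, Stil q ^ 2 ∂phaseMeasure Ω +
          2 * ∫ q, initialResidual σ μ f₀ Xf₀ q ^ 2 ∂phaseMeasure Ω := by linarith
  have j8 := mul_le_mul_of_nonneg_left j7 (Real.exp_pos ((2 + m ^ 2) * T)).le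
  rwa [← mul_assoc, ← Real.exp_add, add_neg_cancel, Real.exp_zero, one_mul] at j8

/-- The source is controlled by the initial value. -/
theorem IsDerivedSolution.phaseEnergy_source_le
    (h : IsDerivedSolution Ω T σ μ Stil S₀init f₀ Xf₀ S₀t u₀ U W F)
    (D : IsBoundedData Ω γ γ₀ M m N c₃ σ Stil μ S₀t)
    (hΩ : IsOpen Ω) (hb : Bornology.IsBounded Ω) (hT : 0 < T) {c₁ a b K : ℝ} (hc₁ : 0 < c₁)
    (hR : Integrable (fun q => initialResidual σ μ f₀ Xf₀ q ^ 2) (phaseMeasure Ω))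
    (hS₀ : ∀ᵐ q ∂phaseMeasure Ω, q.2 ∈ velocitySet γ γ₀ → c₁ ≤ S₀init q)
    (heven : ∀ᵐ q ∂phaseMeasure Ω, Stil q = Stil (q.1, -q.2))
    (hzero : ∀ᵐ q ∂phaseMeasure Ω, |inner ℝ γ (q.2 : Euc d)| ≤ γ₀ → Stil q = 0)
    (hK : ∀ x ∈ Ω, expWeight γ a b 0 x ≤ K) :
    c₁ ^ 2 * phaseEnergy Ω γ a b 0 univ (fun q => Stil q ^ 2) ≤
      2 * (2 * phaseEnergy Ω γ a b 0 (velocitySet γ γ₀) (fun q => u₀ q ^ 2) +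
        2 * (K * ∫ q, initialResidual σ μ f₀ Xf₀ q ^ 2 ∂phaseMeasure Ω)) := by
  have hV := measurableSet_velocitySet γ γ₀
  have hS := D.integrable_sq hb
  have i1 := (h.integrable_sq_initial hb hT).1
  have h1 := phaseEnergy_univ_le (γ := γ) (γ₀ := γ₀) (a := a) (b := b) hΩ hb hS heven hzero hV
  have h2 := phaseEnergy_mono (γ := γ) (a := a) (b := b) hΩ hb hV le_rfl (hS.const_mul (c₁ ^ 2))
    ((i1.const_mul 2).add (hR.const_mul 2)) (by
      filter_upwards [h.initial_eq, hS₀] with q e1 e2 hq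
      have e3 : c₁ ^ 2 ≤ S₀init q ^ 2 := pow_le_pow_left₀ hc₁.le (e2 hq) 2
      have e4 : Stil q * S₀init q = u₀ q - initialResidual σ μ f₀ Xf₀ q := by rw [e1]; ring
      have e5 : (Stil q * S₀init q) ^ 2 = (u₀ q - initialResidual σ μ f₀ Xf₀ q) ^ 2 := by rw [e4]
      simp only [Pi.add_apply]
      nlinarith [sq_nonneg (u₀ q + initialResidual σ μ f₀ Xf₀ q),
        mul_le_mul_of_nonneg_left e3 (sq_nonneg (Stil q))])
  have h3 := (phaseEnergy_add (γ := γ) (a := a) (b := b) hΩ hb hV le_rfl (i1.const_mul 2)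
    (hR.const_mul 2))
  have h4 := phaseEnergy_le_integral (γ := γ) (a := a) (b := b) hΩ hb hV le_rfl hR
    (fun _ => sq_nonneg _) hK
  rw [phaseEnergy_const_mul, phaseEnergy_const_mul] at h3
  rw [phaseEnergy_const_mul] at h2
  have h5 := h2.trans_eq h3
  have h6 := mul_le_mul_of_nonneg_left h1 (sq_nonneg c₁)
  linarith

/-- The stability estimate, with a constant depending on the bounds for the data only. -/
theorem exists_stability_constant (hne : Ω.Nonempty) (hΩ : IsOpen Ω) (hb : Bornology.IsBounded Ω)
    (hc : Convex ℝ Ω) (hs : HasSmoothBoundary Ω) (γ : Euc d) {β : ℝ} (hβ : 0 < β) (hβγ : β < γ₀)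
    (hT : 0 < T) (hTβ : width γ Ω / β < T) (M m : ℝ) {c₁ c₂ c₃ : ℝ} (hc₁ : 0 < c₁) (hc₂ : 0 < c₂) :
    ∃ C : ℝ, 0 < C ∧ ∀ {N : ℝ} {σ Stil S₀init f₀ Xf₀ u₀ : Euc d × Sph d → ℝ}
      {μ : Euc d × Sph d × Sph d → ℝ} {S₀t U W F ft : ℝ × Euc d × Sph d → ℝ},
      IsDerivedSolution Ω T σ μ Stil S₀init f₀ Xf₀ S₀t u₀ U W F →
      IsBoundedData Ω γ γ₀ M m N c₃ σ Stil μ S₀t →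
      StronglyMeasurable f₀ → MemLp f₀ 2 (phaseMeasure Ω) →
      StronglyMeasurable Xf₀ → MemLp Xf₀ 2 (phaseMeasure Ω) →
      (∀ᵐ q ∂phaseMeasure Ω, q.2 ∈ velocitySet γ γ₀ → c₁ ≤ S₀init q ∧ S₀init q ≤ c₂) →
      (∀ᵐ q ∂phaseMeasure Ω, q.2 ∉ velocitySet γ γ₀ → S₀init q = 0) →
      (∀ᵐ q ∂phaseMeasure Ω, Stil q = Stil (q.1, -q.2)) →
      (∀ᵐ q ∂phaseMeasure Ω, |inner ℝ γ (q.2 : Euc d)| ≤ γ₀ → Stil q = 0) →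
      ft =ᵐ[phaseTimeMeasure Ω T] U → eLpNorm (outgoingTrace ft) 2 (outgoingMeasure Ω T) ≠ ⊤ →
      ∫ q, Stil q ^ 2 ∂phaseMeasure Ω ≤
        C * ((eLpNorm (outgoingTrace ft) 2 (outgoingMeasure Ω T)).toReal ^ 2 +
          ∫ q, f₀ q ^ 2 ∂phaseMeasure Ω + ∫ q, Xf₀ q ^ 2 ∂phaseMeasure Ω) := by
  have hγ₀ : 0 < γ₀ := hβ.trans hβγ
  have hδ : 0 < γ₀ - β := by linarith
  have hcont : Continuous fun x : Euc d => (inner ℝ γ x : ℝ) := by fun_prop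
  have hcpt : IsCompact ((fun x : Euc d => (inner ℝ γ x : ℝ)) '' closure Ω) :=
    hb.isCompact_closure.image hcont
  set L : ℝ := sInf ((fun x : Euc d => (inner ℝ γ x : ℝ)) '' closure Ω) with hL
  set H : ℝ := sSup ((fun x : Euc d => (inner ℝ γ x : ℝ)) '' closure Ω) with hH
  have hLx : ∀ x ∈ closure Ω, L ≤ inner ℝ γ x := fun x hx =>
    csInf_le hcpt.bddBelow (mem_image_of_mem _ hx)
  have hHx : ∀ x ∈ closure Ω, inner ℝ γ x ≤ H := fun x hx =>
    le_csSup hcpt.bddAbove (mem_image_of_mem _ hx)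
  have hη : 0 < β * T - (H - L) := by
    have : H - L < T * β := (div_lt_iff₀ hβ).mp hTβ
    linarith
  set E := Real.exp ((2 + m ^ 2) * T) with hE
  -- E₁ is the coefficient of the source in the final energy, and E₂ stems from the bound on ∂ₜS₀.
  -- The value of k₀ makes κ − 2M − 1 at least m² in the Carleman estimate. The parameter `s` is
  -- fixed before any coefficient or solution is introduced.
  obtain ⟨s, hs0, hsk, hε⟩ := exists_large_parameter (E₁ := E * (2 * c₂ ^ 2 + c₃ ^ 2 * T))
    (E₂ := c₃ ^ 2 * T) (m := m) (k₀ := 2 * M + 1 + m ^ 2) hδ hη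
    (show 0 < c₁ ^ 2 / 8 by positivity)
  set k := s * (γ₀ - β) with hk
  have hk0 : 0 < k := mul_pos hs0 hδ
  set η := β * T - (H - L) with hηdef
  set K₀ := Real.exp (2 * s * H) with hK₀
  set l := Real.exp (2 * s * L) with hl
  have hK₀0 : 0 < K₀ := Real.exp_pos _
  have hl0 : 0 < l := Real.exp_pos _
  set K₂ := K₀ * Real.exp (2 * T)
  set ex := Real.exp (-(2 * s * η))
  have hex : 0 < ex := Real.exp_pos _
  set G := ex * (E * (2 * K₀)) + m ^ 2 * (k⁻¹ * K₀ + K₂) + K₀ with hG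
  have hE0 : 0 < E := Real.exp_pos _
  have hK₂ : 0 < K₂ := mul_pos hK₀0 (Real.exp_pos _)
  have hG0 : 0 < G := by positivity
  set A₁ := l⁻¹ * ((c₁ ^ 2)⁻¹ * 8) with hA₁
  have hA₁0 : 0 < A₁ := by positivity
  refine ⟨A₁ * (G * 3 * (1 + M ^ 2 + m ^ 2) + K₀), by positivity, ?_⟩
  intro N σ Stil S₀init f₀ Xf₀ u₀ μ S₀t U W F ft h D hfm hf hXm hX hS₀V hS₀ heven hzero hft hfin
  obtain ⟨hR, hRle⟩ := D.integral_sq_residual_le hΩ hb hfm hf hXm hX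
  have hV := measurableSet_velocitySet γ γ₀
  have hS := D.integrable_sq hb
  have hw : ∀ t ∈ Icc 0 T, ∀ x ∈ closure Ω, expWeight γ s (s * β) t x ≤ K₀ := fun t ht x hx =>
    expWeight_le hs0.le hβ.le ht.1 (hHx x hx)
  have hw0 : ∀ x ∈ Ω, expWeight γ s (s * β) 0 x ≤ K₀ := fun x hx =>
    hw 0 ⟨le_rfl, hT.le⟩ x (subset_closure hx)
  set R := ∫ q, initialResidual σ μ f₀ Xf₀ q ^ 2 ∂phaseMeasure Ω
  set Z := phaseEnergy Ω γ s (s * β) 0 univ (fun q => Stil q ^ 2)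
  set Q := phaseEnergy Ω γ s (s * β) 0 (velocitySet γ γ₀) (fun q => u₀ q ^ 2)
  set D₂ := (eLpNorm (outgoingTrace ft) 2 (outgoingMeasure Ω T)).toReal ^ 2
  have hZ0 : 0 ≤ Z := phaseEnergy_nonneg fun _ => sq_nonneg _
  have h1 := h.timeEnergy_opposite_le D hΩ hb hc hT hs0 hβ hβγ hR hS₀ hw0
  have h2 := h.timeEnergy_transversal_le D hΩ hb hc hT (a := s) (b := s * β) hR hzero
    (fun t ht x hx => hw t ht x (subset_closure hx)) hK₀0.le
  have hIV : 0 ≤ timeEnergy Ω T γ s (s * β) (velocitySet γ γ₀) (fun p => U p ^ 2) :=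
    timeEnergy_nonneg fun _ => sq_nonneg _
  have hcar := h.carleman_le D hΩ hb hc hT (a := s) (b := s * β) hk0 hV (by
    intro v hv
    have : γ₀ ≤ inner ℝ γ (v : Euc d) := hv
    have := mul_le_mul_of_nonneg_left this hs0.le
    rw [hk, mul_sub]
    exact sub_le_sub_right this _)
  -- The scattering term involves all velocities. Its part on V is absorbed by `h5`; the other two
  -- parts are bounded by `h1` and `h2`.
  rw [timeEnergy_univ_eq (γ₀ := γ₀) hΩ hb hγ₀ h.memLp_U.integrable_sq] at hcar
  have h3 := (timeEnergy_snd_le hΩ hb hT (γ := γ) (a := s) (mul_nonneg hs0.le hβ.le) hV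
    hS (fun _ => sq_nonneg _)).trans (mul_le_mul_of_nonneg_left
    (phaseEnergy_mono_set hΩ hb (a := s) (b := s * β) (γ := γ) hV MeasurableSet.univ
      (subset_univ _) le_rfl hS (fun _ => sq_nonneg _)) hT.le)
  have h4 := mul_le_mul_of_nonneg_left h3
    (mul_nonneg (inv_nonneg.mpr hk0.le) (sq_nonneg c₃))
  have h5 := mul_nonneg (show 0 ≤ k - 2 * M - 1 - m ^ 2 by linarith) hIV
  have hJo : outflow Ω T F γ s (s * β) (velocitySet γ γ₀) ≤ K₀ * D₂ := by
    have e1 := h.ofReal_outflow_le hΩ hb hc hs hft hw hV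
    have e2 := ENNReal.toReal_mono (ENNReal.mul_ne_top ENNReal.ofReal_ne_top
      (ENNReal.pow_ne_top hfin)) e1
    rw [ENNReal.toReal_ofReal', ENNReal.toReal_mul, ENNReal.toReal_ofReal hK₀0.le,
      ENNReal.toReal_pow] at e2
    exact (le_max_left _ _).trans e2
  have hS₀c : ∀ᵐ q ∂phaseMeasure Ω, |S₀init q| ≤ c₂ := by
    filter_upwards [hS₀V, hS₀] with q e1 e2
    by_cases hq : q.2 ∈ velocitySet γ γ₀
    · rw [abs_of_nonneg (hc₁.le.trans (e1 hq).1)]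
      exact (e1 hq).2
    · rw [e2 hq, abs_zero]
      exact hc₂.le
  have hlS : l * ∫ q, Stil q ^ 2 ∂phaseMeasure Ω ≤ Z :=
    integral_le_phaseEnergy hΩ hb le_rfl hS (fun _ => sq_nonneg _) fun x hx =>
      le_expWeight_zero hs0.le (hLx x (subset_closure hx))
  have hR0 : 0 ≤ R := integral_nonneg fun _ => sq_nonneg _
  have hlK : l ≤ K₀ := by
    obtain ⟨x, hx⟩ := hne
    exact Real.exp_le_exp.mpr (mul_le_mul_of_nonneg_left
      ((hLx x (subset_closure hx)).trans (hHx x (subset_closure hx))) (by positivity))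
  -- The final weight is at most l · ex. The factor `l` converts the unweighted source energy in the
  -- growth estimate back into `Z`, and `ex` is the small factor.
  have hJT : phaseEnergy Ω γ s (s * β) T (velocitySet γ γ₀) (fun q => finalValue T u₀ W q ^ 2) ≤
      ex * (E * (2 * c₂ ^ 2 + c₃ ^ 2 * T) * Z + E * (2 * K₀) * R) := by
    have e1 := phaseEnergy_le_integral hΩ hb hV hT.le (h.integrable_sq_initial hb hT).2
      (fun _ => sq_nonneg _) (fun x hx => expWeight_final_le (γ := γ) (β := β) (T := T) (L := L)
        hs0.le (hHx x (subset_closure hx)))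
    refine e1.trans ?_
    have e2 := h.integral_sq_final_le D hΩ hb hc hT hR hS₀c
    have e3 := mul_le_mul_of_nonneg_left e2 (mul_pos hl0 hex).le
    refine e3.trans ?_
    have e4 : l * R ≤ K₀ * R := mul_le_mul_of_nonneg_right hlK hR0
    have e5 : 0 ≤ 2 * c₂ ^ 2 + c₃ ^ 2 * T := by positivity
    have e6 := mul_le_mul_of_nonneg_left hlS e5
    have e7 : 0 ≤ ex * E := (mul_pos hex hE0).le
    have e8 := mul_le_mul_of_nonneg_left (add_le_add e6 (mul_le_mul_of_nonneg_left e4 two_pos.le)) e7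
    refine le_trans (le_of_eq ?_) (e8.trans_eq ?_)
    · ring
    · ring
  have hZ := h.phaseEnergy_source_le D hΩ hb hT hc₁ hR (hS₀V.mono fun q hq hqV => (hq hqV).1)
    heven hzero hw0
  have key := stability_of_estimates (D := D₂) (Q := Q) hk0 h1 h2 (by linarith) hJT hJo hZ hZ0 hε
  have hf0 : 0 ≤ ∫ q, f₀ q ^ 2 ∂phaseMeasure Ω := integral_nonneg fun _ => sq_nonneg _
  have hX0 : 0 ≤ ∫ q, Xf₀ q ^ 2 ∂phaseMeasure Ω := integral_nonneg fun _ => sq_nonneg _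
  set f2 := ∫ q, f₀ q ^ 2 ∂phaseMeasure Ω
  set X2 := ∫ q, Xf₀ q ^ 2 ∂phaseMeasure Ω
  have hD0 : 0 ≤ D₂ := sq_nonneg _
  have k1 : ∫ q, Stil q ^ 2 ∂phaseMeasure Ω ≤ A₁ * (G * R + K₀ * D₂) := by
    have e1 := mul_le_mul_of_nonneg_left hlS (sq_nonneg c₁)
    have e2 := mul_le_mul_of_nonneg_left (e1.trans key)
      (show 0 ≤ l⁻¹ * (c₁ ^ 2)⁻¹ by positivity)
    refine le_trans (le_of_eq ?_) (e2.trans_eq ?_)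
    · field_simp
    · rw [hA₁, hG]
      ring
  refine k1.trans ?_
  refine (mul_le_mul_of_nonneg_left ?_ hA₁0.le).trans_eq (mul_assoc _ _ _).symm
  have k2 : R ≤ 3 * (1 + M ^ 2 + m ^ 2) * (D₂ + f2 + X2) :=
    hRle.trans (three_mul_add_mul_le hD0 hf0 hX0)
  have k3 := mul_le_mul_of_nonneg_left k2 hG0.le
  have k4 : K₀ * D₂ ≤ K₀ * (D₂ + f2 + X2) := mul_le_mul_of_nonneg_left (by linarith) hK₀0.le
  linarith

end Stability

end

section

variable {d : ℕ}

/-! ### The stability theorem -/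

theorem toReal_eLpNorm_two_sq {α : Type*} [MeasurableSpace α] {P : Measure α} {g : α → ℝ}
    (hg : MemLp g 2 P) : (eLpNorm g 2 P).toReal ^ 2 = ∫ x, g x ^ 2 ∂P := by
  have h0 : 0 ≤ ∫ x, ‖g x‖ ^ (2 : ℝ) ∂P := integral_nonneg fun _ => by positivity
  rw [hg.eLpNorm_eq_integral_rpow_norm two_ne_zero ENNReal.ofNat_ne_top,
    ENNReal.toReal_ofReal (by simpa using Real.rpow_nonneg h0 _)]
  rw [ENNReal.toReal_ofNat, ← Real.rpow_natCast, ← Real.rpow_mul h0]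
  norm_num

theorem eLpNorm_two_le_of_integral_sq_le {α : Type*} [MeasurableSpace α] {P : Measure α}
    {f g h : α → ℝ} (hf : MemLp f 2 P) (hg : MemLp g 2 P) (hh : MemLp h 2 P) {C : ℝ} {a : ℝ≥0∞}
    (hC : 0 ≤ C) (ha : a ≠ ⊤)
    (hle : ∫ x, f x ^ 2 ∂P ≤ C * (a.toReal ^ 2 + ∫ x, g x ^ 2 ∂P + ∫ x, h x ^ 2 ∂P)) :
    eLpNorm f 2 P ≤ ENNReal.ofReal √C * (a + eLpNorm g 2 P + eLpNorm h 2 P) := by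
  rw [← toReal_eLpNorm_two_sq hf, ← toReal_eLpNorm_two_sq hg, ← toReal_eLpNorm_two_sq hh] at hle
  have e1 : a + eLpNorm g 2 P ≠ ⊤ := ENNReal.add_ne_top.mpr ⟨ha, hg.eLpNorm_ne_top⟩
  have e2 : a + eLpNorm g 2 P + eLpNorm h 2 P ≠ ⊤ :=
    ENNReal.add_ne_top.mpr ⟨e1, hh.eLpNorm_ne_top⟩
  rw [← ENNReal.toReal_le_toReal hf.eLpNorm_ne_top (ENNReal.mul_ne_top ENNReal.ofReal_ne_top e2),
    ENNReal.toReal_mul, ENNReal.toReal_ofReal (Real.sqrt_nonneg _),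
    ENNReal.toReal_add e1 hh.eLpNorm_ne_top, ENNReal.toReal_add ha hg.eLpNorm_ne_top]
  have x1 := ENNReal.toReal_nonneg (a := a)
  have x2 := ENNReal.toReal_nonneg (a := eLpNorm g 2 P)
  have x3 := ENNReal.toReal_nonneg (a := eLpNorm h 2 P)
  refine le_of_sq_le_sq (hle.trans ?_) (by positivity)
  rw [mul_pow, Real.sq_sqrt hC]
  refine mul_le_mul_of_nonneg_left ?_ hC
  nlinarith [mul_nonneg x1 x2, mul_nonneg x1 x3, mul_nonneg x2 x3]

theorem exists_stronglyMeasurable_bounded_of_memLp_top {α : Type*} [MeasurableSpace α]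
    {P : Measure α} {f : α → ℝ} (hf : MemLp f ⊤ P) :
    ∃ (N : ℝ) (g : α → ℝ), StronglyMeasurable g ∧ f =ᵐ[P] g ∧ ∀ x, |g x| ≤ N := by
  have h : ∀ᵐ x ∂P, |f x| ≤ (eLpNorm f ⊤ P).toReal := by
    filter_upwards [ae_le_eLpNormEssSup (f := f) (μ := P)] with x hx
    rw [← eLpNorm_exponent_top] at hx
    have := ENNReal.toReal_mono hf.eLpNorm_ne_top hx
    simpa using this
  exact ⟨_, exists_stronglyMeasurable_bounded hf.aestronglyMeasurable ENNReal.toReal_nonneg h⟩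

end

end InverseTransport

end

open InverseTransport in
theorem theorem3p3 {d : ℕ} (hd : 2 ≤ d)
    (Ω : Set (Euc d)) (hne : Ω.Nonempty) (hopen : IsOpen Ω) (hbdd : Bornology.IsBounded Ω)
    (hconv : Convex ℝ Ω) (hsmooth : HasSmoothBoundary Ω)
    (γ : Euc d) (hγ : ‖γ‖ = 1) (γ₀ β : ℝ) (hβ : 0 < β) (hβγ : β < γ₀)
    (T : ℝ) (hT : Metric.diam Ω < T) (hTβ : width γ Ω / β < T)
    (c₁ c₂ c₃ M m : ℝ) (hc₁ : 0 < c₁) (hc₂ : 0 < c₂) (hc₃ : 0 < c₃) :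
    ∃ C : ℝ, 0 < C ∧
      ∀ (σ : Euc d × Sph d → ℝ) (μ : Euc d × Sph d × Sph d → ℝ),
        IsAdmissiblePair Ω M m σ μ →
      ∀ (γ₁ Cσ Cμ : ℝ), 0 < γ₁ → 0 < Cσ → 0 < Cμ →
        (∀ᵐ q ∂phaseMeasure Ω, |weightB γ β q.2| ≤ γ₁ →
          (weightB γ β q.2)⁻¹ * |σ q| ≤ Cσ) →
        (∀ᵐ q ∂phaseMeasure Ω,
          ∫⁻ v', ENNReal.ofReal (|μ (q.1, v', q.2)| ^ 2) /
              ENNReal.ofReal (|weightB γ β v'| ^ 2) ∂sphereMeasure d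
            ≤ ENNReal.ofReal Cμ) →
        (∀ᵐ r ∂scatteringMeasure Ω, r.2.2 ∉ velocitySet γ γ₀ → μ r = 0) →
      ∀ (f₀ Xf₀ XXf₀ : Euc d × Sph d → ℝ),
        MemLp f₀ ∞ (phaseMeasure Ω) → MemLp Xf₀ ∞ (phaseMeasure Ω) →
        MemLp XXf₀ ∞ (phaseMeasure Ω) →
        HasWeakTransportDeriv Ω f₀ Xf₀ → HasWeakTransportDeriv Ω Xf₀ XXf₀ →
        (∀ᵐ q ∂phaseMeasure Ω, q.2 ∉ velocitySet γ γ₀ → f₀ q = 0) →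
      ∀ (Stil : Euc d × Sph d → ℝ),
        MemLp Stil ∞ (phaseMeasure Ω) →
        (∀ᵐ q ∂phaseMeasure Ω, Stil q = Stil (q.1, -q.2)) →
        (∀ᵐ q ∂phaseMeasure Ω, |inner ℝ γ (q.2 : Euc d)| ≤ γ₀ → Stil q = 0) →
      ∀ (S₀ S₀t : ℝ × Euc d × Sph d → ℝ) (S₀init : Euc d × Sph d → ℝ),
        AEStronglyMeasurable S₀ (phaseTimeMeasure Ω T) →
        AEStronglyMeasurable S₀t (phaseTimeMeasure Ω T) →
        HasWeakTimeDeriv Ω T S₀ S₀t →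
        (∀ᵐ p ∂phaseTimeMeasure Ω T, |S₀ p| ≤ c₃) →
        (∀ᵐ p ∂phaseTimeMeasure Ω T, |S₀t p| ≤ c₃) →
        HasInitialValue Ω S₀ S₀init →
        (∀ᵐ q ∂phaseMeasure Ω, q.2 ∈ velocitySet γ γ₀ → c₁ ≤ S₀init q ∧ S₀init q ≤ c₂) →
        (∀ᵐ q ∂phaseMeasure Ω, q.2 ∉ velocitySet γ γ₀ → S₀init q = 0) →
      ∀ (f ft ftt Xf Xft : ℝ × Euc d × Sph d → ℝ),
        IsSolution Ω T σ μ (fun p => Stil p.2 * S₀ p) f₀ f ft ftt Xf Xft →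
        eLpNorm Stil 2 (phaseMeasure Ω) ≤
          ENNReal.ofReal C *
            (eLpNorm (outgoingTrace ft) 2 (outgoingMeasure Ω T) +
              eLpNorm f₀ 2 (phaseMeasure Ω) + eLpNorm Xf₀ 2 (phaseMeasure Ω)) := by
  have hprob := isProbabilityMeasure_sphereMeasure hd
  have hT0 : 0 < T := Metric.diam_nonneg.trans_lt hT
  have hfinP := isFiniteMeasure_phaseMeasure hbdd
  -- No sign of M or m is given, so absolute values serve as bounds. The estimate `key` is one for
  -- squares, hence the constant √C.
  obtain ⟨C, hC, key⟩ := exists_stability_constant (γ₀ := γ₀) (c₁ := c₁) (c₂ := c₂) (c₃ := c₃)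
    hne hopen hbdd hconv hsmooth γ hβ hβγ hT0 hTβ |M| |m| hc₁ hc₂
  refine ⟨√C, Real.sqrt_pos.mpr hC, ?_⟩
  intro σ μ hadm _ _ _ _ _ _ _ _ hμV f₀ Xf₀ _ hf₀ hXf₀ _ hw₀ _ _ Stil hStil heven hzero S₀ S₀t
    S₀init hS₀m hS₀tm hS₀w hS₀ hS₀t hS₀i hS₀V hS₀0 f ft ftt Xf Xft h
  -- An infinite norm of the trace makes the right side infinite, so no a priori bound for the trace
  -- is required.
  by_cases hfin : eLpNorm (outgoingTrace ft) 2 (outgoingMeasure Ω T) = ⊤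
  · rw [hfin, top_add, top_add, ENNReal.mul_top (by simpa using hC)]
    exact le_top
  have hV := measurableSet_velocitySet γ γ₀
  have hf₀2 : MemLp f₀ 2 (phaseMeasure Ω) := hf₀.mono_exponent le_top
  have hXf₀2 : MemLp Xf₀ 2 (phaseMeasure Ω) := hXf₀.mono_exponent le_top
  have hStil2 : MemLp Stil 2 (phaseMeasure Ω) := hStil.mono_exponent le_top
  obtain ⟨σ', hσm, hσ, hσM⟩ := exists_stronglyMeasurable_bounded hadm.sigma_meas (abs_nonneg M)
    (hadm.sigma_bound.mono fun q hq => (abs_of_nonneg hq.1).trans_le (hq.2.trans (le_abs_self M)))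
  obtain ⟨μ₁, hμ₁m, hμ₁, hμ₁M⟩ := exists_stronglyMeasurable_bounded hadm.mu_meas (abs_nonneg m)
    (hadm.mu_bound.mono fun r hr => (abs_of_nonneg hr.1).trans_le (hr.2.trans (le_abs_self m)))
  obtain ⟨N, Stil', hSm, hS, hSN⟩ := exists_stronglyMeasurable_bounded_of_memLp_top hStil
  obtain ⟨S₀t', hS₀tm', hS₀t', hS₀tM⟩ := exists_stronglyMeasurable_bounded hS₀tm hc₃.le hS₀t
  obtain ⟨f₀', hf₀m, hf₀'⟩ := hf₀.aestronglyMeasurable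
  obtain ⟨Xf₀', hXf₀m, hXf₀'⟩ := hXf₀.aestronglyMeasurable
  -- The cut-off yields a representative of `μ` that vanishes for every v outside V rather than
  -- almost every one, as `IsBoundedData` demands.
  obtain ⟨A, hVm, hA⟩ : ∃ A : Set (Euc d × Sph d × Sph d), MeasurableSet A ∧
      ∀ r, r ∈ A ↔ r.2.2 ∈ velocitySet γ γ₀ :=
    ⟨_, (show Measurable fun r : Euc d × Sph d × Sph d => r.2.2 by fun_prop) hV, fun _ => Iff.rfl⟩
  have hμ' : μ =ᵐ[scatteringMeasure Ω] A.indicator μ₁ := by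
    filter_upwards [hμ₁, hμV] with r e1 e2
    by_cases hr : r ∈ A
    · rw [indicator_of_mem hr, e1]
    · rw [indicator_of_notMem hr, e2 (mt (hA r).mpr hr)]
  have hμM' : ∀ r, |A.indicator μ₁ r| ≤ |m| := by
    intro r
    by_cases hr : r ∈ A
    · rw [indicator_of_mem hr]
      exact hμ₁M r
    · simp [indicator_of_notMem hr]
  have D : IsBoundedData Ω γ γ₀ |M| |m| N c₃ σ' Stil' (A.indicator μ₁) S₀t' :=
    { sigma_meas := hσm
      sigma_nonneg := by
        filter_upwards [hσ, hadm.sigma_bound] with q e1 e2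
        exact e1 ▸ e2.1
      sigma_le := hσM
      mu_meas := hμ₁m.indicator hVm
      mu_le := hμM'
      mu_zero := fun r hr => indicator_of_notMem (mt (hA r).mp hr) _
      source_meas := hSm
      source_le := hSN
      rate_le := hS₀tM }
  have hX2' := hXf₀2.ae_eq hXf₀'
  obtain ⟨u₀, U, W, F, hft, hder⟩ := exists_isDerivedSolution hopen hbdd hconv hsmooth hT0 hσm hσ
    hσM D.mu_meas hμ' hμM' hSm hS hSN hS₀m hc₃.le hS₀ hS₀tm' hS₀t' hS₀tM hS₀w hS₀i hf₀' hXf₀'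
    (hX2'.integrable one_le_two) hw₀ h
  have heven' : ∀ᵐ q ∂phaseMeasure Ω, Stil' q = Stil' (q.1, -q.2) := by
    filter_upwards [hS, (measurePreserving_reflection Ω).quasiMeasurePreserving.ae hS, heven]
      with q e1 e2 e3
    rw [← e1, ← e2, e3]
  have hzero' : ∀ᵐ q ∂phaseMeasure Ω, |inner ℝ γ (q.2 : Euc d)| ≤ γ₀ → Stil' q = 0 := by
    filter_upwards [hS, hzero] with q e1 e2 hq
    rw [← e1, e2 hq]
  have hmain := key hder D hf₀m (hf₀2.ae_eq hf₀') hXf₀m hX2' hS₀V hS₀0 heven' hzero' hft hfin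
  rw [eLpNorm_congr_ae hS, eLpNorm_congr_ae hf₀', eLpNorm_congr_ae hXf₀']
  exact eLpNorm_two_le_of_integral_sq_le (hStil2.ae_eq hS) (hf₀2.ae_eq hf₀') hX2' hC.le hfin hmain
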